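/- Let $\mathcal R$ be a discrete valuation ring with maximal ideal $I$, uniformizer $s$ and fraction field $K$, let $S=\operatorname{Spec}\mathcal R$, and let $X\simeq\mathbb Z^r$, $r\ge 1$. Let $a:X\to K^*$ and a bilinear $b:X\times X\to K^*$ be given with $b(x,y)=a(x+y)a(x)^{-1}a(y)^{-1}$ and $b(x,x)\in I$ for $x\neq0$ (degeneration data in the maximally degenerate, principally polarized case). Let $A(x)$ and $B(x,y)$ be the valuations of $a(x)$ and $b(x,y)$. Then $B$ is bilinear and positive definite, and $A(x)=B(x,x)/2+l(x)/2$ with $l\in X^*$; for $\alpha\in X_{\mathbb R}=X\otimes\mathbb R$ put $dA(\alpha)=B(\alpha,\cdot)+l/2\in X_{\mathbb R}^*$. A Delaunay cell is the convex hull of all lattice elements nearest, for the norm $\|\cdot\|_B$, to some $\alpha\in X_{\mathbb R}$. The dual Voronoi cell $\hat\sigma$ of a Delaunay cell $\sigma$ is the closure of the set of all $\alpha$ that define $\sigma$; the Voronoi cells form the decomposition $\operatorname{Vor}_B$. A maximal-dimensional Delaunay cell $\sigma$ is defined by a unique $\alpha$, its hole $\alpha(\sigma)$. For $c,x\in X$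 let $\eta(x,c)$ be the maximum of the numbers $dA(\alpha(\sigma))(x)$ over the maximal-dimensional Delaunay cells $\sigma\ni c$. Let $M=X\oplus\mathbb Z e_0$ and $N=X^*\oplus\mathbb Z f_0$ be dual lattices; elements of $N_{\mathbb R}$ are written with the $f_0$-coordinate first. Let $Q\subset M_{\mathbb R}$ be the convex hull of the points $(x,A(x))$, $x\in X$. Let $R\subset K[\vartheta,w^x;x\in X]$ be the $\mathcal R$-algebra generated by all monomials $s^{x_0}w^x\vartheta^d$ such that $(d,x,x_0)\in\mathbb Z\oplus M$ lies in the cone over $(1,Q)$ (the saturation of the $\mathcal R$-algebra generated by the elements $a(x)w^x\vartheta$), graded by the degree in $\vartheta$. Let $\widetilde P=\operatorname{Proj}R$ and $\widetilde{\mathcal L}=\mathcal O(1)$, and put $\zeta_c=s^{A(c)}w^c\vartheta\in R_1$. For a cone $\sigma\subset N_{\mathbb R}$, the affine torus embedding over $S$ given by $\sigma$ is the spectrum of the $\mathcal R$-subalgebra of $K[w^x;x\in X]$ generated by the monomials $s^{x_0}w^x$ with $(x,x_0)\in M$ in the dual cone of $\sigma$; the torus embedding given by a fan is obtained by gluing the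 affine ones along the intersections of cones. Then: (i) $\widetilde P$ is covered by the open subschemes $D_+(\zeta_c)\simeq U(c)=\operatorname{Spec}R(c)$, $c\in X$, where $R(c)\subset K[w^x;x\in X]$ is the $\mathcal R$-algebra generated by the monomials $s^{x_0}w^x$ with $(x,x_0)\in M$ and $x_0\ge\eta(x,c)$, and the isomorphism is given by the identification of the fractions $f/\zeta_c^n$, $f\in R_n$, with elements of $K[w^x;x\in X]$. The condition $x_0\ge\eta(x,c)$ describes the lattice elements of the cone of $Q$ at its vertex $(c,A(c))$. (ii) $R(c)$ is a free $\mathcal R$-module with the basis $\zeta_{x,c}=s^{\lceil\eta(x,c)\rceil}w^x$, $x\in X$. (iii) All $\mathcal R$-algebras $R(c)$ are isomorphic to each other, and each is finitely generated. The scheme $\widetilde P$ is locally of finite type over $\mathcal R$. (iv) $\operatorname{Spec}R(c)$ is the affine torus embedding over $S$ given by the cone $\Delta(c)$ over $(1,-dA(\hat c))$, where $\hat c$ is the Voronoi cell dual to $c$. (v) The set $\Delta$ consisting of $\{0\}$ and the cones over the cells of the shifted Voronoi decomposition $(1,-dA(\operatorname{Vor}_B))$ is a fan in $N_{\mathbb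 R}$, and $\widetilde P$ is the torus embedding $T_N\operatorname{emb}\Delta$, compatibly with the identifications in (i) and (iv). The morphism $\widetilde P\to S$ is described by the map of fans from $\Delta$ to the half-line $\mathbb R_{\ge0}f_0$. (vi) $\widetilde{\mathcal L}$ is invertible and ample, ample in the sense that the affine open sets $\widetilde P_t$, for global sections $t$ of $\widetilde{\mathcal L}^{\otimes n}$, $n\ge1$, form a basis of the topology ($\widetilde P$ is not quasi-compact). (vii) The torus $T=\operatorname{Spec}\mathcal R[w^x;x\in X]$ acts on $\widetilde P$ over $S$, and $T\times\mathbb G_m$ acts on $\widetilde{\mathcal L}$ compatibly with the action of $T$ on $\widetilde P$ (a linearization for the action of $T\times\mathbb G_m$ on $\widetilde P$ through $T$). These actions are given by the $X$-gradings of the algebras $R(c)$ and by the $(X\oplus\mathbb Z)$-grading of $R$. -/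

import Mathlib

open CategoryTheory AlgebraicGeometry
open scoped TensorProduct

universe u

set_option linter.unusedSectionVars false
set_option linter.unusedSimpArgs false

namespace MaxDegeneration

noncomputable section

/-! ### Degeneration data in the maximally degenerate, principally polarized case -/

/-- The valuation `Kˣ → ℤ` of the fraction field `K` of a discrete valuation ring `𝓡`, normalized
so that a uniformizer has valuation `1`. -/
def ord (𝓡 : Type u) [CommRing 𝓡] [IsDomain 𝓡] [IsDiscreteValuationRing 𝓡]
    {K : Type u} [Field K] [Algebra 𝓡 K] [IsFractionRing 𝓡 K] (z : Kˣ) : ℤ :=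
  -Multiplicative.toAdd ((IsDiscreteValuationRing.maximalIdeal 𝓡).valuationOfNeZero z)

/-- Degeneration data with trivial abelian part, on the lattice `X` (identified with `Y` through
the isomorphism `φ : Y ≃ X` given by the principal polarization): a function `a : X → Kˣ` and a
bilinear `b : X × X → Kˣ` with `b(x, y) = a(x + y) a(x)⁻¹ a(y)⁻¹` and `b(x, x) ∈ I` for
`x ≠ 0`, where `I` is the maximal ideal of the discrete valuation ring. -/
structure DegenerationData (𝓡 : Type u) [CommRing 𝓡] [IsDomain 𝓡] [IsDiscreteValuationRing 𝓡]
    (K : Type u) [Field K] [Algebra 𝓡 K] [IsFractionRing 𝓡 K] (X : Type u) [AddCommGroup X] where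
  /-- the trivialization `ψ` -/
  a : X → Kˣ
  /-- the trivialization `τ` -/
  b : X → X → Kˣ
  b_add_left : ∀ x x' y, b (x + x') y = b x y * b x' y
  b_add_right : ∀ x y y', b x (y + y') = b x y * b x y'
  b_eq : ∀ x y, b x y = a (x + y) * (a x)⁻¹ * (a y)⁻¹
  pos : ∀ x, x ≠ 0 → ∃ r ∈ IsLocalRing.maximalIdeal 𝓡, algebraMap 𝓡 K r = b x x

section Ord

variable {𝓡 : Type u} [CommRing 𝓡] [IsDomain 𝓡] [IsDiscreteValuationRing 𝓡]
  {K : Type u} [Field K] [Algebra 𝓡 K] [IsFractionRing 𝓡 K]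

lemma ord_mul (z w : Kˣ) : ord 𝓡 (z * w) = ord 𝓡 z + ord 𝓡 w := by
  simp [ord]; ring

lemma ord_inv (z : Kˣ) : ord 𝓡 z⁻¹ = -ord 𝓡 z := by
  simp [ord]

end Ord

namespace DegenerationData

variable {𝓡 : Type u} [CommRing 𝓡] [IsDomain 𝓡] [IsDiscreteValuationRing 𝓡]
  {K : Type u} [Field K] [Algebra 𝓡 K] [IsFractionRing 𝓡 K] {X : Type u} [AddCommGroup X]
  (D : DegenerationData 𝓡 K X)

/-- `A(x)`, the valuation of `a(x)`. -/
def A (x : X) : ℤ := ord 𝓡 (D.a x)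

/-- `B(x, y)`, the valuation of `b(x, y)`, a bilinear form on `X` (the monodromy pairing). -/
def B : LinearMap.BilinForm ℤ X :=
  (AddMonoidHom.mk' (fun x => (AddMonoidHom.mk' (fun y => ord 𝓡 (D.b x y)) (fun y y' => by
    rw [D.b_add_right, ord_mul])).toIntLinearMap) (fun x x' => by
    ext y
    change ord 𝓡 (D.b (x + x') y) = ord 𝓡 (D.b x y) + ord 𝓡 (D.b x' y)
    rw [D.b_add_left, ord_mul])).toIntLinearMap

lemma B_apply (x y : X) : D.B x y = ord 𝓡 (D.b x y) := rfl

lemma A_add (x y : X) : D.A (x + y) = D.A x + D.A y + D.B x y := by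
  rw [B_apply, D.b_eq, ord_mul, ord_mul, ord_inv, ord_inv]
  simp only [A]; ring

lemma B_symm (x y : X) : D.B x y = D.B y x := by
  have h1 := D.A_add x y
  have h2 := D.A_add y x
  rw [add_comm y x] at h2
  linarith

/-- The linear form `l` on `X` with `A(x) = B(x, x)/2 + l(x)/2`. -/
def l : X →ₗ[ℤ] ℤ :=
  (AddMonoidHom.mk' (fun x => 2 * D.A x - D.B x x) (fun x y => by
    have h := D.B_symm x y
    simp only [D.A_add, map_add, LinearMap.add_apply]
    linarith)).toIntLinearMap

end DegenerationData

/-! ### The lattices and their real extensions -/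

/-- `X_ℝ = X ⊗ ℝ`. -/
abbrev RealSpan (X : Type u) [AddCommGroup X] : Type u := ℝ ⊗[ℤ] X

/-- The inclusion `X → X_ℝ`. -/
def lat {X : Type u} [AddCommGroup X] (x : X) : RealSpan X := (1 : ℝ) ⊗ₜ[ℤ] x

/-- `N_ℝ = ℝ f₀ ⊕ X_ℝ^*`, where `N = ℤ f₀ ⊕ X^*` is the dual of the lattice `M = X ⊕ ℤ e₀`.
Its elements are written with the `f₀`-coordinate first. -/
abbrev NR (X : Type u) [AddCommGroup X] : Type u := ℝ × Module.Dual ℝ (RealSpan X)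

/-- The pairing of `v ∈ N_ℝ` with the element `(x, x₀)` of `M = X ⊕ ℤ e₀`. -/
def pairing {X : Type u} [AddCommGroup X] (v : NR X) (x : X) (x₀ : ℤ) : ℝ :=
  v.1 * x₀ + v.2 (lat x)

/-- The lattice `N` inside `N_ℝ`: the vectors that pair integrally with `M`. -/
def latticeN (X : Type u) [AddCommGroup X] : Set (NR X) :=
  {v | ∀ (x : X) (x₀ : ℤ), ∃ n : ℤ, pairing v x x₀ = n}

namespace DegenerationData

variable {𝓡 : Type u} [CommRing 𝓡] [IsDomain 𝓡] [IsDiscreteValuationRing 𝓡]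
  {K : Type u} [Field K] [Algebra 𝓡 K] [IsFractionRing 𝓡 K] {X : Type u} [AddCommGroup X]
  (D : DegenerationData 𝓡 K X)

/-- The extension of `B` to `X_ℝ`. -/
def BR : LinearMap.BilinForm ℝ (RealSpan X) := D.B.baseChange ℝ

/-- The extension of `l` to `X_ℝ`. -/
def lR : Module.Dual ℝ (RealSpan X) :=
  (TensorProduct.AlgebraTensorModule.rid ℤ ℝ ℝ).toLinearMap ∘ₗ D.l.baseChange ℝ

lemma BR_lat (x y : X) : D.BR (lat x) (lat y) = D.B x y := by
  simp [BR, lat]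

lemma lR_lat (x : X) : D.lR (lat x) = D.l x := by
  simp [lR, lat]

/-- `‖v‖_B`. -/
def normB (v : RealSpan X) : ℝ := Real.sqrt (D.BR v v)

/-! ### Delaunay and Voronoi decompositions -/

/-- `x ∈ X` is `α`-nearest. -/
def IsNearest (α : RealSpan X) (x : X) : Prop :=
  ∀ x' : X, D.normB (lat x - α) ≤ D.normB (lat x' - α)

/-- The Delaunay cell defined by `α`: the convex hull of the (finitely many) `α`-nearest lattice
elements. -/
def delaunayCell (α : RealSpan X) : Set (RealSpan X) :=
  convexHull ℝ (lat '' {x | D.IsNearest α x})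

/-- The Delaunay decomposition `Del_B`. -/
def Del : Set (Set (RealSpan X)) := Set.range D.delaunayCell

/-- The Voronoi cell dual to the Delaunay cell `σ`: the closure of the set of all `α` defining `σ`,
for the canonical topology of the finite-dimensional real vector space `X_ℝ`. -/
def voronoiCell (σ : Set (RealSpan X)) : Set (RealSpan X) :=
  @closure (RealSpan X) (moduleTopology ℝ (RealSpan X)) {α | D.delaunayCell α = σ}

/-- The Voronoi decomposition `Vor_B`. -/
def Vor : Set (Set (RealSpan X)) := D.voronoiCell '' D.Del

/-- `α` is the hole of a maximal-dimensional Delaunay cell that contains the lattice element `c`. -/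
def IsHoleAt (c : X) (α : RealSpan X) : Prop :=
  affineSpan ℝ (D.delaunayCell α) = ⊤ ∧ lat c ∈ D.delaunayCell α

/-- `dA(α) = B(α, ·) + l/2 ∈ X_ℝ^*`. -/
def dA (α : RealSpan X) : Module.Dual ℝ (RealSpan X) := D.BR α + (1 / 2 : ℝ) • D.lR

/-- The values at `x` of the linear functions `dA(α(σ))`, for the maximal-dimensional Delaunay
cells `σ` containing `c`. -/
def slopes (x c : X) : Set ℝ := {t | ∃ α, D.IsHoleAt c α ∧ t = D.dA α (lat x)}

/-- `η(x, c)`: the largest of the numbers `dA(α(σ))(x)`, for the maximal-dimensional Delaunay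
cells `σ` containing `c`. -/
def eta (x c : X) : ℝ := sSup (D.slopes x c)

/-- The multifaceted paraboloid `Q ⊂ X_ℝ ⊕ ℝ e₀`: the convex hull of the points `(x, A(x))`. -/
def Q : Set (RealSpan X × ℝ) :=
  convexHull ℝ (Set.range fun x : X => ((lat x, (D.A x : ℝ)) : RealSpan X × ℝ))

/-- The cone over `Q`, placed in the hyperplane `(1, M_ℝ)` of `ℝ ⊕ M_ℝ`. -/
def coneQ : Set (ℝ × RealSpan X × ℝ) := {v | ∃ t : ℝ, 0 ≤ t ∧ ∃ q ∈ D.Q, v = (t, t • q)}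

/-- The shifted embedding `α ↦ (1, -dA(α))` of `X_ℝ` in the hyperplane `(1, N₀)` of `N_ℝ`. -/
def shift (α : RealSpan X) : NR X := (1, -D.dA α)

/-- The cone over the shift `(1, -dA(F))` of a subset `F` of `X_ℝ`. -/
def shiftedCone (F : Set (RealSpan X)) : PointedCone ℝ (NR X) := PointedCone.hull ℝ (D.shift '' F)

/-- The cone `Δ(c)` over `(1, -dA(ĉ))`, where `ĉ` is the Voronoi cell dual to `c ∈ X`. -/
def coneAt (c : X) : PointedCone ℝ (NR X) := D.shiftedCone (D.voronoiCell {lat c})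

/-- The fan `Δ`: the zero cone and the cones over the cells of the shifted Voronoi decomposition
`(1, -dA(Vor_B))`. -/
def fan : Set (PointedCone ℝ (NR X)) := {⊥} ∪ D.shiftedCone '' D.Vor

end DegenerationData

/-! ### Fans and torus embeddings over a discrete valuation ring -/

/-- `Δ` is a (possibly infinite) fan in `N_ℝ`: a nonempty collection of strongly convex rational
polyhedral cones, closed under passing to faces, in which any two cones meet in a common face. -/
structure IsFan {X : Type u} [AddCommGroup X] (Δ : Set (PointedCone ℝ (NR X))) : Prop where
  nonempty : Δ.Nonempty
  rational : ∀ σ ∈ Δ, ∃ s : Finset (NR X), (s : Set (NR X)) ⊆ latticeN X ∧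
    σ = PointedCone.hull ℝ (s : Set (NR X))
  strongly_convex : ∀ σ ∈ Δ, ∀ v ∈ σ, -v ∈ σ → v = 0
  face : ∀ σ ∈ Δ, ∀ τ : PointedCone ℝ (NR X), τ.IsFaceOf σ → τ ∈ Δ
  inter : ∀ σ ∈ Δ, ∀ τ ∈ Δ, (σ ⊓ τ).IsFaceOf σ ∧ (σ ⊓ τ).IsFaceOf τ

section Toric

variable (𝓡 : Type u) [CommRing 𝓡] {K : Type u} [Field K] [Algebra 𝓡 K] (s : 𝓡)
  {X : Type u} [AddCommGroup X]

/-- The monomial `s^{x₀} w^x` in `K[w^x ; x ∈ X]`. -/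
def monomial (K : Type u) [Field K] [Algebra 𝓡 K] (x : X) (x₀ : ℤ) : AddMonoidAlgebra K X :=
  AddMonoidAlgebra.single x (algebraMap 𝓡 K s ^ x₀)

/-- The `𝓡`-algebra of the affine torus embedding over `𝓡` given by a cone `σ ⊂ N_ℝ`: it is
generated by the monomials `s^{x₀} w^x` with `(x, x₀)` in the dual cone of `σ`. -/
def coneAlgebra (K : Type u) [Field K] [Algebra 𝓡 K] (σ : PointedCone ℝ (NR X)) :
    Subalgebra 𝓡 (AddMonoidAlgebra K X) :=
  Algebra.adjoin 𝓡 {m | ∃ (x : X) (x₀ : ℤ), (∀ v ∈ σ, 0 ≤ pairing v x x₀) ∧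
    m = monomial 𝓡 s K x x₀}

lemma coneAlgebra_anti {σ τ : PointedCone ℝ (NR X)} (h : τ ≤ σ) :
    coneAlgebra 𝓡 s K σ ≤ coneAlgebra 𝓡 s K τ := by
  refine Algebra.adjoin_mono ?_
  rintro m ⟨x, x₀, hσ, rfl⟩
  exact ⟨x, x₀, fun v hv => hσ v (h hv), rfl⟩

end Toric

/-! ### The graded algebra `R` -/

namespace DegenerationData

variable {𝓡 : Type u} [CommRing 𝓡] [IsDomain 𝓡] [IsDiscreteValuationRing 𝓡]
  {K : Type u} [Field K] [Algebra 𝓡 K] [IsFractionRing 𝓡 K] {X : Type u} [AddCommGroup X]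
  (D : DegenerationData 𝓡 K X) (s : 𝓡)

/-- The monomial `s^{x₀} w^x ϑ^d` in `K[ϑ, w^x ; x ∈ X]`. -/
def gradedMonomial (𝓡 : Type u) [CommRing 𝓡] (K : Type u) [Field K] [Algebra 𝓡 K] (s : 𝓡)
    {X : Type u} [AddCommGroup X] (d : ℕ) (x : X) (x₀ : ℤ) : AddMonoidAlgebra K (ℕ × X) :=
  AddMonoidAlgebra.single (d, x) (algebraMap 𝓡 K s ^ x₀)

/-- The saturated algebra `R ⊂ K[ϑ, w^x ; x ∈ X]`: the `𝓡`-algebra generated by the monomials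
`s^{x₀} w^x ϑ^d` that correspond to the lattice vectors `(d, x, x₀)` of `ℤ ⊕ M` in `Cone(Q)`. -/
def satAlgebra : Subalgebra 𝓡 (AddMonoidAlgebra K (ℕ × X)) :=
  Algebra.adjoin 𝓡 {m | ∃ (d : ℕ) (x : X) (x₀ : ℤ),
    (((d : ℝ), lat x, (x₀ : ℝ)) : ℝ × RealSpan X × ℝ) ∈ D.coneQ ∧
    m = gradedMonomial 𝓡 K s d x x₀}

/-- The homogeneous elements of `R` of degree `d` in `ϑ`. -/
def grade (d : ℕ) : Submodule 𝓡 (D.satAlgebra s) where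
  carrier := {f | ∀ p ∈ (f : AddMonoidAlgebra K (ℕ × X)).coeff.support, p.1 = d}
  zero_mem' := by simp
  add_mem' := by
    classical
    intro f g hf hg p hp
    rcases Finset.mem_union.1 (Finsupp.support_add hp) with h | h
    exacts [hf p h, hg p h]
  smul_mem' := by
    intro c f hf p hp
    exact hf p (Finsupp.support_smul hp)

/-- The part of degree `d` of an element of `K[ϑ, w^x ; x ∈ X]`. -/
def degreePart (𝓡 : Type u) [CommRing 𝓡] {K : Type u} [Field K] [Algebra 𝓡 K] {X : Type u}
    [AddCommGroup X] (d : ℕ) : AddMonoidAlgebra K (ℕ × X) →ₗ[𝓡] AddMonoidAlgebra K (ℕ × X) where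
  toFun f := AddMonoidAlgebra.ofCoeff (f.coeff.filter fun p => p.1 = d)
  map_add' f g := by
    ext p
    simp [Finsupp.filter_add]
  map_smul' c f := by
    ext p
    by_cases h : p.1 = d <;> simp [h, Finsupp.filter_apply]

lemma degreePart_apply (d : ℕ) (f : AddMonoidAlgebra K (ℕ × X)) (p : ℕ × X) :
    (degreePart 𝓡 d f).coeff p = if p.1 = d then f.coeff p else 0 := by
  simp [degreePart, Finsupp.filter_apply]

lemma degreePart_mem (d : ℕ) {f : AddMonoidAlgebra K (ℕ × X)} (hf : f ∈ D.satAlgebra s) :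
    degreePart 𝓡 d f ∈ D.satAlgebra s := by
  have key : Subalgebra.toSubmodule (D.satAlgebra s) ≤
      (Subalgebra.toSubmodule (D.satAlgebra s)).comap (degreePart 𝓡 d) := by
    conv_lhs => rw [satAlgebra, Algebra.adjoin_eq_span]
    rw [Submodule.span_le]
    intro m hm
    have hm' : m ∈ D.satAlgebra s :=
      (Submonoid.closure_le (S := (D.satAlgebra s).toSubmonoid)).2 Algebra.subset_adjoin hm
    have hs : ∃ (p : ℕ × X) (k : K), m = AddMonoidAlgebra.single p k := by
      induction hm using Submonoid.closure_induction with
      | mem m h => obtain ⟨e, x, x₀, -, rfl⟩ := h; exact ⟨_, _, rfl⟩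
      | one => exact ⟨0, 1, rfl⟩
      | mul m n _ _ ihm ihn =>
        obtain ⟨p, k, rfl⟩ := ihm ((Submonoid.closure_le (S := (D.satAlgebra s).toSubmonoid)).2
          Algebra.subset_adjoin ‹_›)
        obtain ⟨q, k', rfl⟩ := ihn ((Submonoid.closure_le (S := (D.satAlgebra s).toSubmonoid)).2
          Algebra.subset_adjoin ‹_›)
        exact ⟨p + q, k * k', by rw [AddMonoidAlgebra.single_mul_single]⟩
    obtain ⟨p, k, rfl⟩ := hs
    change degreePart 𝓡 d _ ∈ D.satAlgebra s
    by_cases hp : p.1 = d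
    · have : degreePart 𝓡 d (AddMonoidAlgebra.single p k) = AddMonoidAlgebra.single p k := by
        ext q
        rw [degreePart_apply]
        by_cases hq : p = q
        · subst hq; simp [hp]
        · simp [AddMonoidAlgebra.coeff_single, Finsupp.single_apply, hq]
      rwa [this]
    · have : degreePart 𝓡 d (AddMonoidAlgebra.single p k) = 0 := by
        ext q
        rw [degreePart_apply]
        by_cases hq : p = q
        · subst hq; simp [hp]
        · simp [AddMonoidAlgebra.coeff_single, Finsupp.single_apply, hq]
      rw [this]
      exact zero_mem _
  exact key hf

lemma degreePart_mem_grade (d : ℕ) (f : D.satAlgebra s) :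
    (⟨degreePart 𝓡 d f.1, D.degreePart_mem s d f.2⟩ : D.satAlgebra s) ∈ D.grade s d := by
  intro p hp
  by_contra h
  apply Finsupp.mem_support_iff.1 hp
  simp [degreePart_apply, h]

lemma degreePart_of_mem {d e : ℕ} {f : D.satAlgebra s} (hf : f ∈ D.grade s e) :
    degreePart 𝓡 d (f : AddMonoidAlgebra K (ℕ × X)) = if e = d then f.1 else 0 := by
  ext p
  rw [degreePart_apply]
  by_cases hp : p ∈ f.1.coeff.support
  · have := hf p hp
    subst this
    split_ifs <;> simp
  · rw [Finsupp.notMem_support_iff.1 hp]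
    split_ifs <;> simp [Finsupp.notMem_support_iff.1 hp]

lemma degreePart_coe (d : ℕ) (x : DirectSum ℕ fun i => D.grade s i) :
    degreePart 𝓡 d ((DirectSum.coeAddMonoidHom (D.grade s) x : D.satAlgebra s) :
      AddMonoidAlgebra K (ℕ × X)) = (x d : D.satAlgebra s) := by
  classical
  induction x using DirectSum.induction_on with
  | zero => simp
  | of i x =>
    rw [DirectSum.coeAddMonoidHom_of, D.degreePart_of_mem s x.2]
    by_cases h : i = d
    · subst h; simp
    · simp [h, DirectSum.of_eq_of_ne _ _ _ (Ne.symm h)]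
  | add x y hx hy => simp [hx, hy]

instance gradedRing : GradedAlgebra (D.grade s) where
  one_mem := by
    intro p hp
    have : p = 0 := by
      by_contra h
      apply Finsupp.mem_support_iff.1 hp
      simp [AddMonoidAlgebra.one_def, AddMonoidAlgebra.coeff_single, Finsupp.single_apply,
        Ne.symm h]
    rw [this]; rfl
  mul_mem := by
    classical
    intro i j f g hf hg p hp
    have h := AddMonoidAlgebra.support_coeff_mul_subset (f : AddMonoidAlgebra K (ℕ × X)) g.1 hp
    obtain ⟨q, hq, r, hr, rfl⟩ := Finset.mem_add.1 h
    rw [Prod.fst_add, hf q hq, hg r hr]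
  decompose' f := DirectSum.mk (fun i => D.grade s i) (f.1.coeff.support.image Prod.fst)
    fun d => ⟨⟨degreePart 𝓡 d f.1, D.degreePart_mem s d f.2⟩, D.degreePart_mem_grade s d f⟩
  left_inv := by
    intro f
    apply Subtype.ext
    ext p
    have := congrArg (fun z => AddMonoidAlgebra.coeff z p) (D.degreePart_coe s p.1
      (DirectSum.mk (fun i => D.grade s i) (f.1.coeff.support.image Prod.fst)
    fun d => ⟨⟨degreePart 𝓡 d f.1, D.degreePart_mem s d f.2⟩, D.degreePart_mem_grade s d f⟩))
    simp only [degreePart_apply, if_true] at this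
    rw [this]
    by_cases hp : p.1 ∈ f.1.coeff.support.image Prod.fst
    · rw [DirectSum.mk_apply_of_mem hp]
      simp [degreePart_apply]
    · rw [DirectSum.mk_apply_of_notMem hp]
      have : f.1.coeff p = 0 := by
        by_contra h
        exact hp (Finset.mem_image_of_mem _ (Finsupp.mem_support_iff.2 h))
      simp [this]
  right_inv := by
    intro x
    refine DFinsupp.ext fun d => ?_
    apply Subtype.ext; apply Subtype.ext
    rw [← D.degreePart_coe s d x]
    by_cases hp : d ∈ (DirectSum.coeAddMonoidHom (D.grade s) x).1.coeff.support.image Prod.fst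
    · rw [DirectSum.mk_apply_of_mem hp]
    · rw [DirectSum.mk_apply_of_notMem hp]
      ext p
      rw [degreePart_apply]
      by_cases h : p.1 = d
      · have : (DirectSum.coeAddMonoidHom (D.grade s) x).1.coeff p = 0 := by
          by_contra h'
          exact hp (Finset.mem_image.2 ⟨p, Finsupp.mem_support_iff.2 h', h⟩)
        simp [this]
      · simp [h]

/-- The generator `ζ_c = s^{A(c)} w^c ϑ` of `R`. -/
def zeta (c : X) : D.satAlgebra s :=
  ⟨gradedMonomial 𝓡 K s 1 c (D.A c), Algebra.subset_adjoin ⟨1, c, D.A c,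
    ⟨1, zero_le_one, (lat c, (D.A c : ℝ)), subset_convexHull ℝ _ ⟨c, rfl⟩, by simp⟩, rfl⟩⟩

lemma zeta_mem (c : X) : D.zeta s c ∈ D.grade s 1 := by
  intro p hp
  have : p = (1, c) := by
    by_contra h
    apply Finsupp.mem_support_iff.1 hp
    simp [zeta, gradedMonomial, AddMonoidAlgebra.coeff_single, Finsupp.single_apply, Ne.symm h]
  rw [this]

/-- The algebra `R(c)` of the cone at the vertex `c` of `Q`: the `𝓡`-subalgebra of
`K[w^x ; x ∈ X]` generated by the monomials `s^{x₀} w^x` with `x₀ ≥ η(x, c)`. -/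
def vertexAlgebra (c : X) : Subalgebra 𝓡 (AddMonoidAlgebra K X) :=
  Algebra.adjoin 𝓡 {m | ∃ (x : X) (x₀ : ℤ), D.eta x c ≤ x₀ ∧ m = monomial 𝓡 s K x x₀}

end DegenerationData

/-! ### Serre's twisting sheaves on `Proj` -/

namespace SerreTwist

variable {A : Type u} {σ : Type*} [CommRing A] [SetLike σ A] [AddSubgroupClass σ A]
  (𝒜 : ℕ → σ) [GradedRing 𝒜] (n : ℕ)

open TopologicalSpace Opposite

/-- The localization of `A` at the prime ideal of a point of `Proj A`. -/
abbrev Fiber (x : ProjectiveSpectrum 𝒜) : Type u :=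
  Localization.AtPrime x.asHomogeneousIdeal.toIdeal

lemma mul_notMem (x : ProjectiveSpectrum 𝒜) {t t' : A} (h : t ∉ x.asHomogeneousIdeal.toIdeal)
    (h' : t' ∉ x.asHomogeneousIdeal.toIdeal) : t * t' ∉ x.asHomogeneousIdeal.toIdeal :=
  fun hm => (x.isPrime.mem_or_mem hm).elim h h'

/-- A function on `U` given by one fraction `r / t` with `r`, `t` homogeneous and
`deg r = deg t + n`. -/
def isFractionPrelocal : TopCat.PrelocalPredicate (X := ProjectiveSpectrum.top 𝒜) (Fiber 𝒜) where
  pred {U} f := ∃ (i : ℕ) (r t : A) (_ : r ∈ 𝒜 (i + n)) (_ : t ∈ 𝒜 i)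
    (ht : ∀ x : U, t ∉ x.1.asHomogeneousIdeal.toIdeal), ∀ x : U, f x = Localization.mk r ⟨t, ht x⟩
  res := by
    rintro V U i f ⟨j, r, t, hr, ht, h, w⟩
    exact ⟨j, r, t, hr, ht, fun x => h (i x), fun x => w (i x)⟩

/-- A function that is locally given by such fractions. -/
def isLocallyFraction : TopCat.LocalPredicate (X := ProjectiveSpectrum.top 𝒜) (Fiber 𝒜) := (isFractionPrelocal 𝒜 n).sheafify

/-- The sections of `𝒪(n)` over `U`. -/
def sections (U : (Opens (ProjectiveSpectrum.top 𝒜))ᵒᵖ) :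
    AddSubgroup (∀ x : U.unop, Fiber 𝒜 x.1) where
  carrier := {f | (isLocallyFraction 𝒜 n).pred f}
  zero_mem' := by
    intro x
    exact ⟨U.unop, x.2, 𝟙 _, 0, 0, 1, zero_mem _, SetLike.GradedOne.one_mem,
      fun y => (Ideal.ne_top_iff_one _).1 y.1.isPrime.ne_top, fun y => (Localization.mk_zero _).symm⟩
  add_mem' := by
    intro f g hf hg x
    obtain ⟨V, hV, iV, i, r, t, hr, ht, h, w⟩ := hf x
    obtain ⟨V', hV', iV', i', r', t', hr', ht', h', w'⟩ := hg x
    refine ⟨V ⊓ V', ⟨hV, hV'⟩, V.infLELeft V' ≫ iV, i + i', t * r' + t' * r, t * t', ?_, ?_, ?_, ?_⟩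
    · refine add_mem ?_ ?_
      · have := SetLike.mul_mem_graded ht hr'
        rwa [← add_assoc] at this
      · have := SetLike.mul_mem_graded ht' hr
        rwa [← add_assoc, add_comm i' i] at this
    · exact SetLike.mul_mem_graded ht ht'
    · intro y
      exact mul_notMem 𝒜 y.1 (h ⟨y.1, y.2.1⟩) (h' ⟨y.1, y.2.2⟩)
    · intro y
      have e1 := w ⟨y.1, y.2.1⟩
      have e2 := w' ⟨y.1, y.2.2⟩
      change f _ + g _ = _
      refine (congrArg₂ (· + ·) e1 e2).trans ?_
      simp only []
      rw [Localization.add_mk]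
      rfl
  neg_mem' := by
    intro f hf x
    obtain ⟨V, hV, iV, i, r, t, hr, ht, h, w⟩ := hf x
    refine ⟨V, hV, iV, i, -r, t, neg_mem hr, ht, h, fun y => ?_⟩
    exact (congrArg Neg.neg (w y)).trans (Localization.neg_mk _ _)

lemma smul_mem (U : (Opens (ProjectiveSpectrum.top 𝒜))ᵒᵖ)
    (a : (ProjectiveSpectrum.Proj.structureSheaf 𝒜).1.obj U) (f : sections 𝒜 n U) :
    (fun x => (a.1 x).val * f.1 x) ∈ sections 𝒜 n U := by
  intro x
  obtain ⟨V, hV, iV, i, r, t, h, w⟩ := a.2 x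
  obtain ⟨V', hV', iV', i', r', t', hr', ht', h', w'⟩ := f.2 x
  refine ⟨V ⊓ V', ⟨hV, hV'⟩, V.infLELeft V' ≫ iV, i + i', r.1 * r', t.1 * t', ?_, ?_, ?_, ?_⟩
  · have := SetLike.mul_mem_graded r.2 hr'
    rwa [← add_assoc] at this
  · exact SetLike.mul_mem_graded t.2 ht'
  · intro y
    exact mul_notMem 𝒜 y.1 (h ⟨y.1, y.2.1⟩) (h' ⟨y.1, y.2.2⟩)
  · intro y
    have e1 := w ⟨y.1, y.2.1⟩
    have e2 := w' ⟨y.1, y.2.2⟩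
    refine (congrArg₂ (fun p q => HomogeneousLocalization.val p * q) e1 e2).trans ?_
    rw [HomogeneousLocalization.val_mk, Localization.mk_mul]
    rfl

instance moduleSections (U : (Opens (ProjectiveSpectrum.top 𝒜))ᵒᵖ) :
    Module ((ProjectiveSpectrum.Proj.structureSheaf 𝒜).1.obj U) (sections 𝒜 n U) where
  smul a f := ⟨fun x => (a.1 x).val * f.1 x, smul_mem 𝒜 n U a f⟩
  one_smul f := by
    apply Subtype.ext; funext x
    change HomogeneousLocalization.val 1 * f.1 x = f.1 x
    rw [HomogeneousLocalization.val_one, one_mul]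
  mul_smul a b f := by
    apply Subtype.ext; funext x
    change HomogeneousLocalization.val (a.1 x * b.1 x) * f.1 x = (a.1 x).val * ((b.1 x).val * f.1 x)
    rw [HomogeneousLocalization.val_mul, mul_assoc]
  smul_zero a := by
    apply Subtype.ext; funext x
    exact mul_zero _
  smul_add a f g := by
    apply Subtype.ext; funext x
    exact mul_add _ _ _
  add_smul a b f := by
    apply Subtype.ext; funext x
    change HomogeneousLocalization.val (a.1 x + b.1 x) * f.1 x = (a.1 x).val * f.1 x + (b.1 x).val * f.1 x
    rw [HomogeneousLocalization.val_add, add_mul]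
  zero_smul f := by
    apply Subtype.ext; funext x
    change HomogeneousLocalization.val 0 * f.1 x = 0
    rw [HomogeneousLocalization.val_zero, zero_mul]

/-- The presheaf of abelian groups underlying `𝒪(n)`. -/
def abPresheaf : TopCat.Presheaf Ab.{u} (ProjectiveSpectrum.top 𝒜) where
  obj U := AddCommGrpCat.of (sections 𝒜 n U)
  map {U V} i := AddCommGrpCat.ofHom
    { toFun := fun f => ⟨fun x => f.1 (i.unop x), (isLocallyFraction 𝒜 n).res i.unop f.1 f.2⟩
      map_zero' := rfl
      map_add' := fun _ _ => rfl }

lemma isSheaf_abPresheaf : (abPresheaf 𝒜 n).IsSheaf :=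
  (TopCat.Presheaf.isSheaf_iff_isSheaf_comp (forget AddCommGrpCat) _).2
    (TopCat.subpresheafToTypes.isSheaf (isLocallyFraction 𝒜 n))

/-- Serre's twisting sheaf `𝒪(n)` on `Proj A`. -/
def twist : (Proj 𝒜).Modules where
  val :=
    letI (U : (Opens (Proj 𝒜))ᵒᵖ) : Module ((Proj 𝒜).ringCatSheaf.obj.obj U)
        ((abPresheaf 𝒜 n).obj U) :=
      moduleSections 𝒜 n U
    .ofPresheaf (abPresheaf 𝒜 n) fun _ _ _ _ _ => rfl
  isSheaf := isSheaf_abPresheaf 𝒜 n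

/-- The global section of `𝒪(n)` given by `f ∈ A` of degree `n`. -/
def toSection (f : A) (hf : f ∈ 𝒜 n) : Γ(twist 𝒜 n, ⊤) :=
  (⟨fun x => algebraMap A (Fiber 𝒜 x.1) f, by
    intro x
    refine ⟨⊤, x.2, 𝟙 _, 0, f, 1, by simpa using hf, SetLike.GradedOne.one_mem,
      fun y => (Ideal.ne_top_iff_one _).1 y.1.isPrime.ne_top, fun y => ?_⟩
    exact (Localization.mk_one_eq_algebraMap f).symm⟩ : sections 𝒜 n (op ⊤))

end SerreTwist

/-! ### Invertible and ample sheaves -/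

section LineBundles

open TopologicalSpace Opposite

variable {Z : Scheme.{u}}

/-- The section `t` of `M` over `U` is a frame: it freely generates `M` over `U`. -/
def IsFrame (M : Z.Modules) (U : Z.Opens) (t : Γ(M, U)) : Prop :=
  ∀ (V : Z.Opens) (h : V ≤ U),
    Function.Bijective fun f : Γ(Z, V) => f • M.presheaf.map (homOfLE h).op t

/-- `M` is invertible: locally free of rank one. -/
def IsInvertibleSheaf (M : Z.Modules) : Prop :=
  ∀ z : Z, ∃ (U : Z.Opens) (t : Γ(M, U)), z ∈ U ∧ IsFrame M U t

/-- The presheaf tensor power `U ↦ M(U)^{⊗ n}`. -/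
def presheafTensorPow (M : Z.Modules) :
    ℕ → PresheafOfModules.{u} (Z.presheaf ⋙ forget₂ CommRingCat RingCat)
  | 0 => MonoidalCategoryStruct.tensorUnit _
  | n + 1 => MonoidalCategoryStruct.tensorObj (presheafTensorPow M n) M.val

/-- The tensor power `M^{⊗ n}`: the sheaf associated with the presheaf tensor power. -/
def tensorPow (M : Z.Modules) (n : ℕ) : Z.Modules :=
  (PresheafOfModules.sheafification (𝟙 Z.ringCatSheaf.obj)).obj (presheafTensorPow M n)

/-- The open set `Z_t` where a global section `t` of an invertible sheaf `M` does not vanish, that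
is, generates `M`. -/
def nonvanishing (M : Z.Modules) (t : Γ(M, ⊤)) : Z.Opens :=
  sSup {U : Z.Opens | IsFrame M U (M.presheaf.map (homOfLE (le_top : U ≤ ⊤)).op t)}

/-- `M` is ample (in the sense used for schemes that need not be quasi-compact): it is invertible
and the affine open sets of the form `Z_t`, for global sections `t` of the powers `M^{⊗ n}`,
`n ≥ 1`, form a basis of the topology. -/
def IsAmpleSheaf (M : Z.Modules) : Prop :=
  IsInvertibleSheaf M ∧ Opens.IsBasis {U : Z.Opens | IsAffineOpen U ∧
    ∃ (n : ℕ) (t : Γ(tensorPow M n, ⊤)), 1 ≤ n ∧ U = nonvanishing (tensorPow M n) t}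

/-- The pullback `g^* t` of a global section. -/
def pullbackSection {W : Scheme.{u}} (g : W ⟶ Z) (M : Z.Modules) (t : Γ(M, ⊤)) :
    Γ((Scheme.Modules.pullback g).obj M, ⊤) :=
  ((Scheme.Modules.pullbackPushforwardAdjunction g).unit.app M).app ⊤ t

/-- The canonical isomorphism `f^* g^* M ≅ f'^* g'^* M` for `g ∘ f = g' ∘ f'`. -/
def pullbackComparison {W Y Y' : Scheme.{u}} (f : W ⟶ Y) (g : Y ⟶ Z) (f' : W ⟶ Y') (g' : Y' ⟶ Z)
    (h : f ≫ g = f' ≫ g') (M : Z.Modules) :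
    (Scheme.Modules.pullback f).obj ((Scheme.Modules.pullback g).obj M) ⟶
      (Scheme.Modules.pullback f').obj ((Scheme.Modules.pullback g').obj M) :=
  (Scheme.Modules.pullbackComp f g).hom.app M ≫ (Scheme.Modules.pullbackCongr h).hom.app M ≫
    (Scheme.Modules.pullbackComp f' g').inv.app M

end LineBundles

/-! ### Group actions and linearizations -/

section Actions

open MonoidalCategory CartesianMonoidalCategory MonObj

variable {S : Scheme.{u}}

/-- An action of the group scheme `G` on `P`, over `S`. -/
structure GroupAction (G P : Over S) [MonObj G] where
  /-- the action morphism -/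
  act : G ⊗ P ⟶ P
  one_act : η[G] ▷ P ≫ act = (λ_ P).hom
  mul_act : (α_ G G P).inv ≫ μ[G] ▷ P ≫ act = G ◁ act ≫ act

/-- A `G`-linearization of a sheaf `L` on `P`, that is, an action of `G` on `L` compatible with its
action on `P`: an isomorphism `act^* L ≅ pr₂^* L` on `G × P` that satisfies the cocycle condition
on `G × G × P`. -/
structure Linearization {G P : Over S} [MonObj G] (ρ : GroupAction G P) (L : P.left.Modules) where
  /-- the isomorphism `act^* L ≅ pr₂^* L` -/
  iso : (Scheme.Modules.pullback ρ.act.left).obj L ≅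
    (Scheme.Modules.pullback (snd G P).left).obj L
  cocycle :
    (Scheme.Modules.pullback ((α_ G G P).inv ≫ μ[G] ▷ P).left).map iso.hom =
      pullbackComparison ((α_ G G P).inv ≫ μ[G] ▷ P).left ρ.act.left (G ◁ ρ.act).left ρ.act.left
        (by rw [← Over.comp_left, ← Over.comp_left, Category.assoc, ρ.mul_act]) L ≫
      (Scheme.Modules.pullback (G ◁ ρ.act).left).map iso.hom ≫
      pullbackComparison (G ◁ ρ.act).left (snd G P).left (snd G (G ⊗ P)).left ρ.act.left
        (by rw [← Over.comp_left, ← Over.comp_left, whiskerLeft_snd]) L ≫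
      (Scheme.Modules.pullback (snd G (G ⊗ P)).left).map iso.hom ≫
      pullbackComparison (snd G (G ⊗ P)).left (snd G P).left
        ((α_ G G P).inv ≫ μ[G] ▷ P).left (snd G P).left
        (by rw [← Over.comp_left, ← Over.comp_left]; simp) L

end Actions

/-! ### Schemes over `Spec 𝓡` -/

/-- `Spec A` as a scheme over `Spec 𝓡`. -/
abbrev specOver (𝓡 : Type u) [CommRing 𝓡] (A : Type u) [CommRing A] [Algebra 𝓡 A] :
    Over (Spec (CommRingCat.of 𝓡)) :=
  (Spec (CommRingCat.of A)).asOver (Spec (CommRingCat.of 𝓡))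

/-- The morphism of schemes over `Spec 𝓡` given by a homomorphism of `𝓡`-algebras. -/
abbrev specOverMap {𝓡 : Type u} [CommRing 𝓡] {A B : Type u} [CommRing A] [Algebra 𝓡 A]
    [CommRing B] [Algebra 𝓡 B] (f : A →ₐ[𝓡] B) : specOver 𝓡 B ⟶ specOver 𝓡 A :=
  (Spec.map (CommRingCat.ofHom f.toRingHom)).asOver (Spec (CommRingCat.of 𝓡))

namespace DegenerationData

variable {𝓡 : Type u} [CommRing 𝓡] [IsDomain 𝓡] [IsDiscreteValuationRing 𝓡]
  {K : Type u} [Field K] [Algebra 𝓡 K] [IsFractionRing 𝓡 K] {X : Type u} [AddCommGroup X]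
  (D : DegenerationData 𝓡 K X) (s : 𝓡)

/-- The scheme `P̃ = Proj R`, over `Spec 𝓡`. -/
def P : Over (Spec (CommRingCat.of 𝓡)) :=
  Over.mk (Proj.toSpecZero (D.grade s) ≫
    Spec.map (CommRingCat.ofHom (algebraMap 𝓡 (D.grade s 0))))

end DegenerationData

/-- The function on `Spec A` given by `f ∈ A`. -/
def specFunction {A : Type u} [CommRing A] (f : A) : Γ(Spec (CommRingCat.of A), ⊤) :=
  (Scheme.ΓSpecIso (CommRingCat.of A)).inv f

/-- The split torus over `Spec 𝓡` with character lattice `Λ`. -/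
abbrev splitTorus (𝓡 : Type u) [CommRing 𝓡] (Λ : Type u) [AddCommGroup Λ] :
    Over (Spec (CommRingCat.of 𝓡)) :=
  specOver 𝓡 (AddMonoidAlgebra 𝓡 Λ)

/-- The character of the torus given by `χ ∈ Λ`. -/
def character (𝓡 : Type u) [CommRing 𝓡] {Λ : Type u} [AddCommGroup Λ] (χ : Λ) :
    Γ((splitTorus 𝓡 Λ).left, ⊤) :=
  specFunction (AddMonoidAlgebra.single χ (1 : 𝓡))

/-- The homomorphism of tori `Hom(Λ', 𝔾_m) → Hom(Λ, 𝔾_m)` given by a homomorphism `Λ → Λ'` of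
character lattices. -/
abbrev splitTorusMap (𝓡 : Type u) [CommRing 𝓡] {Λ Λ' : Type u} [AddCommGroup Λ] [AddCommGroup Λ']
    (φ : Λ →+ Λ') : splitTorus 𝓡 Λ' ⟶ splitTorus 𝓡 Λ :=
  specOverMap (AddMonoidAlgebra.mapDomainAlgHom 𝓡 𝓡 φ)

/-! ### Torus embeddings given by a fan -/

section TorusEmbeddings

variable {𝓡 : Type u} [CommRing 𝓡] {X X' : Type u} [AddCommGroup X] [AddCommGroup X']

/-- The structure of the torus embedding `T_N emb Δ` on the scheme `P` over `Spec 𝓡`: `P` is glued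
from the affine torus embeddings `U(σ)`, `σ ∈ Δ`, along the open subschemes
`U(σ ∩ τ) = U(σ) ∩ U(τ)`. -/
structure TorusEmbedding (s : 𝓡) (K : Type u) [Field K] [Algebra 𝓡 K]
    (Δ : Set (PointedCone ℝ (NR X))) (P : Over (Spec (CommRingCat.of 𝓡))) where
  /-- the inclusions of the affine torus embeddings -/
  chart : ∀ σ : Δ, specOver 𝓡 (coneAlgebra 𝓡 s K σ.1) ⟶ P
  isOpenImmersion : ∀ σ, IsOpenImmersion (chart σ).left
  restrict : ∀ (σ τ : Δ) (h : τ.1 ≤ σ.1),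
    specOverMap (Subalgebra.inclusion (coneAlgebra_anti 𝓡 s h)) ≫ chart σ = chart τ
  cover : ∀ p : P.left, ∃ σ, p ∈ Set.range (chart σ).left
  inter : ∀ σ τ ρ : Δ, ρ.1 = σ.1 ⊓ τ.1 →
    Set.range (chart σ).left ∩ Set.range (chart τ).left = Set.range (chart ρ).left

/-- The map `N_ℝ → N'_ℝ`, preserving the `f₀`-coordinate, that is dual to a homomorphism
`X' → X`. -/
def mapNR (φ : X' →ₗ[ℤ] X) : NR X →ₗ[ℝ] NR X' :=
  LinearMap.prodMap LinearMap.id (φ.baseChange ℝ).dualMap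

/-- The morphism `g` between the torus embeddings given by the fans `Δ` and `Δ'` is described by
the map of lattices `N → N'` dual to `φ : X' → X`: this is a map of fans from `Δ` to `Δ'`, and
if it maps `σ ∈ Δ` into `σ' ∈ Δ'`, then `g` is given on `U(σ) → U(σ')` by the homomorphism
`s^{x₀} w^x ↦ s^{x₀} w^{φ(x)}`. -/
def IsToricMorphism {s : 𝓡} {K : Type u} [Field K] [Algebra 𝓡 K]
    {Δ : Set (PointedCone ℝ (NR X))} {Δ' : Set (PointedCone ℝ (NR X'))}
    {P P' : Over (Spec (CommRingCat.of 𝓡))} (E : TorusEmbedding s K Δ P)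
    (E' : TorusEmbedding s K Δ' P') (φ : X' →ₗ[ℤ] X) (g : P ⟶ P') : Prop :=
  (∀ σ ∈ Δ, ∃ σ' ∈ Δ', ∀ v ∈ σ, mapNR φ v ∈ σ') ∧
  ∀ (σ : Δ) (σ' : Δ'), (∀ v ∈ σ.1, mapNR φ v ∈ σ'.1) →
    ∃ ψ : coneAlgebra 𝓡 s K σ'.1 →ₐ[𝓡] coneAlgebra 𝓡 s K σ.1,
      (∀ f, (ψ f : AddMonoidAlgebra K X) =
        AddMonoidAlgebra.mapDomain φ (f : AddMonoidAlgebra K X')) ∧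
      E.chart σ ≫ g = specOverMap ψ ≫ E'.chart σ'

/-- The fan in the line `ℝ f₀` that consists of `{0}` and the half-line `ℝ_{≥ 0} f₀`. -/
def halfLineFan : Set (PointedCone ℝ (NR PUnit.{u + 1})) :=
  {⊥, PointedCone.hull ℝ {(1, 0)}}

end TorusEmbeddings

namespace DegenerationData

open MonoidalCategory CartesianMonoidalCategory

variable {𝓡 : Type u} [CommRing 𝓡] [IsDomain 𝓡] [IsDiscreteValuationRing 𝓡]
  {K : Type u} [Field K] [Algebra 𝓡 K] [IsFractionRing 𝓡 K] {X : Type u} [AddCommGroup X]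
  (D : DegenerationData 𝓡 K X) (s : 𝓡)

/-- The sheaf `L̃ = 𝒪(1)` on `P̃`. -/
def L : (D.P s).left.Modules := SerreTwist.twist (D.grade s) 1

/-- The global section of `L̃` given by an element of `R` of degree `1`. -/
def sectionL (f : D.satAlgebra s) (hf : f ∈ D.grade s 1) : Γ(D.L s, ⊤) :=
  SerreTwist.toSection (D.grade s) 1 f hf

/-- The action `ρ` of `T` on `P̃` is given on the open subschemes `j c : Spec R(c) → P̃` by the
`X`-grading of the algebras `R(c)`. -/
def IsGivenByGrading (j : ∀ c, specOver 𝓡 (D.vertexAlgebra s c) ⟶ D.P s)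
    (ρ : GroupAction (splitTorus 𝓡 X) (D.P s)) : Prop :=
  ∀ c, ∃ α : splitTorus 𝓡 X ⊗ specOver 𝓡 (D.vertexAlgebra s c) ⟶ specOver 𝓡 (D.vertexAlgebra s c),
    splitTorus 𝓡 X ◁ j c ≫ ρ.act = α ≫ j c ∧
    ∀ (x : X) (f : D.vertexAlgebra s c), (f : AddMonoidAlgebra K X).coeff.support ⊆ {x} →
      α.left.appTop (specFunction f) =
        (fst (splitTorus 𝓡 X) (specOver 𝓡 (D.vertexAlgebra s c))).left.appTop (character 𝓡 x) *
        (snd (splitTorus 𝓡 X) (specOver 𝓡 (D.vertexAlgebra s c))).left.appTop (specFunction f)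

/-- The action of `T × 𝔾_m` (the torus with character lattice `X ⊕ ℤ`) on `L̃` is given by the
`(X ⊕ ℤ)`-grading of `R`: an element of `R` that is homogeneous of degree `(x, 1)` gives a section
of `L̃` on which `T × 𝔾_m` acts through the character `(x, 1)`. -/
def IsGivenByBigrading {ρ : GroupAction (splitTorus 𝓡 (X × ℤ)) (D.P s)}
    (Φ : Linearization ρ (D.L s)) : Prop :=
  ∀ (x : X) (f : D.satAlgebra s) (hf : f ∈ D.grade s 1),
    (f : AddMonoidAlgebra K (ℕ × X)).coeff.support ⊆ {(1, x)} →
    Φ.iso.hom.app ⊤ (pullbackSection ρ.act.left (D.L s) (D.sectionL s f hf)) =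
      (fst (splitTorus 𝓡 (X × ℤ)) (D.P s)).left.appTop (character 𝓡 (x, (1 : ℤ))) •
        pullbackSection (snd (splitTorus 𝓡 (X × ℤ)) (D.P s)).left (D.L s)
          (D.sectionL s f hf)

end DegenerationData

end

end MaxDegeneration

open MaxDegeneration MonoidalCategory

namespace MaxDegeneration

noncomputable section

/-! ### Farkas' lemma for finitely many linear forms -/

/-- **Farkas' lemma**: a linear form that is nonnegative wherever finitely many given forms are
nonnegative is a nonnegative combination of them. -/
theorem farkas {V : Type*} [AddCommGroup V] [Module ℝ V] {S : Set (Module.Dual ℝ V)}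
    (hS : S.Finite) : ∀ g : Module.Dual ℝ V, (∀ v, (∀ f ∈ S, 0 ≤ f v) → 0 ≤ g v) →
      g ∈ PointedCone.hull ℝ S := by
  -- a stronger induction: the forms are indexed by a list
  have key : ∀ (L : List (Module.Dual ℝ V)) (g : Module.Dual ℝ V),
      (∀ v, (∀ f ∈ L, 0 ≤ f v) → 0 ≤ g v) → g ∈ PointedCone.hull ℝ {f | f ∈ L} := by
    intro L
    induction hn : L.length generalizing L with
    | zero =>
      intro g hg
      obtain rfl := List.length_eq_zero_iff.1 hn
      have : g = 0 := by
        ext v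
        have h1 := hg v (by simp)
        have h2 := hg (-v) (by simp)
        simp at h2
        exact le_antisymm (by simpa using h2) h1
      rw [this]; exact zero_mem _
    | succ n ih =>
      intro g hg
      match L, hn with
      | f₀ :: L, hn =>
        have hL : L.length = n := by simpa using hn
        by_cases h : ∀ v, (∀ f ∈ L, 0 ≤ f v) → 0 ≤ g v
        · exact Submodule.span_mono (fun f hf => List.mem_cons_of_mem _ hf) (ih L hL g h)
        · push Not at h
          obtain ⟨v₁, hv₁, hgv₁⟩ := h
          have hf₀ : f₀ v₁ < 0 := by
            by_contra hc
            push Not at hc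
            refine absurd (hg v₁ ?_) (not_le.2 hgv₁)
            intro f hf
            rcases List.mem_cons.1 hf with rfl | hf
            exacts [hc, hv₁ f hf]
          set v₀ : V := (-(f₀ v₁))⁻¹ • v₁ with hv₀
          have hpos : 0 < (-(f₀ v₁))⁻¹ := by
            rw [inv_pos]; linarith
          have e0 : f₀ v₀ = -1 := by
            rw [hv₀, map_smul, smul_eq_mul, inv_neg, neg_mul, inv_mul_cancel₀ hf₀.ne]
          have eg : g v₀ ≤ 0 := by
            rw [hv₀, map_smul, smul_eq_mul]
            exact mul_nonpos_of_nonneg_of_nonpos hpos.le hgv₁.le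
          have eL : ∀ f ∈ L, 0 ≤ f v₀ := by
            intro f hf
            rw [hv₀, map_smul, smul_eq_mul]
            exact mul_nonneg hpos.le (hv₁ f hf)
          have h1 := ih (L.map fun f => f + f v₀ • f₀) (by simpa using hL) (g + g v₀ • f₀) (by
            intro v hv
            have : g (v + f₀ v • v₀) = (g + g v₀ • f₀) v := by
              simp; ring
            rw [← this]
            apply hg
            intro f hf
            rcases List.mem_cons.1 hf with rfl | hf
            · simp [e0]
            · have := hv _ (List.mem_map.2 ⟨f, hf, rfl⟩)
              simp at this ⊢
              linarith)
          have hmem0 : f₀ ∈ PointedCone.hull ℝ {f | f ∈ f₀ :: L} :=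
            PointedCone.subset_hull (by simp)
          have h2 : PointedCone.hull ℝ {f | f ∈ L.map fun f => f + f v₀ • f₀} ≤
              PointedCone.hull ℝ {f | f ∈ f₀ :: L} := by
            refine Submodule.span_le.2 ?_
            rintro _ hf'
            obtain ⟨f, hf, rfl⟩ := List.mem_map.1 hf'
            refine add_mem (PointedCone.subset_hull (List.mem_cons_of_mem _ hf)) ?_
            exact PointedCone.smul_mem _ (eL f hf) hmem0
          have h3 := h2 h1
          have : g = (g + g v₀ • f₀) + (-(g v₀)) • f₀ := by
            ext v; simp
          rw [this]
          exact add_mem h3 (PointedCone.smul_mem _ (by linarith) hmem0)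
  intro g hg
  have := key hS.toFinset.toList g (by simpa using hg)
  simpa using this

/-! ### Real quadratic spaces -/

/-- The pairing of `N_ℝ` with `M_ℝ`. -/
def pairingR {X : Type u} [AddCommGroup X] : NR X →ₗ[ℝ] (RealSpan X × ℝ) →ₗ[ℝ] ℝ :=
  LinearMap.mk₂ ℝ (fun n m => n.1 * m.2 + n.2 m.1)
    (by intros; simp; ring) (by intros; simp; ring) (by intros; simp; ring) (by intros; simp; ring)

lemma pairingR_apply {X : Type u} [AddCommGroup X] (n : NR X) (m : RealSpan X × ℝ) :
    pairingR n m = n.1 * m.2 + n.2 m.1 := rfl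

lemma pairing_eq {X : Type u} [AddCommGroup X] (n : NR X) (x : X) (k : ℤ) :
    pairing n x k = pairingR n (lat x, (k : ℝ)) := rfl

lemma lat_add {X : Type u} [AddCommGroup X] (x y : X) : lat (x + y) = lat x + lat y :=
  TensorProduct.tmul_add _ _ _

lemma lat_neg {X : Type u} [AddCommGroup X] (x : X) : lat (-x) = -lat x :=
  TensorProduct.tmul_neg _ _

lemma lat_zero {X : Type u} [AddCommGroup X] : lat (0 : X) = 0 := TensorProduct.tmul_zero _ _

lemma lat_sub {X : Type u} [AddCommGroup X] (x y : X) : lat (x - y) = lat x - lat y :=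
  TensorProduct.tmul_sub _ _ _

lemma lat_zsmul {X : Type u} [AddCommGroup X] (n : ℤ) (x : X) : lat (n • x) = (n : ℝ) • lat x := by
  simp only [lat]
  rw [TensorProduct.tmul_smul, TensorProduct.smul_tmul', TensorProduct.smul_tmul']
  simp

lemma span_range_lat (X : Type u) [AddCommGroup X] : Submodule.span ℝ (Set.range (lat (X := X))) = ⊤ := by
  rw [eq_top_iff]
  rintro v -
  induction v using TensorProduct.induction_on with
  | zero => exact zero_mem _
  | tmul r x =>
    have : r ⊗ₜ[ℤ] x = r • lat x := by simp [lat, TensorProduct.smul_tmul']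
    rw [this]
    exact Submodule.smul_mem _ _ (Submodule.subset_span ⟨x, rfl⟩)
  | add v w hv hw => exact add_mem hv hw

lemma dual_ext_lat {X : Type u} [AddCommGroup X] {f g : Module.Dual ℝ (RealSpan X)}
    (h : ∀ x, f (lat x) = g (lat x)) : f = g := by
  apply LinearMap.ext_on (span_range_lat X)
  rintro _ ⟨x, rfl⟩
  exact h x

lemma pairingR_injective (X : Type u) [AddCommGroup X] :
    Function.Injective (pairingR (X := X)) := by
  intro n m h
  have h1 := fun p => DFunLike.congr_fun h p
  simp only [pairingR_apply] at h1
  refine Prod.ext (by simpa using h1 (0, 1)) (LinearMap.ext fun v => by simpa using h1 (v, 0))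

/-- Farkas' lemma in `N_ℝ`. -/
lemma mem_hull_of_pairing {X : Type u} [AddCommGroup X] {S : Set (NR X)} (hS : S.Finite) (n : NR X)
    (h : ∀ m, (∀ n' ∈ S, 0 ≤ pairingR n' m) → 0 ≤ pairingR n m) : n ∈ PointedCone.hull ℝ S := by
  have h1 := farkas (hS.image (pairingR (X := X))) (pairingR n)
    (fun m hm => h m fun n' hn' => hm _ ⟨n', hn', rfl⟩)
  have h2 : PointedCone.hull ℝ (pairingR (X := X) '' S) =
      (PointedCone.hull ℝ S).map (pairingR (X := X)) := by
    simp only [PointedCone.hull, PointedCone.map]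
    rw [Submodule.map_span]; rfl
  rw [h2] at h1
  obtain ⟨n', hn', e⟩ := h1
  rwa [← pairingR_injective X e]

/-- Farkas' lemma in `M_ℝ`. -/
lemma mem_hull_of_pairing_flip {X : Type u} [AddCommGroup X] {S : Set (RealSpan X × ℝ)}
    (hS : S.Finite) (m : RealSpan X × ℝ)
    (h : ∀ n, (∀ m' ∈ S, 0 ≤ pairingR n m') → 0 ≤ pairingR n m) : m ∈ PointedCone.hull ℝ S := by
  have h1 := farkas (hS.image (pairingR (X := X)).flip) ((pairingR (X := X)).flip m)
    (fun n hn => h n fun m' hm' => hn _ ⟨m', hm', rfl⟩)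
  have h2 : PointedCone.hull ℝ ((pairingR (X := X)).flip '' S) =
      (PointedCone.hull ℝ S).map (pairingR (X := X)).flip := by
    simp only [PointedCone.hull, PointedCone.map]
    rw [Submodule.map_span]; rfl
  rw [h2] at h1
  obtain ⟨m', hm', e⟩ := h1
  have hinj : Function.Injective (pairingR (X := X)).flip := by
    intro p q h
    have h1 := fun n => DFunLike.congr_fun h n
    simp only [LinearMap.flip_apply, pairingR_apply] at h1
    refine Prod.ext ?_ (by simpa using h1 (1, 0))
    rw [← sub_eq_zero, ← Module.forall_dual_apply_eq_zero_iff ℝ]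
    intro f
    have := h1 (0, f)
    simp at this
    simp [this]
  rwa [← hinj e]

end

end MaxDegeneration

namespace MaxDegeneration

noncomputable section

namespace DegenerationData

variable {𝓡 : Type u} [CommRing 𝓡] [IsDomain 𝓡] [IsDiscreteValuationRing 𝓡]
  {K : Type u} [Field K] [Algebra 𝓡 K] [IsFractionRing 𝓡 K] {X : Type u} [AddCommGroup X]
  (D : DegenerationData 𝓡 K X)

/-! ### Positivity of `B` -/

lemma B_pos {x : X} (hx : x ≠ 0) : 0 < D.B x x := by
  obtain ⟨r, hr, e⟩ := D.pos x hx
  rw [B_apply, ord, Left.neg_pos_iff]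
  change ((IsDiscreteValuationRing.maximalIdeal 𝓡).valuationOfNeZero (D.b x x)) < 1
  rw [← WithZero.coe_lt_coe, IsDedekindDomain.HeightOneSpectrum.valuationOfNeZero_eq, ← e,
    WithZero.coe_one, IsDedekindDomain.HeightOneSpectrum.valuation_lt_one_iff_mem]
  exact hr

lemma B_nonneg (x : X) : 0 ≤ D.B x x := by
  by_cases hx : x = 0
  · simp [hx]
  · exact (D.B_pos hx).le

lemma BR_symm (v w : RealSpan X) : D.BR v w = D.BR w v := by
  have : D.BR = D.BR.flip := by
    refine LinearMap.ext_on (span_range_lat X) ?_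
    rintro _ ⟨x, rfl⟩
    refine LinearMap.ext_on (span_range_lat X) ?_
    rintro _ ⟨y, rfl⟩
    change D.BR (lat x) (lat y) = D.BR (lat y) (lat x)
    rw [BR_lat, BR_lat, B_symm]
  exact DFunLike.congr_fun (DFunLike.congr_fun this v) w

section Finite

variable [Module.Free ℤ X] [Module.Finite ℤ X]

open Module in
lemma BR_nonneg (v : RealSpan X) : 0 ≤ D.BR v v := by
  let b := Free.chooseBasis ℤ X
  let bR : Basis _ ℝ (RealSpan X) := b.baseChange ℝ
  have hb : ∀ i, bR i = lat (b i) := fun i => by simp [bR, lat]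
  let F : (Free.ChooseBasisIndex ℤ X → ℝ) → ℝ := fun r =>
    ∑ i, ∑ j, r i * r j * (D.B (b i) (b j) : ℝ)
  have hF : ∀ r, D.BR (∑ i, r i • lat (b i)) (∑ i, r i • lat (b i)) = F r := by
    intro r
    simp only [map_sum, LinearMap.sum_apply, map_smul, LinearMap.smul_apply, BR_lat, F, smul_eq_mul]
    refine Finset.sum_congr rfl fun i _ => ?_
    rw [Finset.mul_sum]
    refine Finset.sum_congr rfl fun j _ => ?_
    rw [D.B_symm]
    ring
  have hcont : Continuous F := by fun_prop
  have hdense : DenseRange fun (q : Free.ChooseBasisIndex ℤ X → ℚ) i => ((q i : ℚ) : ℝ) :=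
    DenseRange.piMap fun _ => Rat.denseRange_cast
  have hpos : ∀ r, 0 ≤ F r := by
    intro r
    refine hdense.induction_on (p := fun r => 0 ≤ F r) r (isClosed_Ici.preimage hcont) ?_
    intro q
    obtain ⟨N, hN⟩ := IsLocalization.exist_integer_multiples_of_finite (nonZeroDivisors ℤ) q
    choose z hz using hN
    have hN0 : ((N : ℤ) : ℝ) ≠ 0 := by exact_mod_cast nonZeroDivisors.coe_ne_zero N
    have h1 : ∀ i, ((N : ℤ) : ℝ) * (q i : ℝ) = (z i : ℝ) := by
      intro i
      have := hz i
      simp only [algebraMap_int_eq, eq_intCast, zsmul_eq_mul] at this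
      have h2 : ((N : ℤ) : ℚ) * q i = z i := by rw [this]
      exact_mod_cast h2
    have h2 : ((N : ℤ) : ℝ) ^ 2 * F (fun i => (q i : ℝ)) = F fun i => (z i : ℝ) := by
      simp only [F, Finset.mul_sum, ← h1]
      refine Finset.sum_congr rfl fun i _ => Finset.sum_congr rfl fun j _ => ?_
      ring
    have h3 : 0 ≤ F fun i => (z i : ℝ) := by
      rw [← hF]
      have : ∑ i, (z i : ℝ) • lat (b i) = lat (∑ i, z i • b i) := by
        simp only [← lat_zsmul]
        simp [lat, TensorProduct.tmul_sum]
      rw [this, BR_lat]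
      exact_mod_cast D.B_nonneg _
    change 0 ≤ F _
    rw [← h2] at h3
    exact nonneg_of_mul_nonneg_right h3 (by positivity)
  have := hpos (bR.repr v)
  rw [← hF] at this
  simp only [← hb, bR.sum_repr] at this
  exact this

lemma BR_eq_zero {v : RealSpan X} (h : ∀ x : X, D.BR v (lat x) = 0) : v = 0 := by
  classical
  let b := Module.Free.chooseBasis ℤ X
  let bR : Module.Basis _ ℝ (RealSpan X) := b.baseChange ℝ
  have hb : ∀ i, bR i = lat (b i) := fun i => by simp [bR, lat]
  let M : Matrix _ _ ℤ := Matrix.of fun i j => D.B (b i) (b j)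
  have hM : M.det ≠ 0 := by
    intro h0
    obtain ⟨w, hw, h1⟩ := Matrix.exists_mulVec_eq_zero_iff.2 h0
    have h2 : ∀ i, D.B (b i) (∑ j, w j • b j) = 0 := by
      intro i
      have := congrFun h1 i
      simp only [Matrix.mulVec, dotProduct, M, Matrix.of_apply, Pi.zero_apply] at this
      simp only [map_sum, map_smul, smul_eq_mul]
      rw [← this]
      exact Finset.sum_congr rfl fun j _ => mul_comm _ _
    have h3 : D.B (∑ j, w j • b j) (∑ j, w j • b j) = 0 := by
      conv_lhs => rw [map_sum]
      refine Finset.sum_eq_zero fun i _ => ?_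
      rw [map_smul, B_symm, h2, smul_zero]
    have h4 : ∑ j, w j • b j = 0 := by
      by_contra hne
      exact (D.B_pos hne).ne' h3
    exact hw (funext fun i => Fintype.linearIndependent_iff.1 b.linearIndependent w h4 i)
  have hMR : (M.map (Int.castRingHom ℝ)).det ≠ 0 := by
    rw [← RingHom.mapMatrix_apply, ← RingHom.map_det]
    simpa using hM
  have h5 : Matrix.mulVec (M.map (Int.castRingHom ℝ)) (fun j => bR.repr v j) = 0 := by
    funext i
    have h1 := h (b i)
    rw [← bR.sum_repr v] at h1
    simp only [map_sum, LinearMap.sum_apply, map_smul, LinearMap.smul_apply, hb, BR_lat] at h1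
    simp only [Matrix.mulVec, dotProduct, M, Matrix.map_apply, Matrix.of_apply, Pi.zero_apply]
    rw [← h1]
    refine Finset.sum_congr rfl fun j _ => ?_
    rw [D.B_symm]
    simp [mul_comm]
  have h6 := Matrix.eq_zero_of_mulVec_eq_zero hMR h5
  apply bR.repr.injective
  ext i
  simpa using congrFun h6 i

lemma BR_mul_le (v w : RealSpan X) : D.BR v w ^ 2 ≤ D.BR v v * D.BR w w := by
  have := LinearMap.BilinForm.apply_mul_apply_le_of_forall_zero_le D.BR D.BR_nonneg v w
  rw [D.BR_symm w v] at this
  rwa [sq]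

lemma BR_bijective : Function.Bijective D.BR := by
  have hi : Function.Injective D.BR := by
    rw [injective_iff_map_eq_zero]
    intro v hv
    exact D.BR_eq_zero fun x => by simp [hv]
  refine ⟨hi, ?_⟩
  exact (LinearMap.injective_iff_surjective_of_finrank_eq_finrank
    (Subspace.dual_finrank_eq (K := ℝ) (V := RealSpan X)).symm).1 hi

lemma exists_dA (f : Module.Dual ℝ (RealSpan X)) : ∃ α, D.dA α = f := by
  obtain ⟨α, h⟩ := D.BR_bijective.2 (f - (1 / 2 : ℝ) • D.lR)
  exact ⟨α, by rw [dA, h, sub_add_cancel]⟩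

/-- Bounded sets contain finitely many lattice elements. -/
lemma finite_lat_le (α : RealSpan X) (C : ℝ) :
    {x : X | D.BR (lat x - α) (lat x - α) ≤ C}.Finite := by
  classical
  let b := Module.Free.chooseBasis ℤ X
  let bR : Module.Basis _ ℝ (RealSpan X) := b.baseChange ℝ
  have hb : ∀ i x, bR.coord i (lat x) = b.coord i x := fun i x => by simp [bR, lat]
  choose w hw using fun i => D.BR_bijective.2 (bR.coord i)
  -- the coordinates are bounded
  let N : Module.Free.ChooseBasisIndex ℤ X → ℤ := fun i =>
    ⌈|bR.coord i α| + (D.BR (w i) (w i) * C + 1)⌉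
  refine Set.Finite.subset ((Set.Finite.pi' fun i => Set.finite_Icc (-N i) (N i)).preimage
    (f := fun (x : X) i => b.coord i x) ?_) ?_
  · intro x _ y _ h
    exact b.repr.injective (Finsupp.ext fun i => congrFun h i)
  · intro x hx i
    have h1 := D.BR_mul_le (w i) (lat x - α)
    rw [show D.BR (w i) (lat x - α) = (b.coord i x : ℝ) - bR.coord i α by
      rw [hw, map_sub, hb]] at h1
    have h2 : D.BR (w i) (w i) * D.BR (lat x - α) (lat x - α) ≤ D.BR (w i) (w i) * C :=
      mul_le_mul_of_nonneg_left hx (D.BR_nonneg _)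
    have h0 := D.BR_nonneg (w i)
    have hC := (D.BR_nonneg (lat x - α)).trans hx
    have h6 := mul_nonneg h0 hC
    have h3 : |(b.coord i x : ℝ) - bR.coord i α| ≤ D.BR (w i) (w i) * C + 1 := by
      apply abs_le_of_sq_le_sq
      · nlinarith
      · linarith
    have h4 : |(b.coord i x : ℝ)| ≤ N i := by
      have : |(b.coord i x : ℝ)| ≤ |bR.coord i α| + |(b.coord i x : ℝ) - bR.coord i α| := by
        have := abs_add_le (bR.coord i α) ((b.coord i x : ℝ) - bR.coord i α)
        rwa [add_sub_cancel] at this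
      refine (this.trans ?_).trans (Int.le_ceil _)
      linarith
    have h5 : |b.coord i x| ≤ N i := by exact_mod_cast h4
    exact abs_le.1 h5

end Finite

end DegenerationData

end

end MaxDegeneration

namespace MaxDegeneration

noncomputable section

namespace DegenerationData

variable {𝓡 : Type u} [CommRing 𝓡] [IsDomain 𝓡] [IsDiscreteValuationRing 𝓡]
  {K : Type u} [Field K] [Algebra 𝓡 K] [IsFractionRing 𝓡 K] {X : Type u} [AddCommGroup X]
  (D : DegenerationData 𝓡 K X)

/-! ### The edge vectors at a vertex of `Q` -/

/-- The vector from the vertex `(c, A(c))` of `Q` to the vertex `(c + y, A(c + y))`. -/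
def edge (c y : X) : RealSpan X × ℝ := (lat y, ((D.A (c + y) - D.A c : ℤ) : ℝ))

lemma pairingR_edge_add (n : NR X) (c u v : X) :
    pairingR n (D.edge c (u + v)) =
      pairingR n (D.edge c u) + pairingR n (D.edge c v) + n.1 * D.B u v := by
  simp only [pairingR_apply, edge, D.A_add, lat_add, map_add, LinearMap.add_apply]
  push_cast
  ring

lemma pairingR_edge_trans (n : NR X) (c c' y : X) :
    pairingR n (D.edge c (c' - c + y)) =
      pairingR n (D.edge c (c' - c)) + pairingR n (D.edge c' y) := by
  simp only [pairingR_apply, edge, lat_add, map_add, add_sub_cancel, ← add_assoc]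
  push_cast
  ring

lemma pairingR_edge_symm (n : NR X) (c c' : X) :
    pairingR n (D.edge c' (c - c')) = -pairingR n (D.edge c (c' - c)) := by
  have := D.pairingR_edge_trans n c c' (c - c')
  rw [show c' - c + (c - c') = 0 by abel] at this
  have h0 : pairingR n (D.edge c 0) = 0 := by simp [pairingR_apply, edge, lat_zero]
  linarith

lemma pairingR_edge_zero (n : NR X) (c : X) : pairingR n (D.edge c 0) = 0 := by
  simp [pairingR_apply, edge, lat_zero]

lemma two_A (x : X) : 2 * (D.A x : ℝ) = D.B x x + D.l x := by
  have : D.l x = 2 * D.A x - D.B x x := rfl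
  rw [this]; push_cast; ring

lemma pairingR_shift_edge (α : RealSpan X) (c y : X) :
    2 * pairingR (D.shift α) (D.edge c y) =
      D.BR (lat (c + y) - α) (lat (c + y) - α) - D.BR (lat c - α) (lat c - α) := by
  have h1 := D.two_A (c + y)
  have h2 := D.two_A c
  have h3 : D.BR (lat (c + y)) α = D.BR α (lat (c + y)) := D.BR_symm _ _
  have h4 : D.BR (lat c) α = D.BR α (lat c) := D.BR_symm _ _
  have h5 : D.BR α (lat (c + y)) = D.BR α (lat c) + D.BR α (lat y) := by rw [lat_add, map_add]
  simp only [pairingR_apply, shift, edge, dA, map_sub, LinearMap.sub_apply, BR_lat,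
    LinearMap.neg_apply, LinearMap.add_apply, LinearMap.smul_apply, lR_lat, smul_eq_mul, h3, h4]
  have h6 : (D.l (c + y) : ℝ) = D.l c + D.l y := by rw [map_add]; push_cast; rfl
  push_cast
  linear_combination h1 - h2 + h6 + 2 * h5

section Finite

variable [Module.Free ℤ X] [Module.Finite ℤ X]

lemma normB_le_normB {v w : RealSpan X} : D.normB v ≤ D.normB w ↔ D.BR v v ≤ D.BR w w :=
  Real.sqrt_le_sqrt_iff (D.BR_nonneg w)

lemma isNearest_iff {α : RealSpan X} {c : X} :
    D.IsNearest α c ↔ ∀ y, 0 ≤ pairingR (D.shift α) (D.edge c y) := by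
  constructor
  · intro h y
    have := D.normB_le_normB.1 (h (c + y))
    linarith [D.pairingR_shift_edge α c y]
  · intro h x
    rw [normB_le_normB]
    have := D.pairingR_shift_edge α c (x - c)
    rw [add_sub_cancel] at this
    linarith [h (x - c)]

lemma isNearest_add_iff {α : RealSpan X} {c : X} (hc : D.IsNearest α c) (y : X) :
    D.IsNearest α (c + y) ↔ pairingR (D.shift α) (D.edge c y) = 0 := by
  have hc' := D.isNearest_iff.1 hc
  rw [isNearest_iff]
  constructor
  · intro h
    have h1 := h (c - (c + y))
    rw [D.pairingR_edge_symm, add_sub_cancel_left] at h1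
    linarith [hc' y]
  · intro h z
    have h1 := D.pairingR_edge_trans (D.shift α) c (c + y) z
    rw [add_sub_cancel_left, h, zero_add] at h1
    rw [← h1]
    exact hc' _

lemma exists_isNearest (α : RealSpan X) : ∃ c, D.IsNearest α c := by
  have hfin := D.finite_lat_le α (D.BR (lat 0 - α) (lat 0 - α))
  obtain ⟨c, hc, h⟩ := Set.exists_min_image _ (fun x : X => D.BR (lat x - α) (lat x - α)) hfin
    ⟨0, by simp⟩
  refine ⟨c, fun x => ?_⟩
  rw [normB_le_normB]
  by_cases hx : D.BR (lat x - α) (lat x - α) ≤ D.BR (lat 0 - α) (lat 0 - α)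
  · exact h x hx
  · exact le_trans (show _ from hc) (not_le.1 hx).le

lemma finite_isNearest (α : RealSpan X) : {c | D.IsNearest α c}.Finite := by
  obtain ⟨c, hc⟩ := D.exists_isNearest α
  refine (D.finite_lat_le α (D.BR (lat c - α) (lat c - α))).subset fun x hx => ?_
  exact D.normB_le_normB.1 (hx c)

lemma lat_mem_delaunayCell {α : RealSpan X} {c : X} :
    lat c ∈ D.delaunayCell α ↔ D.IsNearest α c := by
  constructor
  · intro h
    obtain ⟨c₀, hc₀⟩ := D.exists_isNearest α
    have hconv : Convex ℝ {v : RealSpan X | D.BR (v - α) (v - α) ≤ D.BR (lat c₀ - α) (lat c₀ - α)} := by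
      intro v hv w hw a b ha hb hab
      change D.BR _ _ ≤ _
      have h1 : a • v + b • w - α = a • (v - α) + b • (w - α) := by
        have : α = a • α + b • α := by rw [← add_smul, hab, one_smul]
        conv_lhs => rw [this]
        rw [smul_sub, smul_sub]; abel
      have h2 := D.BR_nonneg ((v - α) - (w - α))
      have h3 := D.BR_symm (w - α) (v - α)
      change D.BR (v - α) (v - α) ≤ _ at hv
      change D.BR (w - α) (w - α) ≤ _ at hw
      rw [h1]
      simp only [map_add, map_smul, LinearMap.add_apply, LinearMap.smul_apply, smul_eq_mul]
      rw [map_sub D.BR, LinearMap.sub_apply, map_sub (D.BR (v - α)), map_sub (D.BR (w - α)), h3] at h2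
      rw [h3]
      have hb' : b = 1 - a := by linarith
      subst hb'
      nlinarith [mul_nonneg (mul_nonneg ha hb) h2, mul_le_mul_of_nonneg_left hv ha,
        mul_le_mul_of_nonneg_left hw hb]
    have h1 : D.delaunayCell α ⊆ {v | D.BR (v - α) (v - α) ≤ D.BR (lat c₀ - α) (lat c₀ - α)} := by
      refine convexHull_min ?_ hconv
      rintro _ ⟨x, hx, rfl⟩
      exact D.normB_le_normB.1 (hx c₀)
    intro x
    exact le_trans (D.normB_le_normB.2 (h1 h)) (hc₀ x)
  · intro h
    exact subset_convexHull ℝ _ ⟨c, h, rfl⟩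

lemma delaunayCell_eq_iff {α β : RealSpan X} :
    D.delaunayCell α = D.delaunayCell β ↔ ∀ c, D.IsNearest α c ↔ D.IsNearest β c := by
  constructor
  · intro h c
    rw [← lat_mem_delaunayCell, h, lat_mem_delaunayCell]
  · intro h
    rw [delaunayCell, delaunayCell]
    simp only [h]

lemma shift_combo {a b : ℝ} (hab : a + b = 1) (α β : RealSpan X) :
    D.shift (a • α + b • β) = a • D.shift α + b • D.shift β := by
  refine Prod.ext (by simp [shift, hab]) ?_
  change -D.dA _ = a • -D.dA α + b • -D.dA β
  rw [dA, dA, dA, map_add, map_smul, map_smul, smul_neg, smul_neg, smul_add, smul_add]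
  conv_lhs => rw [show (1 / 2 : ℝ) • D.lR = a • (1 / 2 : ℝ) • D.lR + b • (1 / 2 : ℝ) • D.lR by
    rw [← add_smul, hab, one_smul]]
  abel

/-- The intersection of the Voronoi cells of the lattice elements in `V`. -/
def cell (V : Set X) : Set (RealSpan X) := {α | ∀ c ∈ V, D.IsNearest α c}

lemma isNearest_combo {α β : RealSpan X} {a b : ℝ} (ha : 0 < a) (hb : 0 ≤ b) (hab : a + b = 1)
    {c₀ : X} (h₀ : D.IsNearest α c₀) (h₀' : D.IsNearest β c₀) (c : X) :
    D.IsNearest (a • α + b • β) c ↔ D.IsNearest α c ∧ (b = 0 ∨ D.IsNearest β c) := by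
  have hα := D.isNearest_iff.1 h₀
  have hβ := D.isNearest_iff.1 h₀'
  have hs : ∀ y, pairingR (D.shift (a • α + b • β)) (D.edge c₀ y) =
      a * pairingR (D.shift α) (D.edge c₀ y) + b * pairingR (D.shift β) (D.edge c₀ y) := by
    intro y
    rw [D.shift_combo hab]; simp
  have h1 : D.IsNearest (a • α + b • β) c₀ := by
    rw [isNearest_iff]
    intro y
    rw [hs]
    exact add_nonneg (mul_nonneg ha.le (hα y)) (mul_nonneg hb (hβ y))
  obtain ⟨y, rfl⟩ : ∃ y, c = c₀ + y := ⟨c - c₀, by abel⟩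
  rw [D.isNearest_add_iff h1, D.isNearest_add_iff h₀, D.isNearest_add_iff h₀', hs]
  have p1 := mul_nonneg ha.le (hα y)
  have p2 := mul_nonneg hb (hβ y)
  constructor
  · intro h
    have e1 : a * pairingR (D.shift α) (D.edge c₀ y) = 0 := by linarith
    have e2 : b * pairingR (D.shift β) (D.edge c₀ y) = 0 := by linarith
    exact ⟨(mul_eq_zero.1 e1).resolve_left ha.ne', mul_eq_zero.1 e2⟩
  · rintro ⟨h1, h2⟩
    rw [h1, mul_zero, zero_add]
    exact mul_eq_zero.2 h2

/-- The Voronoi cell dual to a Delaunay cell is the intersection of the Voronoi cells of its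
lattice elements. -/
lemma voronoiCell_delaunayCell (α₀ : RealSpan X) :
    D.voronoiCell (D.delaunayCell α₀) = D.cell {c | D.IsNearest α₀ c} := by
  let _ : TopologicalSpace (RealSpan X) := moduleTopology ℝ (RealSpan X)
  have : IsModuleTopology ℝ (RealSpan X) := ⟨rfl⟩
  have : ContinuousAdd (RealSpan X) := IsModuleTopology.toContinuousAdd ℝ (RealSpan X)
  have : ContinuousSMul ℝ (RealSpan X) := IsModuleTopology.toContinuousSMul ℝ (RealSpan X)
  apply Set.Subset.antisymm
  · refine closure_minimal ?_ ?_
    · intro α hα c hc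
      exact (D.delaunayCell_eq_iff.1 hα c).2 hc
    · have : D.cell {c | D.IsNearest α₀ c} = ⋂ c ∈ {c | D.IsNearest α₀ c}, ⋂ y,
          {α | 0 ≤ pairingR (D.shift α) (D.edge c y)} := by
        ext α
        simp [cell, isNearest_iff]
      rw [this]
      refine isClosed_biInter fun c _ => isClosed_iInter fun y => ?_
      have h1 : Continuous fun α => pairingR (D.shift α) (D.edge c y) := by
        have h2 : Continuous (D.BR.flip (lat y)) :=
          IsModuleTopology.continuous_of_linearMap (D.BR.flip (lat y))
        have h3 : (fun α => pairingR (D.shift α) (D.edge c y)) = fun α =>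
            1 * ((D.A (c + y) - D.A c : ℤ) : ℝ) - (D.BR.flip (lat y) α + (1 / 2) * D.lR (lat y)) := by
          funext α
          simp [pairingR_apply, shift, edge, dA]
          change _ = _ - (D.BR α (lat y) + _)
          ring
        rw [h3]
        fun_prop
      exact isClosed_Ici.preimage h1
  · intro α hα
    have hcont : Continuous fun t : ℝ => t • α₀ + (1 - t) • α := by fun_prop
    have h0 : Filter.Tendsto (fun t : ℝ => t • α₀ + (1 - t) • α) (nhdsWithin 0 (Set.Ioo 0 1))
        (nhds α) := by
      have := hcont.tendsto 0
      simp only [zero_smul, sub_zero, one_smul, zero_add] at this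
      exact this.mono_left nhdsWithin_le_nhds
    have : (nhdsWithin (0 : ℝ) (Set.Ioo 0 1)).NeBot := left_nhdsWithin_Ioo_neBot zero_lt_one
    refine mem_closure_of_tendsto h0 ?_
    filter_upwards [self_mem_nhdsWithin] with t ht
    refine D.delaunayCell_eq_iff.2 ?_
    obtain ⟨c₀, hc₀⟩ := D.exists_isNearest α₀
    intro c
    rw [D.isNearest_combo ht.1 (by linarith [ht.2]) (by ring) hc₀ (hα c₀ hc₀)]
    exact ⟨fun h => h.1, fun h => ⟨h, Or.inr (hα c h)⟩⟩

lemma isNearest_lat_iff (c x : X) : D.IsNearest (lat c) x ↔ x = c := by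
  constructor
  · intro h
    have h1 := D.normB_le_normB.1 (h c)
    rw [sub_self, map_zero, ← lat_sub, BR_lat] at h1
    by_contra hne
    have : D.B (x - c) (x - c) ≤ 0 := by exact_mod_cast h1
    exact absurd (D.B_pos (sub_ne_zero.2 hne)) (not_lt.2 this)
  · rintro rfl y
    rw [normB_le_normB, sub_self, map_zero]
    exact D.BR_nonneg _

lemma delaunayCell_lat (c : X) : D.delaunayCell (lat c) = {lat c} := by
  simp [delaunayCell, isNearest_lat_iff]

lemma voronoiCell_singleton (c : X) : D.voronoiCell {lat c} = D.cell {c} := by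
  rw [← D.delaunayCell_lat, voronoiCell_delaunayCell]
  simp [isNearest_lat_iff]

/-! ### Finitely many test vectors -/

lemma exists_testSet : ∃ E : Finset X, ∀ y, y ≠ 0 → y ∈ E ∨
    ∃ u v, y = u + v ∧ 0 ≤ D.B u v ∧ D.B u u < D.B y y ∧ D.B v v < D.B y y := by
  classical
  let S : AddSubgroup X := (zsmulAddGroupHom 2 : X →+ X).range
  have : Finite (X ⧸ S) := by
    have : AddGroup.FG X := Module.Finite.iff_addGroup_fg.1 inferInstance
    apply AddCommGroup.finite_of_fg_isAddTorsion
    intro x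
    obtain ⟨y, rfl⟩ := QuotientAddGroup.mk_surjective x
    rw [isOfFinAddOrder_iff_nsmul_eq_zero]
    refine ⟨2, by norm_num, ?_⟩
    rw [← QuotientAddGroup.mk_nsmul, QuotientAddGroup.eq_zero_iff]
    exact ⟨y, two_zsmul y |>.trans (two_nsmul y).symm⟩
  have hmin : ∀ q : X ⧸ S, ∃ z : X, (z : X ⧸ S) = q ∧ ∀ y : X, (y : X ⧸ S) = q → D.B z z ≤ D.B y y := by
    intro q
    obtain ⟨y₀, hy₀⟩ := QuotientAddGroup.mk_surjective q
    obtain ⟨z, hz, h⟩ := (measure fun x : X => (D.B x x).toNat).wf.has_min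
      {x : X | (x : X ⧸ S) = q} ⟨y₀, hy₀⟩
    refine ⟨z, hz, fun y hy => ?_⟩
    have := h y hy
    have h1 := D.B_nonneg y
    have h2 := D.B_nonneg z
    change ¬ ((D.B y y).toNat < (D.B z z).toNat) at this
    omega
  choose m hm hm' using hmin
  have := Fintype.ofFinite (X ⧸ S)
  refine ⟨Finset.univ.image m ∪ Finset.univ.image fun q => -m q, fun y hy => ?_⟩
  by_cases hE : y = m y ∨ y = -m y
  · left
    rcases hE with h | h
    · exact Finset.mem_union_left _ (Finset.mem_image.2 ⟨_, Finset.mem_univ _, h.symm⟩)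
    · exact Finset.mem_union_right _ (Finset.mem_image.2 ⟨_, Finset.mem_univ _, h.symm⟩)
  · right
    push Not at hE
    have h1 := hm' y y rfl
    have h2 := hm (y : X ⧸ S)
    set z := m (y : X ⧸ S) with hz
    obtain ⟨v, hv⟩ : y - z ∈ S := by
      rw [← QuotientAddGroup.eq_zero_iff, QuotientAddGroup.mk_sub, h2, sub_self]
    have hv' : y - z = v + v := by rw [← hv]; simp [two_zsmul]
    have ey : y = (z + v) + v := by
      rw [add_assoc, ← hv']; abel
    have hv0 : v ≠ 0 := by
      rintro rfl
      exact hE.1 (by simpa using ey)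
    have hu0 : z + v ≠ 0 := by
      intro h
      apply hE.2
      rw [h, zero_add] at ey
      rw [ey, eq_neg_iff_add_eq_zero, add_comm]; exact h
    have ez : D.B z z = D.B (z + v) (z + v) - 2 * D.B (z + v) v + D.B v v := by
      have := D.B_symm v z
      simp only [map_add, LinearMap.add_apply]; linarith
    have ey' : D.B y y = D.B (z + v) (z + v) + 2 * D.B (z + v) v + D.B v v := by
      have h := D.B_symm v (z + v)
      conv_lhs => rw [ey]
      rw [map_add (D.B (z + v + v)), map_add D.B, LinearMap.add_apply, LinearMap.add_apply, h]; ring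
    have p1 := D.B_pos hv0
    have p2 := D.B_pos hu0
    have p3 : 0 ≤ D.B (z + v) v := by linarith
    exact ⟨z + v, v, ey, p3, by linarith, by linarith⟩

/-- A finite set of lattice vectors that suffices to test the inequalities which define the
Voronoi cells. -/
def testSet : Finset X := D.exists_testSet.choose

lemma testSet_induction {p : X → Prop} (h0 : p 0) (hE : ∀ y ∈ D.testSet, p y)
    (hadd : ∀ u v, 0 ≤ D.B u v → p u → p v → p (u + v)) (y : X) : p y := by
  induction h : (D.B y y).toNat using Nat.strong_induction_on generalizing y with
  | _ n ih =>
    by_cases hy : y = 0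
    · rw [hy]; exact h0
    · rcases D.exists_testSet.choose_spec y hy with hy | ⟨u, v, e, huv, hu, hv⟩
      · exact hE y hy
      · have h1 := D.B_nonneg u
        have h2 := D.B_nonneg v
        rw [e]
        exact hadd u v huv (ih _ (by omega) u rfl) (ih _ (by omega) v rfl)

lemma edge_nonneg_of_testSet {n : NR X} (hn : 0 ≤ n.1) {c : X}
    (h : ∀ y ∈ D.testSet, 0 ≤ pairingR n (D.edge c y)) (y : X) : 0 ≤ pairingR n (D.edge c y) := by
  refine D.testSet_induction (p := fun y => 0 ≤ pairingR n (D.edge c y))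
    (D.pairingR_edge_zero n c).ge h ?_ y
  intro u v huv hu hv
  rw [D.pairingR_edge_add]
  have : 0 ≤ n.1 * (D.B u v : ℝ) := mul_nonneg hn (by exact_mod_cast huv)
  linarith

lemma isNearest_iff_testSet {α : RealSpan X} {c : X} :
    D.IsNearest α c ↔ ∀ y ∈ D.testSet, 0 ≤ pairingR (D.shift α) (D.edge c y) :=
  ⟨fun h y _ => D.isNearest_iff.1 h y, fun h => D.isNearest_iff.2
    (D.edge_nonneg_of_testSet zero_le_one h)⟩

/-- A vector that pairs to zero with an edge pairs to zero with test vectors that span it. -/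
lemma lat_mem_span_tight {n : NR X} (hn : 0 ≤ n.1) {c : X}
    (h : ∀ y, 0 ≤ pairingR n (D.edge c y)) (y : X) (hy : pairingR n (D.edge c y) = 0) :
    lat y ∈ Submodule.span ℝ (lat '' {e | e ∈ D.testSet ∧ pairingR n (D.edge c e) = 0}) := by
  revert hy
  refine D.testSet_induction (p := fun y => pairingR n (D.edge c y) = 0 → lat y ∈ _) ?_ ?_ ?_ y
  · intro _; rw [lat_zero]; exact zero_mem _
  · intro y hy h0
    exact Submodule.subset_span ⟨y, ⟨hy, h0⟩, rfl⟩
  · intro u v huv hu hv h0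
    rw [D.pairingR_edge_add] at h0
    have : 0 ≤ n.1 * (D.B u v : ℝ) := mul_nonneg hn (by exact_mod_cast huv)
    rw [lat_add]
    exact add_mem (hu (by linarith [h u, h v])) (hv (by linarith [h u, h v]))

end Finite

end DegenerationData

end

end MaxDegeneration

namespace MaxDegeneration

noncomputable section

namespace DegenerationData

variable {𝓡 : Type u} [CommRing 𝓡] [IsDomain 𝓡] [IsDiscreteValuationRing 𝓡]
  {K : Type u} [Field K] [Algebra 𝓡 K] [IsFractionRing 𝓡 K] {X : Type u} [AddCommGroup X]
  (D : DegenerationData 𝓡 K X)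

/-! ### The cones over intersections of Voronoi cells -/

/-- The cone over the shifted intersection of the Voronoi cells of the elements of `V`, described
by inequalities. -/
def cone (V : Set X) : PointedCone ℝ (NR X) where
  carrier := {n | 0 ≤ n.1 ∧ ∀ c ∈ V, ∀ y, 0 ≤ pairingR n (D.edge c y)}
  zero_mem' := by simp
  add_mem' := by
    rintro n n' ⟨h, h'⟩ ⟨k, k'⟩
    refine ⟨add_nonneg h k, fun c hc y => ?_⟩
    rw [map_add]
    exact add_nonneg (h' c hc y) (k' c hc y)
  smul_mem' := by
    rintro ⟨t, ht⟩ n ⟨h, h'⟩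
    refine ⟨mul_nonneg ht h, fun c hc y => ?_⟩
    change 0 ≤ pairingR (t • n) _
    rw [map_smul]
    exact mul_nonneg ht (h' c hc y)

lemma mem_cone {V : Set X} {n : NR X} :
    n ∈ D.cone V ↔ 0 ≤ n.1 ∧ ∀ c ∈ V, ∀ y, 0 ≤ pairingR n (D.edge c y) := Iff.rfl

lemma cone_anti {V W : Set X} (h : V ⊆ W) : D.cone W ≤ D.cone V :=
  fun _ hn => ⟨hn.1, fun c hc => hn.2 c (h hc)⟩

lemma cone_union (V W : Set X) : D.cone (V ∪ W) = D.cone V ⊓ D.cone W := by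
  ext n
  simp only [Submodule.mem_inf, mem_cone, Set.mem_union, or_imp, forall_and]
  tauto

lemma eq_zero_of_mem_cone {V : Set X} (hV : V.Nonempty) {n : NR X} (hn : n ∈ D.cone V)
    (h : n.1 = 0) : n = 0 := by
  obtain ⟨c, hc⟩ := hV
  refine Prod.ext h (dual_ext_lat fun y => ?_)
  have h1 := hn.2 c hc y
  have h2 := hn.2 c hc (-y)
  rw [pairingR_apply, h, zero_mul, zero_add] at h1 h2
  simp only [edge, lat_neg, map_neg] at h1 h2
  exact le_antisymm (show n.2 (lat y) ≤ 0 by linarith) h1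

lemma mem_cone_singleton_of_edge_eq_zero {n : NR X} {c c' : X} (hn : n ∈ D.cone {c})
    (h : pairingR n (D.edge c (c' - c)) = 0) : n ∈ D.cone {c'} := by
  refine ⟨hn.1, ?_⟩
  intro d hd y
  rw [Set.mem_singleton_iff.1 hd]
  have := D.pairingR_edge_trans n c c' y
  rw [h, zero_add] at this
  rw [← this]
  exact hn.2 c rfl _

lemma edge_eq_zero_of_mem_cone {n : NR X} {V : Set X} {c c' : X} (hc : c ∈ V) (hc' : c' ∈ V)
    (hn : n ∈ D.cone V) : pairingR n (D.edge c (c' - c)) = 0 := by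
  have h1 := hn.2 c hc (c' - c)
  have h2 := hn.2 c' hc' (c - c')
  rw [D.pairingR_edge_symm] at h2
  linarith

lemma mem_cone_iff_of_mem {V : Set X} {c : X} (hc : c ∈ V) {n : NR X} :
    n ∈ D.cone V ↔ n ∈ D.cone {c} ∧ ∀ c' ∈ V, pairingR n (D.edge c (c' - c)) = 0 := by
  constructor
  · intro hn
    exact ⟨D.cone_anti (by simpa using hc) hn, fun c' hc' => D.edge_eq_zero_of_mem_cone hc hc' hn⟩
  · rintro ⟨hn, h⟩
    exact ⟨hn.1, fun c' hc' => (D.mem_cone_singleton_of_edge_eq_zero hn (h c' hc')).2 c' rfl⟩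

/-- Passing to a larger set of vertices gives a face. -/
lemma cone_isFaceOf {V W : Set X} (hV : V.Nonempty) (h : V ⊆ W) :
    (D.cone W).IsFaceOf (D.cone V) := by
  obtain ⟨c, hc⟩ := hV
  refine ⟨D.cone_anti h, fun {n n' a} hn hn' ha hs => ?_⟩
  rw [D.mem_cone_iff_of_mem (h hc)] at hs ⊢
  refine ⟨D.cone_anti (by simpa using hc) hn, fun c' hc' => ?_⟩
  have h1 := hs.2 c' hc'
  rw [map_add, map_smul, LinearMap.add_apply, LinearMap.smul_apply, smul_eq_mul] at h1
  have h2 := hn.2 c hc (c' - c)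
  have h3 := hn'.2 c hc (c' - c)
  have h4 := mul_nonneg ha.le h2
  have h5 : a * pairingR n (D.edge c (c' - c)) = 0 := by linarith
  exact (mul_eq_zero.1 h5).resolve_left ha.ne'

section Finite

variable [Module.Free ℤ X] [Module.Finite ℤ X]

lemma shift_mem_cone {V : Set X} {α : RealSpan X} : D.shift α ∈ D.cone V ↔ α ∈ D.cell V := by
  simp only [mem_cone, cell, Set.mem_ofPred_eq, isNearest_iff]
  exact ⟨fun h => h.2, fun h => ⟨zero_le_one, h⟩⟩

lemma exists_shift {n : NR X} (hn : 0 < n.1) : ∃ α, n = n.1 • D.shift α := by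
  obtain ⟨α, hα⟩ := D.exists_dA (-(n.1⁻¹ • n.2))
  refine ⟨α, Prod.ext (by simp [shift]) ?_⟩
  simp [shift, hα, smul_smul, mul_inv_cancel₀ hn.ne']

lemma exists_shift_of_mem_cone {V : Set X} (hV : V.Nonempty) {n : NR X} (hn : n ∈ D.cone V)
    (h0 : n ≠ 0) : 0 < n.1 ∧ ∃ α ∈ D.cell V, n = n.1 • D.shift α := by
  have h1 : 0 < n.1 := lt_of_le_of_ne hn.1 fun h => h0 (D.eq_zero_of_mem_cone hV hn h.symm)
  obtain ⟨α, hα⟩ := D.exists_shift h1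
  refine ⟨h1, α, D.shift_mem_cone.1 ?_, hα⟩
  have : D.shift α = n.1⁻¹ • n := by
    conv_rhs => rw [hα]
    simp [shift, smul_smul, inv_mul_cancel₀ h1.ne']
  rw [this]
  exact PointedCone.smul_mem _ (inv_nonneg.2 h1.le) hn

lemma shiftedCone_cell {V : Set X} (hV : V.Nonempty) : D.shiftedCone (D.cell V) = D.cone V := by
  apply le_antisymm
  · refine Submodule.span_le.2 ?_
    rintro _ ⟨α, hα, rfl⟩
    exact D.shift_mem_cone.2 hα
  · intro n hn
    by_cases h0 : n = 0
    · rw [h0]; exact zero_mem _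
    · obtain ⟨h1, α, hα, e⟩ := D.exists_shift_of_mem_cone hV hn h0
      rw [e]
      exact PointedCone.smul_mem _ h1.le (PointedCone.subset_hull ⟨α, hα, rfl⟩)

lemma coneAt_eq (c : X) : D.coneAt c = D.cone {c} := by
  rw [coneAt, voronoiCell_singleton, D.shiftedCone_cell (Set.singleton_nonempty c)]

/-! ### Holes -/

lemma isHoleAt_iff {c : X} {α : RealSpan X} : D.IsHoleAt c α ↔ D.IsNearest α c ∧
    Submodule.span ℝ (lat '' {y | pairingR (D.shift α) (D.edge c y) = 0}) = ⊤ := by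
  rw [IsHoleAt, lat_mem_delaunayCell, and_comm]
  refine and_congr_right fun hc => ?_
  have hne : (lat c : RealSpan X) ∈ lat '' {x | D.IsNearest α x} := ⟨c, hc, rfl⟩
  rw [delaunayCell, affineSpan_convexHull,
    AffineSubspace.affineSpan_eq_top_iff_vectorSpan_eq_top_of_nonempty ℝ _ _ ⟨_, hne⟩,
    vectorSpan_eq_span_vsub_set_right ℝ hne]
  have : (fun x => x -ᵥ (lat c : RealSpan X)) '' (lat '' {x | D.IsNearest α x}) =
      lat '' {y | pairingR (D.shift α) (D.edge c y) = 0} := by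
    rw [Set.image_image]
    ext v
    constructor
    · rintro ⟨x, hx, rfl⟩
      refine ⟨x - c, ?_, by simp [lat_sub]⟩
      change pairingR _ _ = 0
      rw [← D.isNearest_add_iff hc, add_sub_cancel]
      exact hx
    · rintro ⟨y, hy, rfl⟩
      refine ⟨c + y, (D.isNearest_add_iff hc y).2 hy, by simp [lat_add]⟩
  rw [this]

lemma pairingR_shift_add (α w : RealSpan X) (t : ℝ) (m : RealSpan X × ℝ) :
    pairingR (D.shift (α + t • w)) m = pairingR (D.shift α) m - t * D.BR w m.1 := by
  simp only [pairingR_apply, shift, dA, map_add, map_smul, LinearMap.neg_apply, LinearMap.add_apply,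
    LinearMap.smul_apply, smul_eq_mul]
  ring

/-- Every linear function on a Voronoi cell takes its maximum at a hole, which can be chosen on
the smallest face that contains a given point. -/
lemma exists_isHoleAt (x : RealSpan X) {c : X} {α : RealSpan X} (hc : D.IsNearest α c) :
    ∃ α', D.IsHoleAt c α' ∧ (∀ c', D.IsNearest α c' → D.IsNearest α' c') ∧
      D.dA α x ≤ D.dA α' x := by
  induction h : Module.finrank ℝ (RealSpan X) - Module.finrank ℝ (Submodule.span ℝ
    (lat '' {y | pairingR (D.shift α) (D.edge c y) = 0})) using Nat.strong_induction_on
    generalizing α with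
  | _ n ih =>
    set W := Submodule.span ℝ (lat '' {y | pairingR (D.shift α) (D.edge c y) = 0}) with hW
    by_cases htop : W = ⊤
    · exact ⟨α, D.isHoleAt_iff.2 ⟨hc, htop⟩, fun _ h => h, le_rfl⟩
    obtain ⟨f₀, hf₀, hker₀⟩ := Submodule.exists_le_ker_of_lt_top W (lt_top_iff_ne_top.2 htop)
    obtain ⟨f, hf, hker, hfx⟩ : ∃ f : Module.Dual ℝ (RealSpan X), f ≠ 0 ∧
        W ≤ LinearMap.ker f ∧ 0 ≤ f x := by
      rcases le_total 0 (f₀ x) with h0 | h0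
      · exact ⟨f₀, hf₀, hker₀, h0⟩
      · exact ⟨-f₀, neg_ne_zero.2 hf₀, fun v hv => by simpa using hker₀ hv, by simpa using h0⟩
    obtain ⟨w, hw⟩ := D.BR_bijective.2 f
    have hpos : ∃ e ∈ D.testSet, 0 < f (lat e) := by
      by_contra hcon
      push Not at hcon
      have h1 : ∀ y : X, f (lat y) ≤ 0 := by
        intro y
        refine D.testSet_induction (p := fun y => f (lat y) ≤ 0) (by simp [lat_zero]) hcon ?_ y
        intro u v _ hu hv
        rw [lat_add, map_add]; linarith
      apply hf
      refine dual_ext_lat fun y => le_antisymm (h1 y) ?_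
      have := h1 (-y)
      rw [lat_neg, map_neg] at this
      simpa using this
    classical
    obtain ⟨e₁, he₁, hfe₁⟩ := hpos
    obtain ⟨e, he, hmin⟩ := Finset.exists_min_image (D.testSet.filter fun e => 0 < f (lat e))
      (fun e => pairingR (D.shift α) (D.edge c e) / f (lat e)) ⟨e₁, by simp [he₁, hfe₁]⟩
    rw [Finset.mem_filter] at he
    set t := pairingR (D.shift α) (D.edge c e) / f (lat e) with ht
    have hα := D.isNearest_iff.1 hc
    have ht0 : 0 ≤ t := div_nonneg (hα e) he.2.le
    have hshift : ∀ m, pairingR (D.shift (α + t • w)) m = pairingR (D.shift α) m - t * f m.1 := by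
      intro m; rw [pairingR_shift_add, hw]
    have hc' : D.IsNearest (α + t • w) c := by
      rw [isNearest_iff_testSet]
      intro y hy
      rw [hshift]
      change 0 ≤ _ - t * f (lat y)
      by_cases hfy : 0 < f (lat y)
      · have := hmin y (by simp [hy, hfy])
        rw [le_div_iff₀ hfy] at this
        linarith
      · push Not at hfy
        have := mul_nonpos_of_nonneg_of_nonpos ht0 hfy
        linarith [hα y]
    have hsub : {y | pairingR (D.shift α) (D.edge c y) = 0} ⊆
        {y | pairingR (D.shift (α + t • w)) (D.edge c y) = 0} := by
      intro y hy
      have h1 : f (lat y) = 0 := hker (Submodule.subset_span ⟨y, hy, rfl⟩)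
      change pairingR _ _ = 0
      rw [hshift, show (D.edge c y).1 = lat y from rfl, h1, mul_zero, sub_zero]
      exact hy
    have hlt : W < Submodule.span ℝ (lat '' {y | pairingR (D.shift (α + t • w)) (D.edge c y) = 0}) := by
      refine lt_of_le_of_ne (Submodule.span_mono (Set.image_mono hsub)) fun heq => ?_
      have : lat e ∈ W := by
        rw [heq]
        refine Submodule.subset_span ⟨e, ?_, rfl⟩
        change pairingR _ _ = 0
        rw [hshift]
        change _ - t * f (lat e) = 0
        rw [ht, div_mul_cancel₀ _ he.2.ne', sub_self]
      have h0 : f (lat e) = 0 := hker this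
      exact he.2.ne' h0
    have hrank := Submodule.finrank_lt_finrank_of_lt hlt
    have hle := Submodule.finrank_le (Submodule.span ℝ
      (lat '' {y | pairingR (D.shift (α + t • w)) (D.edge c y) = 0}))
    obtain ⟨α', h1, h2, h3⟩ := ih _ (by omega) hc' rfl
    refine ⟨α', h1, fun c' hcc' => h2 c' ?_, le_trans ?_ h3⟩
    · obtain ⟨y, rfl⟩ : ∃ y, c' = c + y := ⟨c' - c, by abel⟩
      rw [D.isNearest_add_iff hc'] 
      exact hsub ((D.isNearest_add_iff hc y).1 hcc')
    · have : D.dA (α + t • w) x = D.dA α x + t * f x := by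
        simp only [dA, map_add, map_smul, LinearMap.add_apply, LinearMap.smul_apply, smul_eq_mul, hw]
        ring
      rw [this]
      linarith [mul_nonneg ht0 hfx]

lemma finite_isHoleAt (c : X) : {α | D.IsHoleAt c α}.Finite := by
  classical
  refine Set.Finite.of_finite_image (f := fun α => {e | e ∈ D.testSet ∧
    pairingR (D.shift α) (D.edge c e) = 0}) ?_ ?_
  · refine (D.testSet.finite_toSet.powerset).subset ?_
    rintro _ ⟨α, -, rfl⟩ e he
    exact he.1
  · intro α hα β hβ h
    obtain ⟨h1, h2⟩ := D.isHoleAt_iff.1 hα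
    obtain ⟨h1', h2'⟩ := D.isHoleAt_iff.1 hβ
    simp only at h
    have hspan : Submodule.span ℝ (lat '' {e | e ∈ D.testSet ∧
        pairingR (D.shift α) (D.edge c e) = 0}) = ⊤ := by
      rw [eq_top_iff, ← h2, Submodule.span_le]
      rintro _ ⟨y, hy, rfl⟩
      exact D.lat_mem_span_tight zero_le_one (D.isNearest_iff.1 h1) y hy
    apply D.BR_bijective.1
    refine LinearMap.ext_on hspan ?_
    rintro _ ⟨e, he, rfl⟩
    have he' : pairingR (D.shift β) (D.edge c e) = 0 := by
      rw [h] at he; exact he.2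
    have he := he.2
    simp only [pairingR_apply, shift, dA, edge, LinearMap.neg_apply, LinearMap.add_apply] at he he'
    linarith

lemma cone_eq_hull {V : Set X} {c : X} (hc : c ∈ V) :
    D.cone V = PointedCone.hull ℝ (D.shift '' {α | D.IsHoleAt c α ∧ α ∈ D.cell V}) := by
  apply le_antisymm
  · intro n hn
    refine mem_hull_of_pairing (((D.finite_isHoleAt c).subset fun _ h => h.1).image _) n ?_
    intro m hm
    by_cases h0 : n = 0
    · simp [h0]
    · obtain ⟨h1, α, hα, e⟩ := D.exists_shift_of_mem_cone ⟨c, hc⟩ hn h0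
      obtain ⟨α', h2, h3, h4⟩ := D.exists_isHoleAt m.1 (hα c hc)
      have h5 := hm _ ⟨α', ⟨h2, fun c' hc' => h3 c' (hα c' hc')⟩, rfl⟩
      rw [e, map_smul, LinearMap.smul_apply]
      refine mul_nonneg h1.le ?_
      simp only [pairingR_apply, shift, LinearMap.neg_apply] at h5 ⊢
      linarith
  · refine Submodule.span_le.2 ?_
    rintro _ ⟨α, hα, rfl⟩
    exact D.shift_mem_cone.2 hα.2

lemma exists_multiple_mem_latticeN {c : X} {α : RealSpan X} (h : D.IsHoleAt c α) :
    ∃ N : ℕ, 0 < N ∧ (N : ℝ) • D.shift α ∈ latticeN X := by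
  obtain ⟨h1, h2⟩ := D.isHoleAt_iff.1 h
  let G : Submodule ℤ X :=
    { carrier := {x | ∃ n : ℤ, D.dA α (lat x) = n}
      zero_mem' := ⟨0, by simp [lat_zero]⟩
      add_mem' := by
        rintro x y ⟨n, hn⟩ ⟨m, hm⟩
        exact ⟨n + m, by rw [lat_add, map_add, hn, hm]; push_cast; rfl⟩
      smul_mem' := by
        rintro k x ⟨n, hn⟩
        exact ⟨k * n, by rw [lat_zsmul, map_smul, hn]; push_cast; rfl⟩ }
  have hG : ∀ y, pairingR (D.shift α) (D.edge c y) = 0 → y ∈ G := by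
    intro y hy
    refine ⟨D.A (c + y) - D.A c, ?_⟩
    simp only [pairingR_apply, shift, edge, LinearMap.neg_apply] at hy
    linarith
  have htors : ∀ q : X ⧸ G, q ∈ Submodule.torsion ℤ (X ⧸ G) := by
    intro q
    obtain ⟨x, rfl⟩ := Submodule.Quotient.mk_surjective _ q
    rw [← Submodule.Quotient.mk_eq_zero, ← Module.forall_dual_apply_eq_zero_iff ℤ]
    intro φ
    let ψ : X →ₗ[ℤ] ℤ := φ ∘ₗ (Submodule.mkQ _) ∘ₗ (Submodule.mkQ G)
    let ψR : Module.Dual ℝ (RealSpan X) :=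
      (TensorProduct.AlgebraTensorModule.rid ℤ ℝ ℝ).toLinearMap ∘ₗ ψ.baseChange ℝ
    have hψ : ∀ x, ψR (lat x) = ψ x := fun x => by simp [ψR, lat]
    have h0 : ψR = 0 := by
      refine LinearMap.ext_on h2 ?_
      rintro _ ⟨y, hy, rfl⟩
      rw [hψ]
      have : Submodule.mkQ G y = 0 := by
        rw [Submodule.mkQ_apply, Submodule.Quotient.mk_eq_zero]; exact hG y hy
      simp [ψ, LinearMap.comp_apply, this]
    have := hψ x
    rw [h0, LinearMap.zero_apply] at this
    exact_mod_cast this.symm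
  have : Finite (X ⧸ G) := by
    have : AddGroup.FG (X ⧸ G) := Module.Finite.iff_addGroup_fg.1 inferInstance
    apply AddCommGroup.finite_of_fg_isAddTorsion
    intro q
    obtain ⟨a, ha⟩ := (Submodule.mem_torsion_iff q).1 (htors q)
    rw [isOfFinAddOrder_iff_zsmul_eq_zero]
    exact ⟨a, nonZeroDivisors.coe_ne_zero a, ha⟩
  refine ⟨Nat.card (X ⧸ G), Nat.card_pos, fun x k => ?_⟩
  have : (Nat.card (X ⧸ G)) • x ∈ G := by
    rw [← Submodule.Quotient.mk_eq_zero, Submodule.Quotient.mk_smul]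
    exact card_nsmul_eq_zero'
  obtain ⟨n, hn⟩ := this
  refine ⟨Nat.card (X ⧸ G) * k - n, ?_⟩
  have h3 : lat ((Nat.card (X ⧸ G)) • x) = ((Nat.card (X ⧸ G) : ℕ) : ℝ) • lat x := by
    rw [← natCast_zsmul, lat_zsmul]; simp
  rw [h3, map_smul, smul_eq_mul] at hn
  rw [pairing_eq, map_smul, LinearMap.smul_apply, pairingR_apply]
  simp only [shift, LinearMap.neg_apply, smul_eq_mul]
  push_cast
  linear_combination -hn

/-! ### The slopes `η(x, c)` and the cone at a vertex of `Q` -/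

lemma isGreatest_eta (x c : X) : IsGreatest (D.slopes x c) (D.eta x c) := by
  have hfin : (D.slopes x c).Finite := by
    refine ((D.finite_isHoleAt c).image fun α => D.dA α (lat x)).subset ?_
    rintro _ ⟨α, hα, rfl⟩
    exact ⟨α, hα, rfl⟩
  have hne : (D.slopes x c).Nonempty := by
    obtain ⟨α, hα, -⟩ := D.exists_isHoleAt 0 ((D.isNearest_lat_iff c c).2 rfl)
    exact ⟨_, α, hα, rfl⟩
  exact ⟨hne.csSup_mem hfin, fun t ht => le_csSup hfin.bddAbove ht⟩

lemma eta_le_iff {x c : X} {k : ℤ} : D.eta x c ≤ k ↔ ∀ n ∈ D.cone {c}, 0 ≤ pairing n x k := by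
  have h1 : D.eta x c ≤ k ↔ ∀ α, D.IsHoleAt c α → 0 ≤ pairing (D.shift α) x k := by
    constructor
    · intro h α hα
      have := (D.isGreatest_eta x c).2 ⟨α, hα, rfl⟩
      simp only [pairing, shift, LinearMap.neg_apply]
      linarith
    · intro h
      obtain ⟨α, hα, e⟩ := (D.isGreatest_eta x c).1
      have := h α hα
      simp only [pairing, shift, LinearMap.neg_apply] at this
      rw [e]; linarith
  rw [h1]
  constructor
  · intro h n hn
    rw [D.cone_eq_hull (Set.mem_singleton c)] at hn
    induction hn using Submodule.span_induction with
    | mem n hn =>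
      obtain ⟨α, hα, rfl⟩ := hn
      exact h α hα.1
    | zero => simp [pairing]
    | add n n' _ _ hn hn' =>
      rw [pairing_eq] at *
      rw [map_add]; exact add_nonneg hn hn'
    | smul t n _ hn =>
      rw [pairing_eq] at *
      change 0 ≤ pairingR ((t : ℝ) • n) _
      rw [map_smul]; exact mul_nonneg t.2 hn
  · intro h α hα
    refine h _ (D.shift_mem_cone.2 ?_)
    rintro _ rfl
    exact (D.isHoleAt_iff.1 hα).1

variable [Nontrivial X]

lemma mem_hull_edge {m : RealSpan X × ℝ} {c : X} (h : ∀ n ∈ D.cone {c}, 0 ≤ pairingR n m) :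
    m ∈ PointedCone.hull ℝ (Set.range (D.edge c)) := by
  obtain ⟨y, hy⟩ := exists_ne (0 : X)
  have h1 : m ∈ PointedCone.hull ℝ (D.edge c '' ((D.testSet : Set X) ∪ {y, -y})) := by
    refine mem_hull_of_pairing_flip ((D.testSet.finite_toSet.union (by simp)).image _) m ?_
    intro n hn
    apply h
    have h1 : 0 ≤ n.1 := by
      have e := D.pairingR_edge_add n c y (-y)
      rw [add_neg_cancel, D.pairingR_edge_zero] at e
      have p1 := hn _ ⟨y, by simp, rfl⟩
      have p2 := hn _ ⟨-y, by simp, rfl⟩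
      rw [map_neg] at e
      push_cast at e
      have p3 : (0 : ℝ) < D.B y y := by exact_mod_cast D.B_pos hy
      have p4 : 0 ≤ n.1 * D.B y y := by linarith
      exact nonneg_of_mul_nonneg_left p4 p3
    refine ⟨h1, ?_⟩
    rintro _ rfl
    exact D.edge_nonneg_of_testSet h1 fun e he => hn _ ⟨e, by simp [he], rfl⟩
  exact Submodule.span_mono (Set.image_subset_range _ _) h1

lemma vertex_mem_Q (c : X) : ((lat c, (D.A c : ℝ)) : RealSpan X × ℝ) ∈ D.Q :=
  subset_convexHull ℝ _ ⟨c, rfl⟩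

lemma cone_dual_iff {m : RealSpan X × ℝ} {c : X} : (∀ n ∈ D.cone {c}, 0 ≤ pairingR n m) ↔
    ∃ t : ℝ, 0 < t ∧ (lat c, (D.A c : ℝ)) + t • m ∈ D.Q := by
  have hconv : Convex ℝ D.Q := convex_convexHull ℝ _
  set p : RealSpan X × ℝ := (lat c, (D.A c : ℝ)) with hp
  have hpQ : p ∈ D.Q := D.vertex_mem_Q c
  constructor
  · intro h
    have hm := D.mem_hull_edge h
    induction hm using Submodule.span_induction with
    | mem m hm =>
      obtain ⟨y, rfl⟩ := hm
      refine ⟨1, one_pos, ?_⟩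
      convert D.vertex_mem_Q (c + y) using 1
      simp [hp, edge, lat_add]
    | zero => exact ⟨1, one_pos, by simpa using hpQ⟩
    | add m m' h1 h1' ih ih' =>
      have hd : ∀ m'' ∈ PointedCone.hull ℝ (Set.range (D.edge c)), ∀ n ∈ D.cone {c},
          0 ≤ pairingR n m'' := by
        intro m'' hm'' n hn
        induction hm'' using Submodule.span_induction with
        | mem m hm => obtain ⟨y, rfl⟩ := hm; exact hn.2 c rfl y
        | zero => simp
        | add m m' _ _ h h' => rw [map_add]; exact add_nonneg h h'
        | smul t m _ h =>
          change 0 ≤ pairingR n ((t : ℝ) • m)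
          rw [map_smul]; exact mul_nonneg t.2 h
      obtain ⟨t, ht, hQ⟩ := ih (hd m h1)
      obtain ⟨t', ht', hQ'⟩ := ih' (hd m' h1')
      refine ⟨t * t' / (t + t'), by positivity, ?_⟩
      have := hconv hQ hQ' (a := t' / (t + t')) (b := t / (t + t')) (by positivity) (by positivity)
        (by field_simp; ring)
      convert this using 1
      have h1 : p = (t' / (t + t')) • p + (t / (t + t')) • p := by
        rw [← add_smul, ← add_div, add_comm t', div_self (by positivity), one_smul]
      conv_lhs => rw [h1]
      rw [smul_add, smul_add, smul_add, smul_smul, smul_smul,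
        show t' / (t + t') * t = t * t' / (t + t') by ring,
        show t / (t + t') * t' = t * t' / (t + t') by ring]
      abel
    | smul a m h1 ih =>
      by_cases ha : (a : ℝ) = 0
      · refine ⟨1, one_pos, ?_⟩
        change p + (1 : ℝ) • ((a : ℝ) • m) ∈ D.Q
        simpa [ha] using hpQ
      · have ha' : 0 < (a : ℝ) := lt_of_le_of_ne a.2 (Ne.symm ha)
        obtain ⟨t, ht, hQ⟩ := ih fun n hn => by
          have := h n hn
          change 0 ≤ pairingR n ((a : ℝ) • m) at this
          rw [map_smul] at this
          exact nonneg_of_mul_nonneg_right this ha'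
        refine ⟨t / a, by positivity, ?_⟩
        change p + (t / a) • ((a : ℝ) • m) ∈ D.Q
        rwa [smul_smul, div_mul_cancel₀ _ ha]
  · rintro ⟨t, ht, h⟩ n hn
    have h1 : D.Q ⊆ {q | pairingR n p ≤ pairingR n q} := by
      refine convexHull_min ?_ ?_
      · rintro _ ⟨x, rfl⟩
        have h2 := hn.2 c rfl (x - c)
        have h3 : D.edge c (x - c) = (lat x, (D.A x : ℝ)) - p := by
          simp [edge, hp, lat_sub]
        rw [h3, map_sub] at h2
        change pairingR n p ≤ _
        linarith
      · exact convex_halfSpace_ge (pairingR n).isLinear _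
    have h2 := h1 h
    change pairingR n p ≤ pairingR n _ at h2
    rw [map_add, map_smul, smul_eq_mul] at h2
    have h3 : 0 ≤ t * pairingR n m := by linarith
    exact nonneg_of_mul_nonneg_right h3 ht

end Finite

end DegenerationData

end

end MaxDegeneration

namespace MaxDegeneration

noncomputable section

namespace DegenerationData

variable {𝓡 : Type u} [CommRing 𝓡] [IsDomain 𝓡] [IsDiscreteValuationRing 𝓡]
  {K : Type u} [Field K] [Algebra 𝓡 K] [IsFractionRing 𝓡 K] {X : Type u} [AddCommGroup X]
  (D : DegenerationData 𝓡 K X) [Module.Free ℤ X] [Module.Finite ℤ X]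

/-! ### The fan -/

lemma nonempty_isNearest (α : RealSpan X) : {c | D.IsNearest α c}.Nonempty := D.exists_isNearest α

lemma mem_fan_iff {σ : PointedCone ℝ (NR X)} :
    σ ∈ D.fan ↔ σ = ⊥ ∨ ∃ α, σ = D.cone {c | D.IsNearest α c} := by
  rw [fan, Set.singleton_union, Set.mem_insert_iff]
  refine or_congr_right ?_
  constructor
  · rintro ⟨_, ⟨_, ⟨α, rfl⟩, rfl⟩, rfl⟩
    exact ⟨α, by rw [voronoiCell_delaunayCell, D.shiftedCone_cell (D.nonempty_isNearest α)]⟩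
  · rintro ⟨α, rfl⟩
    exact ⟨_, ⟨_, ⟨α, rfl⟩, rfl⟩,
      by rw [voronoiCell_delaunayCell, D.shiftedCone_cell (D.nonempty_isNearest α)]⟩

lemma coneAt_mem_fan (c : X) : D.coneAt c ∈ D.fan :=
  D.mem_fan_iff.2 (Or.inr ⟨lat c, by simp [coneAt_eq, isNearest_lat_iff]⟩)

/-- In a set of points that is closed under midpoints there is one whose nearest lattice elements
are nearest for all points of the set. -/
lemma exists_generic {G : Set (RealSpan X)} (hG : G.Nonempty)
    (hmid : ∀ α ∈ G, ∀ β ∈ G, (1 / 2 : ℝ) • α + (1 / 2 : ℝ) • β ∈ G)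
    {c₀ : X} (h₀ : ∀ α ∈ G, D.IsNearest α c₀) :
    ∃ α ∈ G, ∀ β ∈ G, ∀ c, D.IsNearest α c → D.IsNearest β c := by
  obtain ⟨α, hα, h⟩ := (measure fun α => Set.ncard {c | D.IsNearest α c}).wf.has_min G hG
  refine ⟨α, hα, fun β hβ c hc => ?_⟩
  have h1 := D.isNearest_combo (a := 1 / 2) (b := 1 / 2) (by norm_num) (by norm_num) (by norm_num)
    (h₀ α hα) (h₀ β hβ)
  have h2 : ¬ (Set.ncard _ < Set.ncard _) := h _ (hmid α hα β hβ)
  have h3 : {c | D.IsNearest ((1 / 2 : ℝ) • α + (1 / 2 : ℝ) • β) c} ⊆ {c | D.IsNearest α c} :=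
    fun c hc => ((h1 c).1 hc).1
  have h4 := Set.eq_of_subset_of_ncard_le h3 (not_lt.1 h2) (D.finite_isNearest α)
  have h5 : c ∈ {c | D.IsNearest α c} := hc
  rw [← h4] at h5
  exact (((h1 c).1 h5).2).resolve_left (by norm_num)

lemma face_mem_fan {V : Set X} (hV : V.Nonempty) {τ : PointedCone ℝ (NR X)}
    (hτ : τ.IsFaceOf (D.cone V)) : τ ∈ D.fan := by
  rw [mem_fan_iff, or_iff_not_imp_left]
  intro hbot
  obtain ⟨c₀, hc₀⟩ := hV
  have hcell : ∀ α, D.shift α ∈ τ → α ∈ D.cell V := fun α h => D.shift_mem_cone.1 (hτ.le h)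
  have hex : ∀ n ∈ τ, n ≠ 0 → ∃ α, D.shift α ∈ τ ∧ 0 < n.1 ∧ n = n.1 • D.shift α := by
    intro n hn h0
    obtain ⟨h1, α, -, e⟩ := D.exists_shift_of_mem_cone ⟨c₀, hc₀⟩ (hτ.le hn) h0
    refine ⟨α, ?_, h1, e⟩
    have : D.shift α = n.1⁻¹ • n := by
      conv_rhs => rw [e]
      simp [shift, smul_smul, inv_mul_cancel₀ h1.ne']
    rw [this]
    exact PointedCone.smul_mem _ (inv_nonneg.2 h1.le) hn
  obtain ⟨n, hn, hn0⟩ := (Submodule.ne_bot_iff τ).1 hbot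
  obtain ⟨α₁, hα₁, -, -⟩ := hex n hn hn0
  obtain ⟨α, hα, hmin⟩ := D.exists_generic (G := {α | D.shift α ∈ τ}) ⟨α₁, hα₁⟩ (by
      intro α hα β hβ
      change D.shift _ ∈ τ
      rw [D.shift_combo (by norm_num)]
      exact add_mem (PointedCone.smul_mem _ (by norm_num) hα)
        (PointedCone.smul_mem _ (by norm_num) hβ)) (fun α h => hcell α h c₀ hc₀)
  refine ⟨α, le_antisymm ?_ ?_⟩
  · intro n hn
    by_cases h0 : n = 0
    · rw [h0]; exact zero_mem _
    · obtain ⟨β, hβ, h1, e⟩ := hex n hn h0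
      rw [e]
      exact PointedCone.smul_mem _ h1.le (D.shift_mem_cone.2 fun c hc => hmin β hβ c hc)
  · intro n hn
    by_cases h0 : n = 0
    · rw [h0]; exact zero_mem _
    obtain ⟨h1, β, hβ, e⟩ := D.exists_shift_of_mem_cone (D.nonempty_isNearest α) hn h0
    rw [e]
    refine PointedCone.smul_mem _ h1.le ?_
    have hαV := hcell α hα
    have hαc := D.isNearest_iff.1 (hαV c₀ hc₀)
    have hβc₀ : D.IsNearest β c₀ := hβ c₀ (hαV c₀ hc₀)
    -- prolong the segment from `β` to `α`
    have hev : ∀ᶠ ε : ℝ in nhdsWithin 0 (Set.Ioi 0), ∀ e ∈ D.testSet,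
        0 ≤ (1 + ε) * pairingR (D.shift α) (D.edge c₀ e) -
          ε * pairingR (D.shift β) (D.edge c₀ e) := by
      rw [Filter.eventually_all_finset]
      intro e _
      rcases (hαc e).eq_or_lt with h | h
      · have h2 := (D.isNearest_add_iff hβc₀ e).1
          (hβ _ ((D.isNearest_add_iff (hαV c₀ hc₀) e).2 h.symm))
        refine Filter.Eventually.of_forall fun ε => ?_
        rw [h2, ← h]; simp
      · have hc : Continuous fun ε : ℝ => (1 + ε) * pairingR (D.shift α) (D.edge c₀ e) -
          ε * pairingR (D.shift β) (D.edge c₀ e) := by fun_prop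
        have := hc.tendsto 0
        simp only [add_zero, one_mul, zero_mul, sub_zero] at this
        exact ((this.mono_left nhdsWithin_le_nhds).eventually (lt_mem_nhds h)).mono fun _ h => h.le
    obtain ⟨ε, hε, hpos⟩ := (hev.and self_mem_nhdsWithin).exists
    change 0 < ε at hpos
    let n' := (1 + ε) • D.shift α + (-ε) • D.shift β
    have hn' : n' ∈ D.cone V := by
      rw [D.mem_cone_iff_of_mem hc₀]
      have hn1 : n'.1 = 1 := by simp [n', shift]
      refine ⟨⟨by rw [hn1]; exact zero_le_one, ?_⟩, ?_⟩
      · rintro _ rfl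
        refine D.edge_nonneg_of_testSet (by rw [hn1]; exact zero_le_one) fun e he => ?_
        have := hε e he
        simp only [n', map_add, map_smul, LinearMap.add_apply, LinearMap.smul_apply, smul_eq_mul]
        linarith
      · intro c hc
        have e1 := D.edge_eq_zero_of_mem_cone hc₀ hc (hτ.le hα)
        have e2 := D.edge_eq_zero_of_mem_cone (V := V) hc₀ hc
          (D.shift_mem_cone.2 fun c hc => hβ c (hαV c hc))
        simp only [n', map_add, map_smul, LinearMap.add_apply, LinearMap.smul_apply, smul_eq_mul,
          e1, e2, mul_zero, add_zero]
    refine hτ.mem_of_smul_add_mem (y := n') (a := ε)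
      (D.shift_mem_cone.2 fun c hc => hβ c (hαV c hc)) hn' hpos ?_
    have : ε • D.shift β + n' = (1 + ε) • D.shift α := by
      simp only [n']; module
    rw [this]
    exact PointedCone.smul_mem _ (by linarith) hα

lemma pair_zero_two_cone (y : X) (hy : y ≠ 0) : D.cone {0, y + y} = ⊥ := by
  rw [eq_bot_iff]
  intro n hn
  have h1 := D.edge_eq_zero_of_mem_cone (c := 0) (c' := y + y) (by simp) (by simp) hn
  rw [sub_zero, D.pairingR_edge_add] at h1
  have h2 := hn.2 0 (by simp) y
  have h3 : (0 : ℝ) < D.B y y := by exact_mod_cast D.B_pos hy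
  have h4 := mul_nonneg hn.1 h3.le
  have h5 : n.1 * (D.B y y : ℝ) = 0 := by linarith
  exact D.eq_zero_of_mem_cone (by simp) hn ((mul_eq_zero.1 h5).resolve_right h3.ne')

lemma exists_finset_of_mem_fan [Nontrivial X] {σ : PointedCone ℝ (NR X)} (hσ : σ ∈ D.fan) :
    ∃ V : Finset X, V.Nonempty ∧ σ = D.cone V := by
  classical
  rcases D.mem_fan_iff.1 hσ with rfl | ⟨α, rfl⟩
  · obtain ⟨y, hy⟩ := exists_ne (0 : X)
    exact ⟨{0, y + y}, by simp, by rw [← D.pair_zero_two_cone y hy]; simp⟩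
  · refine ⟨(D.finite_isNearest α).toFinset, ?_, by simp⟩
    simpa using D.nonempty_isNearest α

theorem isFan_fan [Nontrivial X] : IsFan D.fan where
  nonempty := ⟨⊥, D.mem_fan_iff.2 (Or.inl rfl)⟩
  rational := by
    intro σ hσ
    obtain ⟨V, ⟨c, hc⟩, rfl⟩ := D.exists_finset_of_mem_fan hσ
    have hfin : {α | D.IsHoleAt c α ∧ α ∈ D.cell (V : Set X)}.Finite :=
      (D.finite_isHoleAt c).subset fun _ h => h.1
    have hN : ∀ α, ∃ N : ℕ, 0 < N ∧ (D.IsHoleAt c α → (N : ℝ) • D.shift α ∈ latticeN X) := by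
      intro α
      by_cases h : D.IsHoleAt c α
      · obtain ⟨N, h1, h2⟩ := D.exists_multiple_mem_latticeN h
        exact ⟨N, h1, fun _ => h2⟩
      · exact ⟨1, one_pos, fun h' => absurd h' h⟩
    choose N hN0 hN using hN
    refine ⟨(hfin.image fun α => (N α : ℝ) • D.shift α).toFinset, ?_, ?_⟩
    · intro n hn
      rw [Set.Finite.coe_toFinset] at hn
      obtain ⟨α, hα, rfl⟩ := hn
      exact hN α hα.1
    · rw [Set.Finite.coe_toFinset, D.cone_eq_hull (c := c) (by simpa using hc)]
      apply le_antisymm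
      · refine Submodule.span_le.2 ?_
        rintro _ ⟨α, hα, rfl⟩
        have h0 : (0 : ℝ) < N α := by exact_mod_cast hN0 α
        have : D.shift α = (N α : ℝ)⁻¹ • ((N α : ℝ) • D.shift α) := by
          rw [smul_smul, inv_mul_cancel₀ h0.ne', one_smul]
        rw [this]
        exact PointedCone.smul_mem _ (inv_nonneg.2 h0.le) (PointedCone.subset_hull ⟨α, hα, rfl⟩)
      · refine Submodule.span_le.2 ?_
        rintro _ ⟨α, hα, rfl⟩
        exact PointedCone.smul_mem _ (Nat.cast_nonneg _) (PointedCone.subset_hull ⟨α, hα, rfl⟩)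
  strongly_convex := by
    intro σ hσ v hv hv'
    obtain ⟨V, hV, rfl⟩ := D.exists_finset_of_mem_fan hσ
    refine D.eq_zero_of_mem_cone (by simpa using hV) hv (le_antisymm ?_ hv.1)
    have := hv'.1
    simpa using this
  face := by
    intro σ hσ τ hτ
    obtain ⟨V, hV, rfl⟩ := D.exists_finset_of_mem_fan hσ
    exact D.face_mem_fan (by simpa using hV) hτ
  inter := by
    intro σ hσ τ hτ
    obtain ⟨V, hV, rfl⟩ := D.exists_finset_of_mem_fan hσ
    obtain ⟨W, hW, rfl⟩ := D.exists_finset_of_mem_fan hτ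
    rw [← cone_union]
    exact ⟨D.cone_isFaceOf (by simpa using hV) Set.subset_union_left,
      D.cone_isFaceOf (by simpa using hW) Set.subset_union_right⟩

/-! ### Consequences for the dual cones -/

/-- An element of the dual of the face `cone V` of `cone {c}` becomes an element of the dual of
`cone {c}` after adding a multiple of the sum of the edges from `c` to the elements of `V`. -/
lemma exists_add_mem_dual {V : Finset X} {c : X} (hc : c ∈ V) {m : RealSpan X × ℝ}
    (hm : ∀ n ∈ D.cone (V : Set X), 0 ≤ pairingR n m) :
    ∃ N : ℕ, ∀ n ∈ D.cone {c}, 0 ≤ pairingR n (m + (N : ℝ) • ∑ c' ∈ V, D.edge c (c' - c)) := by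
  have hfin := D.finite_isHoleAt c
  have hev : ∀ᶠ N : ℕ in Filter.atTop, ∀ α ∈ hfin.toFinset,
      0 ≤ pairingR (D.shift α) (m + (N : ℝ) • ∑ c' ∈ V, D.edge c (c' - c)) := by
    rw [Filter.eventually_all_finset]
    intro α hα
    have hα' : D.IsNearest α c := (D.isHoleAt_iff.1 (by simpa using hα)).1
    have hα'' := D.isNearest_iff.1 hα'
    by_cases h : ∃ c' ∈ V, 0 < pairingR (D.shift α) (D.edge c (c' - c))
    · have hs : 0 < ∑ c' ∈ V, pairingR (D.shift α) (D.edge c (c' - c)) :=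
        Finset.sum_pos' (fun c' _ => hα'' _) h
      obtain ⟨N₀, hN₀⟩ := exists_nat_ge (-(pairingR (D.shift α) m) /
        ∑ c' ∈ V, pairingR (D.shift α) (D.edge c (c' - c)))
      filter_upwards [Filter.eventually_ge_atTop N₀] with N hN
      rw [map_add, map_smul, map_sum, smul_eq_mul]
      rw [div_le_iff₀ hs] at hN₀
      have : (N₀ : ℝ) ≤ N := by exact_mod_cast hN
      have := mul_le_mul_of_nonneg_right this hs.le
      linarith
    · push Not at h
      refine Filter.Eventually.of_forall fun N => ?_
      have h0 : ∀ c' ∈ V, pairingR (D.shift α) (D.edge c (c' - c)) = 0 :=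
        fun c' hc' => le_antisymm (h c' hc') (hα'' _)
      rw [map_add, map_smul, map_sum, Finset.sum_eq_zero h0, smul_zero, add_zero]
      apply hm
      rw [D.mem_cone_iff_of_mem (by simpa using hc)]
      refine ⟨D.shift_mem_cone.2 ?_, h0⟩
      rintro _ rfl
      exact hα'
  obtain ⟨N, hN⟩ := hev.exists
  refine ⟨N, fun n hn => ?_⟩
  rw [D.cone_eq_hull (Set.mem_singleton c)] at hn
  induction hn using Submodule.span_induction with
  | mem n hn =>
    obtain ⟨α, hα, rfl⟩ := hn
    exact hN α (by simpa using hα.1)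
  | zero => simp
  | add n n' _ _ hn hn' =>
    rw [map_add pairingR, LinearMap.add_apply]
    exact add_nonneg hn hn'
  | smul t n _ hn =>
    change 0 ≤ pairingR ((t : ℝ) • n) _
    rw [map_smul]; exact mul_nonneg t.2 hn

/-- The cone `Δ(c)` is full-dimensional. -/
lemma eq_zero_of_pairing_eq_zero {c x : X} {k : ℤ} (h : ∀ n ∈ D.cone {c}, pairing n x k = 0) :
    x = 0 ∧ k = 0 := by
  have hx : x = 0 := by
    by_contra hx
    have hpos := D.B_pos hx
    set ε : ℝ := 1 / (2 * (1 + D.B x x)) with hε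
    have hposR : (0 : ℝ) < D.B x x := by exact_mod_cast hpos
    have hε0 : 0 < ε := by positivity
    have hmem : ∀ t : ℝ, 0 ≤ t → t ≤ ε → D.shift (lat c + t • lat x) ∈ D.cone {c} := by
      intro t ht hte
      refine D.shift_mem_cone.2 fun c' hc' => ?_
      rw [Set.mem_singleton_iff.1 hc', isNearest_iff]
      intro y
      rw [pairingR_shift_add]
      have h1 := D.pairingR_shift_edge (lat c) c y
      rw [sub_self, map_zero, sub_zero, lat_add, add_sub_cancel_left, BR_lat] at h1
      change 0 ≤ _ - t * D.BR (lat x) (lat y)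
      rw [BR_lat]
      have h2 : (D.B x y : ℝ) ≤ D.B y y * (1 + D.B x x) := by
        have hcs : (D.B x y : ℝ) ^ 2 ≤ D.B x x * D.B y y := by
          have := D.BR_mul_le (lat x) (lat y)
          simpa only [BR_lat] using this
        have hy : (0 : ℝ) ≤ D.B y y := by exact_mod_cast D.B_nonneg y
        rcases hy.eq_or_lt with h0 | h0
        · rw [← h0] at hcs ⊢
          nlinarith
        · have hy1 : (1 : ℝ) ≤ D.B y y := by
            have : 0 < D.B y y := by exact_mod_cast h0
            exact_mod_cast this
          refine le_of_sq_le_sq ?_ (by positivity) 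
          nlinarith [mul_nonneg hposR.le hy, mul_nonneg (mul_nonneg hposR.le hposR.le) hy,
            mul_nonneg (sub_nonneg.2 hy1) hy, mul_nonneg (mul_nonneg (sub_nonneg.2 hy1) hy) hposR.le,
            mul_nonneg (mul_nonneg (mul_nonneg (sub_nonneg.2 hy1) hy) hposR.le) hposR.le]
      rcases le_total (D.B x y : ℝ) 0 with h3 | h3
      · have hy : (0 : ℝ) ≤ D.B y y := by exact_mod_cast D.B_nonneg y
        linarith [mul_nonpos_of_nonneg_of_nonpos ht h3]
      · have h4 : t * (D.B x y : ℝ) ≤ ε * (D.B y y * (1 + D.B x x)) :=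
          mul_le_mul hte h2 h3 hε0.le
        have h5 : ε * ((D.B y y : ℝ) * (1 + D.B x x)) = D.B y y / 2 := by
          rw [hε]; field_simp
        linarith
    have e1 := h _ (hmem 0 le_rfl hε0.le)
    have e2 := h _ (hmem ε hε0.le le_rfl)
    rw [pairing_eq, pairingR_shift_add] at e1 e2
    change _ - ε * D.BR (lat x) (lat x) = 0 at e2
    rw [BR_lat] at e2
    rw [zero_mul, sub_zero] at e1
    rw [e1] at e2
    have := mul_pos hε0 hposR
    linarith
  refine ⟨hx, ?_⟩
  have h1 := h (D.shift (lat c)) (D.shift_mem_cone.2 (by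
    rintro _ rfl; exact (D.isNearest_lat_iff _ _).2 rfl))
  rw [hx] at h1
  simp only [pairing, shift, lat_zero, map_zero, add_zero, one_mul] at h1
  exact_mod_cast h1

end DegenerationData

end

end MaxDegeneration

namespace MaxDegeneration

noncomputable section

section MonomialAlgebra

variable {𝓡 : Type u} [CommRing 𝓡] {K : Type u} [Field K] [Algebra 𝓡 K] {G : Type u}

/-! ### Algebras generated by monomials -/

/-- Elements of an algebra spanned by monomials are described coefficientwise. -/
lemma mem_adjoin_single_iff [AddMonoid G] {s : 𝓡} (hs : algebraMap 𝓡 K s ≠ 0)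
    {p : G → ℤ → Prop} (h0 : p 0 0) (hadd : ∀ g k g' k', p g k → p g' k' → p (g + g') (k + k'))
    {f : AddMonoidAlgebra K G} :
    f ∈ Algebra.adjoin 𝓡 {m : AddMonoidAlgebra K G |
        ∃ g k, p g k ∧ m = AddMonoidAlgebra.single g (algebraMap 𝓡 K s ^ k)} ↔
      ∀ g, f.coeff g = 0 ∨ ∃ k, p g k ∧ ∃ r : 𝓡, f.coeff g = algebraMap 𝓡 K r *
        algebraMap 𝓡 K s ^ k := by
  classical
  have hcl : ∀ m ∈ Submonoid.closure {m : AddMonoidAlgebra K G |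
      ∃ g k, p g k ∧ m = AddMonoidAlgebra.single g (algebraMap 𝓡 K s ^ k)},
      ∃ g k, p g k ∧ m = AddMonoidAlgebra.single g (algebraMap 𝓡 K s ^ k) := by
    intro m hm
    induction hm using Submonoid.closure_induction with
    | mem m h => exact h
    | one => exact ⟨0, 0, h0, by simp [AddMonoidAlgebra.one_def]⟩
    | mul m n _ _ hm hn =>
      obtain ⟨g, k, h, rfl⟩ := hm
      obtain ⟨g', k', h', rfl⟩ := hn
      exact ⟨_, _, hadd _ _ _ _ h h', by
        rw [AddMonoidAlgebra.single_mul_single, zpow_add₀ hs]⟩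
  constructor
  · intro hf g
    rw [← Subalgebra.mem_toSubmodule, Algebra.adjoin_eq_span] at hf
    induction hf using Submodule.span_induction with
    | mem m hm =>
      obtain ⟨g', k, h, rfl⟩ := hcl m hm
      by_cases hg : g' = g
      · subst hg
        exact Or.inr ⟨k, h, 1, by simp [AddMonoidAlgebra.coeff_single]⟩
      · exact Or.inl (by simp [AddMonoidAlgebra.coeff_single, Finsupp.single_apply, hg])
    | zero => exact Or.inl rfl
    | add x y _ _ hx hy =>
      have key : ∀ k k' : ℤ, k ≤ k' → ∀ r r' : 𝓡, algebraMap 𝓡 K r * algebraMap 𝓡 K s ^ k +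
          algebraMap 𝓡 K r' * algebraMap 𝓡 K s ^ k' =
          algebraMap 𝓡 K (r + r' * s ^ (k' - k).toNat) * algebraMap 𝓡 K s ^ k := by
        intro k k' hk r r'
        have : algebraMap 𝓡 K s ^ k' = algebraMap 𝓡 K s ^ (k' - k).toNat * algebraMap 𝓡 K s ^ k := by
          rw [← zpow_natCast, ← zpow_add₀ hs, Int.toNat_of_nonneg (by omega)]
          congr 1; ring
        rw [this, map_add, map_mul, map_pow]; ring
      rw [AddMonoidAlgebra.coeff_add, Finsupp.add_apply]
      rcases hx with hx | ⟨k, hk, r, hr⟩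
      · rw [hx, zero_add]; exact hy
      rcases hy with hy | ⟨k', hk', r', hr'⟩
      · rw [hy, add_zero]; exact Or.inr ⟨k, hk, r, hr⟩
      right
      rw [hr, hr']
      rcases le_total k k' with h | h
      · exact ⟨k, hk, _, key k k' h r r'⟩
      · exact ⟨k', hk', _, (add_comm _ _).trans (key k' k h r' r)⟩
    | smul a x _ hx =>
      rw [AddMonoidAlgebra.coeff_smul, Finsupp.smul_apply]
      rcases hx with hx | ⟨k, hk, r, hr⟩
      · left; rw [hx, smul_zero]
      · right
        exact ⟨k, hk, a * r, by rw [hr, Algebra.smul_def, map_mul, mul_assoc]⟩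
  · intro h
    rw [← AddMonoidAlgebra.sum_coeff_single f]
    refine sum_mem fun g hg => ?_
    rcases h g with h | ⟨k, hk, r, hr⟩
    · exact absurd h (Finsupp.mem_support_iff.1 hg)
    · have : AddMonoidAlgebra.single g (f.coeff g) =
          r • AddMonoidAlgebra.single g (algebraMap 𝓡 K s ^ k) := by
        rw [hr, AddMonoidAlgebra.smul_single, Algebra.smul_def]
      rw [this]
      refine Subalgebra.smul_mem _ (Algebra.subset_adjoin ?_) r
      exact ⟨g, k, hk, rfl⟩

/-- Multiplication of the coefficients of an element by a character. -/
def twistHom (𝓡 : Type u) [CommRing 𝓡] [Algebra 𝓡 K] {G' : Type u} [AddMonoid G]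
    [AddMonoid G'] (φ : G →+ G') (χ : Multiplicative G →* K) :
    AddMonoidAlgebra K G →ₐ[𝓡] AddMonoidAlgebra K G' :=
  (AddMonoidAlgebra.lift K (AddMonoidAlgebra K G') G
    { toFun := fun g => AddMonoidAlgebra.single (φ g.toAdd) (χ g)
      map_one' := by simp [AddMonoidAlgebra.one_def]
      map_mul' := fun g h => by
        simp [AddMonoidAlgebra.single_mul_single] }).restrictScalars 𝓡

lemma twistHom_single {G' : Type u} [AddMonoid G] [AddMonoid G'] (φ : G →+ G')
    (χ : Multiplicative G →* K) (g : G) (k : K) :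
    twistHom 𝓡 φ χ (AddMonoidAlgebra.single g k) =
      AddMonoidAlgebra.single (φ g) (k * χ (Multiplicative.ofAdd g)) := by
  simp [twistHom, AddMonoidAlgebra.lift_single, AddMonoidAlgebra.smul_single]

lemma monomial_mul {X : Type u} [AddCommGroup X] {s : 𝓡} (hs : algebraMap 𝓡 K s ≠ 0) (x y : X)
    (k k' : ℤ) : monomial 𝓡 s K x k * monomial 𝓡 s K y k' = monomial 𝓡 s K (x + y) (k + k') := by
  rw [monomial, monomial, AddMonoidAlgebra.single_mul_single, ← zpow_add₀ hs]; rfl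

lemma monomial_zero {X : Type u} [AddCommGroup X] (s : 𝓡) :
    monomial 𝓡 s K (0 : X) 0 = 1 := by
  simp [monomial, AddMonoidAlgebra.one_def]

lemma monomial_pow {X : Type u} [AddCommGroup X] (s : 𝓡) (x : X) (k : ℤ) (n : ℕ) :
    monomial 𝓡 s K x k ^ n = monomial 𝓡 s K (n • x) (n * k) := by
  rw [monomial, monomial, AddMonoidAlgebra.single_pow, mul_comm, zpow_mul, zpow_natCast]

lemma mem_coneAlgebra {X : Type u} [AddCommGroup X] {s : 𝓡} (hs : algebraMap 𝓡 K s ≠ 0)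
    {σ : PointedCone ℝ (NR X)} {f : AddMonoidAlgebra K X} :
    f ∈ coneAlgebra 𝓡 s K σ ↔ ∀ x, f.coeff x = 0 ∨ ∃ k : ℤ, (∀ v ∈ σ, 0 ≤ pairing v x k) ∧
      ∃ r : 𝓡, f.coeff x = algebraMap 𝓡 K r * algebraMap 𝓡 K s ^ k := by
  refine mem_adjoin_single_iff hs (p := fun x k => ∀ v ∈ σ, 0 ≤ pairing v x k) ?_ ?_
  · intro v _; simp [pairing, lat]
  · intro x k y k' h h' v hv
    have := add_nonneg (h v hv) (h' v hv)
    simp only [pairing, lat_add, map_add, Int.cast_add] at this ⊢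
    linarith

lemma monomial_mem_coneAlgebra {X : Type u} [AddCommGroup X] {s : 𝓡}
    {σ : PointedCone ℝ (NR X)} {x : X} {k : ℤ} (h : ∀ v ∈ σ, 0 ≤ pairing v x k) :
    monomial 𝓡 s K x k ∈ coneAlgebra 𝓡 s K σ :=
  Algebra.subset_adjoin ⟨x, k, h, rfl⟩

end MonomialAlgebra

namespace DegenerationData

variable {𝓡 : Type u} [CommRing 𝓡] [IsDomain 𝓡] [IsDiscreteValuationRing 𝓡]
  {K : Type u} [Field K] [Algebra 𝓡 K] [IsFractionRing 𝓡 K] {X : Type u} [AddCommGroup X]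
  (D : DegenerationData 𝓡 K X) [Module.Free ℤ X] [Module.Finite ℤ X] {s : 𝓡}

lemma vertexAlgebra_eq (c : X) : coneAlgebra 𝓡 s K (D.coneAt c) = D.vertexAlgebra s c := by
  simp only [coneAlgebra, vertexAlgebra, coneAt_eq, eta_le_iff]

lemma monomial_mem_vertexAlgebra {x c : X} {k : ℤ} (h : D.eta x c ≤ k) :
    monomial 𝓡 s K x k ∈ D.vertexAlgebra s c := Algebra.subset_adjoin ⟨x, k, h, rfl⟩

lemma eta_edge_le (c y : X) : D.eta (y - c) c ≤ ((D.A y - D.A c : ℤ) : ℝ) := by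
  rw [eta_le_iff]
  intro n hn
  have := (D.mem_cone.1 hn).2 c rfl (y - c)
  rwa [edge, ← pairing_eq, add_sub_cancel] at this

lemma algebraMap_uniformizer_ne_zero (K : Type u) [Field K] [Algebra 𝓡 K] [IsFractionRing 𝓡 K]
    (hs : Irreducible s) : algebraMap 𝓡 K s ≠ 0 := by
  simpa using hs.ne_zero

lemma mem_vertexAlgebra (hs : Irreducible s) {c : X} {f : AddMonoidAlgebra K X} :
    f ∈ D.vertexAlgebra s c ↔ ∀ x, f.coeff x = 0 ∨ ∃ k : ℤ, D.eta x c ≤ k ∧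
      ∃ r : 𝓡, f.coeff x = algebraMap 𝓡 K r * algebraMap 𝓡 K s ^ k := by
  rw [← vertexAlgebra_eq, mem_coneAlgebra (algebraMap_uniformizer_ne_zero K hs)]
  simp only [coneAt_eq, eta_le_iff]

/-- The lattice elements of the cone at a vertex give a basis of `R(c)`. -/
lemma exists_basis_vertexAlgebra (hs : Irreducible s) (c : X) :
    ∃ ζ : Module.Basis X 𝓡 (D.vertexAlgebra s c),
      ∀ x, (ζ x : AddMonoidAlgebra K X) = monomial 𝓡 s K x ⌈D.eta x c⌉ := by
  have hπ := algebraMap_uniformizer_ne_zero K hs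
  let v : X → D.vertexAlgebra s c := fun x =>
    ⟨monomial 𝓡 s K x ⌈D.eta x c⌉, D.monomial_mem_vertexAlgebra (Int.le_ceil _)⟩
  have hli : LinearIndependent 𝓡 v := by
    rw [linearIndependent_iff]
    intro l hl
    ext x
    have h1 := congrArg (fun z : D.vertexAlgebra s c => (z : AddMonoidAlgebra K X).coeff x) hl
    have h2 : ((Finsupp.linearCombination 𝓡 v l : D.vertexAlgebra s c) :
        AddMonoidAlgebra K X) = l.sum fun y r => AddMonoidAlgebra.single y
          (algebraMap 𝓡 K r * algebraMap 𝓡 K s ^ ⌈D.eta y c⌉) := by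
      rw [Finsupp.linearCombination_apply, Finsupp.sum, Finsupp.sum,
        AddSubmonoidClass.coe_finsetSum]
      refine Finset.sum_congr rfl fun y _ => ?_
      simp [v, monomial, AddMonoidAlgebra.smul_single, Algebra.smul_def]
    simp only [h2] at h1
    rw [Finsupp.sum, AddMonoidAlgebra.coeff_sum, Finsupp.finsetSum_apply,
      Finset.sum_eq_single x] at h1
    · simpa [AddMonoidAlgebra.coeff_single, zpow_ne_zero _ hπ] using h1
    · intro y _ hy
      simp [AddMonoidAlgebra.coeff_single, Finsupp.single_apply, hy]
    · intro hx
      simp [Finsupp.notMem_support_iff.1 hx, AddMonoidAlgebra.coeff_single]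
  have hsp : ⊤ ≤ Submodule.span 𝓡 (Set.range v) := by
    rintro ⟨f, hf⟩ -
    have h1 : (Submodule.span 𝓡 (Set.range v)).map (D.vertexAlgebra s c).val.toLinearMap =
        Submodule.span 𝓡 (Set.range fun x => monomial 𝓡 s K x ⌈D.eta x c⌉) := by
      rw [Submodule.map_span, ← Set.range_comp]; rfl
    have h2 : f ∈ (Submodule.span 𝓡 (Set.range v)).map (D.vertexAlgebra s c).val.toLinearMap := by
      rw [h1, ← AddMonoidAlgebra.sum_coeff_single f]
      refine sum_mem fun x hx => ?_
      rcases (D.mem_vertexAlgebra hs).1 hf x with h | ⟨k, hk, r, hr⟩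
      · exact absurd h (Finsupp.mem_support_iff.1 hx)
      · have hk' : ⌈D.eta x c⌉ ≤ k := Int.ceil_le.2 hk
        have : AddMonoidAlgebra.single x (f.coeff x) =
            (r * s ^ (k - ⌈D.eta x c⌉).toNat) • monomial 𝓡 s K x ⌈D.eta x c⌉ := by
          rw [hr, monomial, AddMonoidAlgebra.smul_single, Algebra.smul_def, map_mul, map_pow,
            mul_assoc, ← zpow_natCast, ← zpow_add₀ hπ, Int.toNat_of_nonneg (by omega),
            sub_add_cancel]
        simp only [this]
        exact Submodule.smul_mem _ _ (Submodule.subset_span ⟨x, rfl⟩)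
    obtain ⟨g, hg, rfl⟩ := h2
    exact hg
  exact ⟨Module.Basis.mk hli hsp, fun x => by rw [Module.Basis.mk_apply]⟩

/-! ### Translations -/

lemma mem_cone_translate {c : X} {n : NR X} :
    n ∈ D.cone {c} ↔ ((n.1, n.2 + n.1 • D.BR (lat c)) : NR X) ∈ D.cone {0} := by
  simp only [mem_cone, Set.mem_singleton_iff, forall_eq, edge, ← pairing_eq, pairing,
    LinearMap.add_apply, LinearMap.smul_apply, BR_lat, D.A_add, zero_add]
  have hA : D.A 0 = 0 := by
    have := D.A_add 0 0
    simp at this; exact this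
  refine and_congr_right fun _ => forall_congr' fun y => ?_
  rw [hA]; push_cast
  rw [smul_eq_mul, map_zero, LinearMap.zero_apply, Int.cast_zero]
  constructor <;> intro h <;> linarith

lemma eta_le_translate {x c : X} {k : ℤ} :
    D.eta x c ≤ k ↔ D.eta x 0 ≤ ((k - D.B c x : ℤ) : ℝ) := by
  rw [eta_le_iff, eta_le_iff]
  constructor
  · intro h n hn
    have := h (n.1, n.2 - n.1 • D.BR (lat c)) (by rw [mem_cone_translate]; simpa using hn)
    simp only [pairing, LinearMap.sub_apply, LinearMap.smul_apply, BR_lat, smul_eq_mul] at this ⊢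
    push_cast; linarith
  · intro h n hn
    have := h _ (D.mem_cone_translate.1 hn)
    simp only [pairing, LinearMap.add_apply, LinearMap.smul_apply, BR_lat, smul_eq_mul] at this ⊢
    push_cast at this; linarith

lemma nonempty_vertexAlgebra_zero_equiv (hs : Irreducible s) (c : X) :
    Nonempty (D.vertexAlgebra s 0 ≃ₐ[𝓡] D.vertexAlgebra s c) := by
  have hπ := algebraMap_uniformizer_ne_zero K hs
  let χ (ε : ℤ) : Multiplicative X →* K :=
    { toFun := fun x => algebraMap 𝓡 K s ^ (ε * D.B c x.toAdd)
      map_one' := by simp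
      map_mul' := fun x y => by simp [mul_add, zpow_add₀ hπ] }
  let τ (ε : ℤ) := twistHom 𝓡 (AddMonoidHom.id X) (χ ε)
  have hτ : ∀ ε x k, τ ε (monomial 𝓡 s K x k) = monomial 𝓡 s K x (k + ε * D.B c x) := by
    intro ε x k
    simp [τ, monomial, twistHom_single, χ, zpow_add₀ hπ]
  have hinv : ∀ ε f, τ (-ε) (τ ε f) = f := by
    intro ε f
    induction f using AddMonoidAlgebra.induction_linear with
    | zero => simp
    | add f g hf hg => simp [hf, hg]
    | single x k =>
      simp [τ, twistHom_single, χ, mul_assoc, mul_inv_cancel₀, zpow_ne_zero, hπ]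
  have hinj : Function.Injective (τ 1) := Function.LeftInverse.injective (hinv 1)
  have hmap : (D.vertexAlgebra s 0).map (τ 1) = D.vertexAlgebra s c := by
    rw [vertexAlgebra, vertexAlgebra, AlgHom.map_adjoin]
    congr 1
    ext m
    constructor
    · rintro ⟨_, ⟨x, k, hk, rfl⟩, rfl⟩
      refine ⟨x, k + D.B c x, ?_, by rw [hτ, one_mul]⟩
      rw [eta_le_translate, add_sub_cancel_right]; exact hk
    · rintro ⟨x, k, hk, rfl⟩
      exact ⟨_, ⟨x, k - D.B c x, D.eta_le_translate.1 hk, rfl⟩, by rw [hτ]; congr 1; ring⟩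
  exact ⟨((D.vertexAlgebra s 0).equivMapOfInjective (τ 1) hinj).trans
    (Subalgebra.equivOfEq _ _ hmap)⟩

lemma nonempty_vertexAlgebra_equiv (hs : Irreducible s) (c c' : X) :
    Nonempty (D.vertexAlgebra s c ≃ₐ[𝓡] D.vertexAlgebra s c') := by
  obtain ⟨e⟩ := D.nonempty_vertexAlgebra_zero_equiv hs c
  obtain ⟨e'⟩ := D.nonempty_vertexAlgebra_zero_equiv hs c'
  exact ⟨e.symm.trans e'⟩

/-! ### Finite generation -/

/-- Gordan's lemma for finitely many integral functionals that separate points. -/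
lemma exists_finset_closure_of_functionals {M ι : Type*} [AddCommGroup M] [Finite ι]
    (F : M →+ (ι → ℤ)) (hF : Function.Injective F) :
    ∃ T : Finset M, (∀ m ∈ T, ∀ i, 0 ≤ F m i) ∧
      ∀ m, (∀ i, 0 ≤ F m i) → m ∈ AddSubmonoid.closure (T : Set M) := by
  classical
  let cast : (ι → ℕ) →+ (ι → ℤ) := AddMonoidHom.mk' (fun p i => (p i : ℤ)) fun p q => by
    ext i; simp
  let P : AddSubmonoid (ι → ℕ) := (AddMonoidHom.mrange F).comap cast
  have hP : P.FG := by
    refine AddSubmonoid.fg_of_subtractive fun x hx y hxy => ?_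
    obtain ⟨m, hm⟩ := hx
    obtain ⟨m', hm'⟩ := hxy
    exact ⟨m' - m, by rw [map_sub, hm, hm', map_add, add_sub_cancel_left]⟩
  obtain ⟨T, hT⟩ := hP
  have hTP : ∀ p ∈ T, p ∈ P := fun p hp => by
    rw [← hT]; exact AddSubmonoid.subset_closure hp
  choose! g hg using hTP
  refine ⟨T.image g, ?_, ?_⟩
  · intro m hm i
    obtain ⟨p, hp, rfl⟩ := Finset.mem_image.1 hm
    rw [hg p hp]; simp [cast]
  · intro m hm
    have h1 : cast (fun i => (F m i).toNat) = F m := by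
      ext i; simp [cast, hm i]
    have h2 : (fun i => (F m i).toNat) ∈ AddSubmonoid.closure (T : Set (ι → ℕ)) := by
      rw [hT]; exact ⟨m, h1.symm⟩
    have h3 : ∀ p ∈ AddSubmonoid.closure (T : Set (ι → ℕ)),
        ∃ m ∈ AddSubmonoid.closure ((T.image g : Finset M) : Set M), F m = cast p := by
      intro p hp
      induction hp using AddSubmonoid.closure_induction with
      | mem p hp => exact ⟨g p, AddSubmonoid.subset_closure (by simpa using ⟨p, hp, rfl⟩), hg p hp⟩
      | zero => exact ⟨0, zero_mem _, by simp⟩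
      | add p q _ _ hp hq =>
        obtain ⟨m, hm, e⟩ := hp
        obtain ⟨m', hm', e'⟩ := hq
        exact ⟨m + m', add_mem hm hm', by rw [map_add, map_add, e, e']⟩
    obtain ⟨m', hm', e⟩ := h3 _ h2
    rw [h1] at e
    rwa [← hF e]

lemma finiteType_vertexAlgebra (hs : Irreducible s) (c : X) :
    Algebra.FiniteType 𝓡 (D.vertexAlgebra s c) := by
  classical
  have hπ := algebraMap_uniformizer_ne_zero K hs
  let H := {α | D.IsHoleAt c α}
  have hfin : Finite H := D.finite_isHoleAt c
  have h1 : ∀ α : H, ∃ F : (X × ℤ) →+ ℤ, ∃ N : ℕ, 0 < N ∧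
      ∀ m : X × ℤ, (F m : ℝ) = N * pairing (D.shift α.1) m.1 m.2 := by
    intro α
    obtain ⟨N, hN, h⟩ := D.exists_multiple_mem_latticeN α.2
    choose f hf using h
    refine ⟨AddMonoidHom.mk' (fun m => f m.1 m.2) ?_, N, by exact_mod_cast hN, ?_⟩
    · intro m m'
      have : ((f (m + m').1 (m + m').2 : ℤ) : ℝ) = ((f m.1 m.2 + f m'.1 m'.2 : ℤ) : ℝ) := by
        push_cast
        rw [← hf, ← hf, ← hf]
        simp only [pairing, Prod.fst_add, Prod.snd_add, lat_add, map_add, Int.cast_add]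
        ring
      exact_mod_cast this
    · intro m
      rw [AddMonoidHom.mk'_apply, ← hf]
      simp only [pairing, Prod.smul_fst, Prod.smul_snd, LinearMap.smul_apply, smul_eq_mul]
      ring
  choose F N hN hF using h1
  have hdual : ∀ x k, (∀ α : H, 0 ≤ pairing (D.shift α.1) x k) → D.eta x c ≤ k := by
    intro x k h
    rw [eta_le_iff, D.cone_eq_hull (Set.mem_singleton c)]
    intro n hn
    induction hn using Submodule.span_induction with
    | mem n hn => obtain ⟨α, hα, rfl⟩ := hn; exact h ⟨α, hα.1⟩
    | zero => simp [pairing]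
    | add n n' _ _ h h' =>
      simp only [pairing, Prod.fst_add, Prod.snd_add, LinearMap.add_apply] at h h' ⊢; linarith
    | smul a n _ h =>
      have e : pairing (a • n) x k = (a : ℝ) * pairing n x k := by
        change (a : ℝ) * n.1 * k + (a : ℝ) * n.2 (lat x) = _
        rw [pairing]; ring
      rw [e]; exact mul_nonneg a.2 h
  let F' : X × ℤ →+ (H → ℤ) := AddMonoidHom.mk' (fun m α => F α m) fun m m' => by
    ext α; simp
  have hpos : ∀ α m, 0 ≤ F α m ↔ 0 ≤ pairing (D.shift α.1) m.1 m.2 := by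
    intro α m
    have h1 : (0 : ℝ) < N α := by exact_mod_cast hN α
    have h2 := hF α m
    constructor
    · intro h
      have : (0 : ℝ) ≤ F α m := by exact_mod_cast h
      rw [h2] at this
      exact nonneg_of_mul_nonneg_right this h1
    · intro h
      have : (0 : ℝ) ≤ F α m := by rw [h2]; exact mul_nonneg h1.le h
      exact_mod_cast this
  have hF' : Function.Injective F' := by
    rw [injective_iff_map_eq_zero]
    rintro ⟨x, k⟩ hm
    have h0 : ∀ α, F α (x, k) = 0 := fun α => congrFun hm α
    have h1 := D.eta_le_iff.1 (hdual x k fun α => (hpos α (x, k)).1 (h0 α).ge)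
    have h2 := D.eta_le_iff.1 (hdual (-x) (-k) fun α => (hpos α (-(x, k))).1
      (by rw [map_neg, h0 α, neg_zero]))
    obtain ⟨rfl, rfl⟩ := D.eq_zero_of_pairing_eq_zero (c := c) (x := x) (k := k) fun n hn => by
      have a1 := h1 n hn
      have a2 := h2 n hn
      simp only [pairing, lat_neg, map_neg, Int.cast_neg] at a1 a2 ⊢
      linarith
    rfl
  obtain ⟨T, hT, hcl⟩ := exists_finset_closure_of_functionals F' hF'
  rw [← Subalgebra.fg_iff_finiteType]
  refine ⟨T.image fun m => monomial 𝓡 s K m.1 m.2, le_antisymm ?_ ?_⟩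
  · refine Algebra.adjoin_le ?_
    intro f hf
    obtain ⟨m, hm, rfl⟩ := Finset.mem_image.1 (Finset.mem_coe.1 hf)
    exact D.monomial_mem_vertexAlgebra (hdual _ _ fun α => (hpos α m).1 (hT m hm α))
  · refine Algebra.adjoin_le ?_
    rintro _ ⟨x, k, hk, rfl⟩
    have h1 : ∀ m ∈ AddSubmonoid.closure (T : Set (X × ℤ)), monomial 𝓡 s K m.1 m.2 ∈
        Algebra.adjoin 𝓡 ((T.image fun m : X × ℤ => monomial 𝓡 s K m.1 m.2 :
          Finset (AddMonoidAlgebra K X)) : Set (AddMonoidAlgebra K X)) := by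
      intro m hm
      induction hm using AddSubmonoid.closure_induction with
      | mem m hm => exact Algebra.subset_adjoin (by
          rw [Finset.coe_image]; exact Set.mem_image_of_mem _ hm)
      | zero =>
        have := monomial_zero (X := X) (K := K) s
        exact this ▸ one_mem _
      | add m m' _ _ h h' =>
        have := mul_mem h h'
        rwa [monomial_mul hπ] at this
    refine h1 (x, k) (hcl (x, k) fun α => (hpos α (x, k)).2 ?_)
    refine D.eta_le_iff.1 hk _ ?_
    rw [shift_mem_cone]
    exact fun c' hc' => hc' ▸ (D.isHoleAt_iff.1 α.2).1

end DegenerationData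

end

end MaxDegeneration

namespace MaxDegeneration

noncomputable section

/-- The homomorphism from a homogeneous localization induced by a ring homomorphism. -/
def awayDesc {A σ B : Type*} [CommRing A] [CommRing B] [SetLike σ A] [AddSubgroupClass σ A]
    (𝒜 : ℕ → σ) [GradedRing 𝒜] (g : A →+* B) (z : A) (hz : IsUnit (g z)) :
    HomogeneousLocalization.Away 𝒜 z →+* B :=
  (Localization.awayLift g z hz).comp (algebraMap _ (Localization.Away z))

lemma awayDesc_mk {A σ B : Type*} [CommRing A] [CommRing B] [SetLike σ A] [AddSubgroupClass σ A]
    (𝒜 : ℕ → σ) [GradedRing 𝒜] (g : A →+* B) {z : A} (hz : IsUnit (g z)) {v : B}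
    (hv : g z * v = 1) {d : ℕ} (hd : z ∈ 𝒜 d) (n : ℕ) (f : A) (hf : f ∈ 𝒜 (n • d)) :
    awayDesc 𝒜 g z hz (HomogeneousLocalization.Away.mk 𝒜 hd n f hf) = g f * v ^ n := by
  rw [awayDesc, RingHom.comp_apply, HomogeneousLocalization.algebraMap_apply,
    HomogeneousLocalization.Away.val_mk]
  exact Localization.awayLift_mk g z f v hv n

lemma fromZeroRingHom_algebraMap {R A : Type*} [CommRing R] [CommRing A] [Algebra R A]
    (𝒜 : ℕ → Submodule R A) [GradedAlgebra 𝒜] {z : A} {d : ℕ} (hz : z ∈ 𝒜 d) (r : R) :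
    HomogeneousLocalization.fromZeroRingHom 𝒜 (Submonoid.powers z) (algebraMap R (𝒜 0) r) =
      HomogeneousLocalization.Away.mk 𝒜 hz 0 (algebraMap R A r)
        (by rw [zero_smul]; exact SetLike.algebraMap_mem_graded _ r) := by
  rw [HomogeneousLocalization.ext_iff_val, HomogeneousLocalization.Away.val_mk]
  change Localization.mk _ _ = Localization.mk _ _
  congr 1
  exact Subtype.ext (pow_zero z).symm

lemma isIso_specMap_ringEquiv {A B : Type u} [CommRing A] [CommRing B] (e : A ≃+* B) :
    IsIso (Spec.map (CommRingCat.ofHom e.toRingHom)) :=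
  (inferInstance : IsIso (Spec.map e.toCommRingCatIso.hom))

lemma specMap_awayι {A B : Type u} {σ : Type*} [CommRing A] [CommRing B] [SetLike σ A]
    [AddSubgroupClass σ A] (𝒜 : ℕ → σ) [GradedRing 𝒜] {z : A} {d : ℕ} (hz : z ∈ 𝒜 d) (hd : 0 < d)
    (e : HomogeneousLocalization.Away 𝒜 z ≃+* B) :
    IsOpenImmersion (Spec.map (CommRingCat.ofHom e.toRingHom) ≫ Proj.awayι 𝒜 z hz hd) ∧
      Set.range (Spec.map (CommRingCat.ofHom e.toRingHom) ≫ Proj.awayι 𝒜 z hz hd) =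
        (Proj.basicOpen 𝒜 z : Set (Proj 𝒜)) := by
  have := isIso_specMap_ringEquiv e
  refine ⟨inferInstance, ?_⟩
  rw [← Proj.opensRange_awayι 𝒜 z hz hd,
    ← Scheme.Hom.opensRange_comp_of_isIso (Spec.map (CommRingCat.ofHom e.toRingHom))]
  rfl

namespace DegenerationData

variable {𝓡 : Type u} [CommRing 𝓡] [IsDomain 𝓡] [IsDiscreteValuationRing 𝓡]
  {K : Type u} [Field K] [Algebra 𝓡 K] [IsFractionRing 𝓡 K] {X : Type u} [AddCommGroup X]
  (D : DegenerationData 𝓡 K X) {s : 𝓡}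

/-! ### The graded algebra and its localizations -/

lemma zero_mem_coneQ : (0 : ℝ × RealSpan X × ℝ) ∈ D.coneQ :=
  ⟨0, le_rfl, (lat 0, (D.A 0 : ℝ)), subset_convexHull ℝ _ ⟨0, rfl⟩, by rw [zero_smul]; rfl⟩

lemma smul_mem_coneQ {v : ℝ × RealSpan X × ℝ} (hv : v ∈ D.coneQ) {t : ℝ} (ht : 0 ≤ t) :
    t • v ∈ D.coneQ := by
  obtain ⟨a, ha, q, hq, rfl⟩ := hv
  exact ⟨t * a, mul_nonneg ht ha, q, hq, by simp [Prod.smul_def, smul_smul, mul_assoc]⟩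

lemma add_mem_coneQ {v w : ℝ × RealSpan X × ℝ} (hv : v ∈ D.coneQ) (hw : w ∈ D.coneQ) :
    v + w ∈ D.coneQ := by
  obtain ⟨a, ha, q, hq, rfl⟩ := hv
  obtain ⟨b, hb, r, hr, rfl⟩ := hw
  rcases (add_nonneg ha hb).eq_or_lt with h | h
  · obtain rfl : a = 0 := by linarith
    obtain rfl : b = 0 := by linarith
    exact ⟨0, le_rfl, q, hq, by simp⟩
  · refine ⟨a + b, h.le, (a / (a + b)) • q + (b / (a + b)) • r,
      (convex_convexHull ℝ _) hq hr (by positivity) (by positivity) (by field_simp), ?_⟩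
    rw [smul_add, smul_smul, smul_smul, mul_div_cancel₀ _ h.ne', mul_div_cancel₀ _ h.ne']
    rfl

lemma one_mem_coneQ {q : RealSpan X × ℝ} (hq : q ∈ D.Q) : ((1, q) : ℝ × RealSpan X × ℝ) ∈ D.coneQ :=
  ⟨1, zero_le_one, q, hq, by simp⟩

lemma vertex_mem_Q' (c : X) : ((lat c, (D.A c : ℝ)) : RealSpan X × ℝ) ∈ D.Q :=
  subset_convexHull ℝ _ ⟨c, rfl⟩

/-- From every point of `Q` one can move away from some vertex. -/
lemma exists_sub_mem_coneQ {q : RealSpan X × ℝ} (hq : q ∈ D.Q) : ∃ (c : X) (ε : ℝ), 0 < ε ∧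
    ((1, q) : ℝ × RealSpan X × ℝ) - ε • (1, lat c, (D.A c : ℝ)) ∈ D.coneQ := by
  have hconv : Convex ℝ {q : RealSpan X × ℝ | q ∈ D.Q ∧ ∃ (c : X) (ε : ℝ), 0 < ε ∧
      ((1, q) : ℝ × RealSpan X × ℝ) - ε • (1, lat c, (D.A c : ℝ)) ∈ D.coneQ} := by
    rintro q ⟨hq, c, ε, hε, h⟩ q' ⟨hq', c', ε', hε', h'⟩ a b ha hb hab
    refine ⟨convex_convexHull ℝ _ hq hq' ha hb hab, ?_⟩
    rcases ha.eq_or_lt with rfl | ha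
    · obtain rfl : b = 1 := by linarith
      exact ⟨c', ε', hε', by simpa using h'⟩
    · refine ⟨c, a * ε, mul_pos ha hε, ?_⟩
      have h1 := D.add_mem_coneQ (D.smul_mem_coneQ h ha.le)
        (D.smul_mem_coneQ (D.one_mem_coneQ hq') hb)
      convert h1 using 1
      have : ((1, a • q + b • q') : ℝ × RealSpan X × ℝ) = a • (1, q) + b • (1, q') := by
        simp [Prod.smul_def, hab]
      rw [this]
      module
  refine (convexHull_min ?_ hconv hq).2
  rintro _ ⟨c, rfl⟩
  exact ⟨D.vertex_mem_Q' c, c, 1, one_pos, by simpa using D.zero_mem_coneQ⟩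

lemma mem_satAlgebra (hs : Irreducible s) {f : AddMonoidAlgebra K (ℕ × X)} :
    f ∈ D.satAlgebra s ↔ ∀ p : ℕ × X, f.coeff p = 0 ∨ ∃ k : ℤ,
      (((p.1 : ℝ), lat p.2, (k : ℝ)) : ℝ × RealSpan X × ℝ) ∈ D.coneQ ∧
      ∃ r : 𝓡, f.coeff p = algebraMap 𝓡 K r * algebraMap 𝓡 K s ^ k := by
  have hset : {m | ∃ (d : ℕ) (x : X) (x₀ : ℤ),
      (((d : ℝ), lat x, (x₀ : ℝ)) : ℝ × RealSpan X × ℝ) ∈ D.coneQ ∧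
      m = gradedMonomial 𝓡 K s d x x₀} = {m | ∃ (p : ℕ × X) (k : ℤ),
      (((p.1 : ℝ), lat p.2, (k : ℝ)) : ℝ × RealSpan X × ℝ) ∈ D.coneQ ∧
      m = AddMonoidAlgebra.single p (algebraMap 𝓡 K s ^ k)} := by
    ext m
    exact ⟨fun ⟨d, x, k, h⟩ => ⟨(d, x), k, h⟩, fun ⟨p, k, h⟩ => ⟨p.1, p.2, k, h⟩⟩
  rw [satAlgebra, hset]
  obtain ⟨P, hP⟩ : ∃ P : ℕ × X → ℤ → Prop, ∀ p k, P p k ↔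
      (((p.1 : ℝ), lat p.2, (k : ℝ)) : ℝ × RealSpan X × ℝ) ∈ D.coneQ := ⟨_, fun _ _ => Iff.rfl⟩
  simp only [← hP]
  refine mem_adjoin_single_iff (algebraMap_uniformizer_ne_zero K hs) ?_ ?_
  · rw [hP]
    convert D.zero_mem_coneQ using 1
    ext <;> simp [lat]
  · intro g k g' k' h h'
    rw [hP] at *
    convert D.add_mem_coneQ h h' using 1
    ext <;> simp [lat_add]

lemma gradedMonomial_mem {d : ℕ} {x : X} {k : ℤ}
    (h : (((d : ℝ), lat x, (k : ℝ)) : ℝ × RealSpan X × ℝ) ∈ D.coneQ) :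
    gradedMonomial 𝓡 K s d x k ∈ D.satAlgebra s :=
  Algebra.subset_adjoin ⟨d, x, k, h, rfl⟩

/-- The substitution `ζ_c = 1`. -/
def vertexHom (s : 𝓡) (c : X) : AddMonoidAlgebra K (ℕ × X) →ₐ[𝓡] AddMonoidAlgebra K X :=
  twistHom 𝓡 (AddMonoidHom.mk' (fun p : ℕ × X => p.2 - p.1 • c) fun p q => by
      rw [Prod.fst_add, Prod.snd_add, add_smul]; abel)
    { toFun := fun p => (algebraMap 𝓡 K s ^ (-D.A c)) ^ p.toAdd.1
      map_one' := by simp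
      map_mul' := fun p q => by simp [pow_add] }

lemma vertexHom_single (c : X) (d : ℕ) (x : X) (k : K) :
    D.vertexHom s c (AddMonoidAlgebra.single (d, x) k) =
      AddMonoidAlgebra.single (x - d • c) (k * (algebraMap 𝓡 K s ^ (-D.A c)) ^ d) := by
  simp [vertexHom, twistHom_single]

lemma vertexHom_gradedMonomial (hs : Irreducible s) (c : X) (d : ℕ) (x : X) (k : ℤ) :
    D.vertexHom s c (gradedMonomial 𝓡 K s d x k) = monomial 𝓡 s K (x - d • c) (k - d * D.A c) := by
  rw [gradedMonomial, vertexHom_single, monomial, ← zpow_natCast, ← zpow_mul,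
    ← zpow_add₀ (algebraMap_uniformizer_ne_zero K hs)]
  congr 2; ring

lemma vertexHom_zeta (hs : Irreducible s) (c c' : X) :
    D.vertexHom s c (D.zeta s c') = monomial 𝓡 s K (c' - c) (D.A c' - D.A c) := by
  rw [zeta, D.vertexHom_gradedMonomial hs]; simp

lemma vertexHom_zeta_self (hs : Irreducible s) (c : X) : D.vertexHom s c (D.zeta s c) = 1 := by
  rw [D.vertexHom_zeta hs, sub_self, sub_self, monomial_zero]

lemma zeta_pow (c : X) (n : ℕ) : (D.zeta s c : AddMonoidAlgebra K (ℕ × X)) ^ n =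
    AddMonoidAlgebra.single (n, n • c) ((algebraMap 𝓡 K s ^ D.A c) ^ n) := by
  simp [zeta, gradedMonomial, AddMonoidAlgebra.single_pow]

lemma sum_single_of_mem_grade {n : ℕ} {f : D.satAlgebra s} (hf : f ∈ D.grade s n) :
    (f : AddMonoidAlgebra K (ℕ × X)) = ∑ p ∈ f.1.coeff.support,
      AddMonoidAlgebra.single (n, p.2) (f.1.coeff p) := by
  conv_lhs => rw [← AddMonoidAlgebra.sum_coeff_single f.1]
  refine Finset.sum_congr rfl fun p hp => ?_
  rw [← hf p hp]

lemma mapDomain_vertexHom (hs : Irreducible s) (c : X) {n : ℕ} {f : D.satAlgebra s}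
    (hf : f ∈ D.grade s n) :
    AddMonoidAlgebra.mapDomain (fun x : X => ((0, x) : ℕ × X)) (D.vertexHom s c f) *
      (D.zeta s c : AddMonoidAlgebra K (ℕ × X)) ^ n = f := by
  have hπ := algebraMap_uniformizer_ne_zero K hs
  have h1 : ∀ g : AddMonoidAlgebra K X, AddMonoidAlgebra.mapDomain
      (fun x : X => ((0, x) : ℕ × X)) g =
      AddMonoidAlgebra.mapDomainRingHom K (AddMonoidHom.inr ℕ X) g := fun g => rfl
  rw [h1]
  conv_lhs => rw [D.sum_single_of_mem_grade hf]
  conv_rhs => rw [D.sum_single_of_mem_grade hf]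
  rw [map_sum, map_sum, Finset.sum_mul]
  refine Finset.sum_congr rfl fun p _ => ?_
  rw [vertexHom_single, ← h1, AddMonoidAlgebra.mapDomain_single, zeta_pow,
    AddMonoidAlgebra.single_mul_single, mul_assoc, ← mul_pow, ← zpow_add₀ hπ]
  simp

/-- Changing the vertex. -/
lemma vertexHom_change (hs : Irreducible s) (c c' : X) {n : ℕ} {f : D.satAlgebra s}
    (hf : f ∈ D.grade s n) :
    D.vertexHom s c f = D.vertexHom s c' f * D.vertexHom s c (D.zeta s c') ^ n := by
  have hπ := algebraMap_uniformizer_ne_zero K hs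
  rw [D.vertexHom_zeta hs, monomial_pow]
  rw [D.sum_single_of_mem_grade hf]
  rw [map_sum, map_sum, Finset.sum_mul]
  refine Finset.sum_congr rfl fun p _ => ?_
  rw [vertexHom_single, vertexHom_single, monomial, AddMonoidAlgebra.single_mul_single, mul_assoc]
  congr 1
  · rw [smul_sub]; abel
  · rw [← zpow_natCast, ← zpow_mul, ← zpow_natCast, ← zpow_mul, ← zpow_add₀ hπ]
    congr 2; ring

/-- The substitution `ζ_c = 1` on `R`. -/
def vertexRing (s : 𝓡) (c : X) : D.satAlgebra s →+* AddMonoidAlgebra K X :=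
  ((D.vertexHom s c).comp (D.satAlgebra s).val).toRingHom

lemma vertexRing_apply (c : X) (f : D.satAlgebra s) :
    D.vertexRing s c f = D.vertexHom s c f := rfl

/-- The homomorphism from a localization of the graded algebra induced by `ζ_c = 1`. -/
def awayHom (c : X) (z : D.satAlgebra s) (hz : IsUnit (D.vertexRing s c z)) :
    HomogeneousLocalization.Away (D.grade s) z →+* AddMonoidAlgebra K X :=
  awayDesc (D.grade s) (D.vertexRing s c) z hz

lemma awayHom_mk {c : X} {z : D.satAlgebra s} (hz : IsUnit (D.vertexRing s c z))
    {v : AddMonoidAlgebra K X} (hv : D.vertexRing s c z * v = 1) {d : ℕ} (hd : z ∈ D.grade s d)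
    (n : ℕ) (f : D.satAlgebra s) (hf : f ∈ D.grade s (n • d)) :
    D.awayHom c z hz (HomogeneousLocalization.Away.mk (D.grade s) hd n f hf) =
      D.vertexHom s c f * v ^ n := by
  rw [awayHom, awayDesc_mk (D.grade s) (D.vertexRing s c) hz hv hd n f hf, vertexRing_apply]

variable [Module.Free ℤ X] [Module.Finite ℤ X] [Nontrivial X]

lemma eta_le_of_mem_coneQ {c x : X} {d : ℕ} {k : ℤ}
    (h : (((d : ℝ), lat x, (k : ℝ)) : ℝ × RealSpan X × ℝ) ∈ D.coneQ) :
    D.eta (x - d • c) c ≤ ((k - d * D.A c : ℤ) : ℝ) := by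
  obtain ⟨t, ht, q, hq, e⟩ := h
  obtain ⟨rfl, e2⟩ := Prod.ext_iff.1 e
  simp only at e2
  rw [eta_le_iff]
  simp only [pairing_eq]
  rcases Nat.eq_zero_or_pos d with rfl | hd
  · rw [Nat.cast_zero, zero_smul] at e2
    obtain ⟨e3, e4⟩ := Prod.ext_iff.1 e2
    simp only [Prod.fst_zero, Prod.snd_zero] at e3 e4
    intro n _
    simp [e3, e4, pairingR_apply]
  · have hd' : (0 : ℝ) < d := by exact_mod_cast hd
    rw [cone_dual_iff]
    refine ⟨(d : ℝ)⁻¹, by positivity, ?_⟩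
    convert hq using 1
    have e3 : q = (d : ℝ)⁻¹ • ((lat x, (k : ℝ)) : RealSpan X × ℝ) := by
      rw [e2, smul_smul, inv_mul_cancel₀ hd'.ne', one_smul]
    have e4 : ((lat (x - d • c), ((k - d * D.A c : ℤ) : ℝ)) : RealSpan X × ℝ) =
        (lat x, (k : ℝ)) - (d : ℝ) • (lat c, (D.A c : ℝ)) := by
      rw [lat_sub, ← natCast_zsmul, lat_zsmul]
      ext <;> simp
    rw [e3, e4, smul_sub, smul_smul, inv_mul_cancel₀ hd'.ne', one_smul]
    abel

lemma exists_mem_coneQ_of_eta_le {c x : X} {k : ℤ} (h : D.eta x c ≤ k) : ∃ n : ℕ, 1 ≤ n ∧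
    (((n : ℝ), lat (n • c + x), ((n * D.A c + k : ℤ) : ℝ)) : ℝ × RealSpan X × ℝ) ∈ D.coneQ := by
  rw [eta_le_iff] at h
  simp only [pairing_eq] at h
  rw [cone_dual_iff] at h
  obtain ⟨t, ht, hq⟩ := h
  obtain ⟨n, hn⟩ := exists_nat_gt t⁻¹
  have hn0 : (0 : ℝ) < n := (by positivity : (0 : ℝ) < t⁻¹).trans hn
  refine ⟨n, by exact_mod_cast hn0, ?_⟩
  have h1 : 0 ≤ (n : ℝ) - t⁻¹ := by linarith
  have h2 := D.add_mem_coneQ (D.smul_mem_coneQ (D.one_mem_coneQ hq) (inv_pos.2 ht).le)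
    (D.smul_mem_coneQ (D.one_mem_coneQ (D.vertex_mem_Q' c)) h1)
  convert h2 using 1
  rw [lat_add, ← natCast_zsmul, lat_zsmul]
  ext
  · simp
  · simp only [Prod.smul_mk, Prod.mk_add_mk, smul_add, smul_smul, inv_mul_cancel₀ ht.ne', Int.cast_natCast]
    module
  · simp only [Prod.smul_mk, Prod.mk_add_mk, smul_add, smul_smul, inv_mul_cancel₀ ht.ne']
    push_cast
    simp only [smul_eq_mul]; ring

lemma vertexHom_mem (hs : Irreducible s) (c : X) (f : D.satAlgebra s) :
    D.vertexHom s c f ∈ D.vertexAlgebra s c := by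
  have : D.satAlgebra s ≤ (D.vertexAlgebra s c).comap (D.vertexHom s c) := by
    refine Algebra.adjoin_le ?_
    rintro _ ⟨d, x, k, h, rfl⟩
    change D.vertexHom s c _ ∈ D.vertexAlgebra s c
    rw [D.vertexHom_gradedMonomial hs]
    exact D.monomial_mem_vertexAlgebra (D.eta_le_of_mem_coneQ h)
  exact this f.2

lemma gradedMonomial_mem_grade {d : ℕ} {x : X} {k : ℤ}
    (h : (((d : ℝ), lat x, (k : ℝ)) : ℝ × RealSpan X × ℝ) ∈ D.coneQ) :
    (⟨gradedMonomial 𝓡 K s d x k, D.gradedMonomial_mem h⟩ : D.satAlgebra s) ∈ D.grade s d := by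
  intro p hp
  have : p = (d, x) := by
    by_contra h
    apply Finsupp.mem_support_iff.1 hp
    simp [gradedMonomial, AddMonoidAlgebra.coeff_single, Finsupp.single_apply, Ne.symm h]
  rw [this]

lemma isUnit_vertexHom_zeta_self (hs : Irreducible s) (c : X) :
    IsUnit (D.vertexRing s c (D.zeta s c)) := by
  rw [vertexRing_apply, D.vertexHom_zeta_self hs]; exact isUnit_one

lemma awayHom_zeta_mk (hs : Irreducible s) (c : X) (n : ℕ) (f : D.satAlgebra s)
    (hf : f ∈ D.grade s (n • 1)) :
    D.awayHom c (D.zeta s c) (D.isUnit_vertexHom_zeta_self hs c)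
      (HomogeneousLocalization.Away.mk (D.grade s) (D.zeta_mem s c) n f hf) =
      D.vertexHom s c f := by
  rw [D.awayHom_mk _ (v := 1) (by rw [vertexRing_apply, D.vertexHom_zeta_self hs, mul_one]), one_pow, mul_one]

/-- The fractions `f / ζ_c^n` as elements of `R(c)`. -/
def vertexRingHom (hs : Irreducible s) (c : X) :
    HomogeneousLocalization.Away (D.grade s) (D.zeta s c) →+* D.vertexAlgebra s c :=
  (D.awayHom c (D.zeta s c) (D.isUnit_vertexHom_zeta_self hs c)).codRestrict
    (D.vertexAlgebra s c) fun z => by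
      obtain ⟨n, f, hf, rfl⟩ := HomogeneousLocalization.Away.mk_surjective _ (D.zeta_mem s c) z
      rw [D.awayHom_zeta_mk hs]
      exact D.vertexHom_mem hs c f

lemma vertexRingHom_mk (hs : Irreducible s) (c : X) (n : ℕ) (f : D.satAlgebra s)
    (hf : f ∈ D.grade s (n • 1)) :
    (D.vertexRingHom hs c (HomogeneousLocalization.Away.mk (D.grade s) (D.zeta_mem s c) n f hf) :
      AddMonoidAlgebra K X) = D.vertexHom s c f :=
  D.awayHom_zeta_mk hs c n f hf

lemma vertexRingHom_algebraMap (hs : Irreducible s) (c : X) (r : 𝓡) :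
    D.vertexRingHom hs c (HomogeneousLocalization.fromZeroRingHom (D.grade s) _ (algebraMap 𝓡 (D.grade s 0) r)) =
      algebraMap 𝓡 (D.vertexAlgebra s c) r := by
  rw [fromZeroRingHom_algebraMap _ (D.zeta_mem s c)]
  apply Subtype.ext
  rw [vertexRingHom_mk]
  exact (D.vertexHom s c).commutes r

lemma vertexRingHom_bijective (hs : Irreducible s) (c : X) :
    Function.Bijective (D.vertexRingHom hs c) := by
  constructor
  · rw [injective_iff_map_eq_zero]
    intro z hz
    obtain ⟨n, f, hf, rfl⟩ := HomogeneousLocalization.Away.mk_surjective _ (D.zeta_mem s c) z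
    have h1 := D.vertexRingHom_mk hs c n f hf
    rw [hz] at h1
    have h2 := D.mapDomain_vertexHom hs c hf
    rw [← h1] at h2
    have h3 : f = 0 := Subtype.ext (by rw [← h2]; simp)
    subst h3
    rw [HomogeneousLocalization.ext_iff_val, HomogeneousLocalization.Away.val_mk,
      HomogeneousLocalization.val_zero, Localization.mk_zero]
  · rintro ⟨f, hf⟩
    suffices ∃ z, (D.vertexRingHom hs c z : AddMonoidAlgebra K X) = f by
      obtain ⟨z, hz⟩ := this
      exact ⟨z, Subtype.ext hz⟩
    rw [vertexAlgebra] at hf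
    induction hf using Algebra.adjoin_induction with
    | mem m hm =>
      obtain ⟨x, k, hk, rfl⟩ := hm
      obtain ⟨n, hn, h⟩ := D.exists_mem_coneQ_of_eta_le hk
      refine ⟨HomogeneousLocalization.Away.mk (D.grade s) (D.zeta_mem s c) n
        ⟨_, D.gradedMonomial_mem h⟩ (by rw [nsmul_one]; exact D.gradedMonomial_mem_grade h), ?_⟩
      rw [vertexRingHom_mk, D.vertexHom_gradedMonomial hs]
      congr 1 <;> simp
    | algebraMap r => exact ⟨_, congrArg Subtype.val (D.vertexRingHom_algebraMap hs c r)⟩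
    | add f g _ _ hf hg =>
      obtain ⟨z, rfl⟩ := hf
      obtain ⟨w, rfl⟩ := hg
      exact ⟨z + w, by simp⟩
    | mul f g _ _ hf hg =>
      obtain ⟨z, rfl⟩ := hf
      obtain ⟨w, rfl⟩ := hg
      exact ⟨z * w, by simp⟩

/-- The isomorphism of the degree zero part of `R[ζ_c⁻¹]` with `R(c)`. -/
def vertexEquiv (hs : Irreducible s) (c : X) :
    HomogeneousLocalization.Away (D.grade s) (D.zeta s c) ≃+* D.vertexAlgebra s c :=
  RingEquiv.ofBijective _ (D.vertexRingHom_bijective hs c)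

lemma vertexEquiv_mk (hs : Irreducible s) (c : X) (n : ℕ) (f : D.satAlgebra s)
    (hf : f ∈ D.grade s (n • 1)) :
    (D.vertexEquiv hs c (HomogeneousLocalization.Away.mk (D.grade s) (D.zeta_mem s c) n f hf) :
      AddMonoidAlgebra K X) = D.vertexHom s c f :=
  D.vertexRingHom_mk hs c n f hf

/-! ### The open subschemes `U(c)` -/

/-- The open immersion `Spec R(c) → P̃`. -/
def vertexImm (hs : Irreducible s) (c : X) : specOver 𝓡 (D.vertexAlgebra s c) ⟶ D.P s :=
  Over.homMk (Spec.map (CommRingCat.ofHom (D.vertexEquiv hs c).toRingHom) ≫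
    Proj.awayι (D.grade s) (D.zeta s c) (D.zeta_mem s c) one_pos) (by
      change (Spec.map _ ≫ Proj.awayι _ _ _ _) ≫ (Proj.toSpecZero _ ≫ Spec.map _) =
        Spec.map (CommRingCat.ofHom (algebraMap _ _))
      rw [Category.assoc, Proj.awayι_toSpecZero_assoc, ← Spec.map_comp, ← Spec.map_comp,
        ← CommRingCat.ofHom_comp, ← CommRingCat.ofHom_comp]
      congr 2
      ext1 r
      exact D.vertexRingHom_algebraMap hs c r)

lemma vertexImm_left (hs : Irreducible s) (c : X) : (D.vertexImm hs c).left =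
    Spec.map (CommRingCat.ofHom (D.vertexEquiv hs c).toRingHom) ≫
      Proj.awayι (D.grade s) (D.zeta s c) (D.zeta_mem s c) one_pos := rfl

instance isOpenImmersion_vertexImm (hs : Irreducible s) (c : X) :
    IsOpenImmersion (D.vertexImm hs c).left :=
  (specMap_awayι (D.grade s) (D.zeta_mem s c) one_pos (D.vertexEquiv hs c)).1

/-- The open subset `D₊(ζ_c)`. -/
def vertexOpen (s : 𝓡) (c : X) : (D.P s).left.Opens := Proj.basicOpen (D.grade s) (D.zeta s c)

lemma range_vertexImm (hs : Irreducible s) (c : X) :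
    Set.range (D.vertexImm hs c).left = D.vertexOpen s c :=
  (specMap_awayι (D.grade s) (D.zeta_mem s c) one_pos (D.vertexEquiv hs c)).2

lemma exists_mem_vertexOpen (hs : Irreducible s) (p : (D.P s).left) :
    ∃ c, p ∈ D.vertexOpen s c := by
  by_contra! hcon
  let x : ProjectiveSpectrum (D.grade s) := p
  have hx : ∀ c, D.zeta s c ∈ x.asHomogeneousIdeal.toIdeal := fun c => by
    by_contra h; exact hcon c h
  have hprime := x.isPrime
  have hmon : ∀ (d : ℕ) (y : X) (k : ℤ) (_ : d ≠ 0)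
      (h : (((d : ℝ), lat y, (k : ℝ)) : ℝ × RealSpan X × ℝ) ∈ D.coneQ),
      (⟨gradedMonomial 𝓡 K s d y k, D.gradedMonomial_mem h⟩ : D.satAlgebra s) ∈
        x.asHomogeneousIdeal.toIdeal := by
    intro d y k hd h
    obtain ⟨t, ht, q, hq, e⟩ := h
    obtain ⟨rfl, e2⟩ := Prod.ext_iff.1 e
    obtain ⟨c, ε, hε, hc⟩ := D.exists_sub_mem_coneQ hq
    have hd' : (0 : ℝ) < d := by exact_mod_cast Nat.pos_of_ne_zero hd
    obtain ⟨N, hN⟩ := exists_nat_gt ((d * ε)⁻¹)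
    have hN0 : (0 : ℝ) < N := (by positivity : (0 : ℝ) < (d * ε)⁻¹).trans hN
    have hN1 : 1 ≤ N * d := by
      have : 0 < N := by exact_mod_cast hN0
      exact Nat.mul_pos this (Nat.pos_of_ne_zero hd)
    have hN2 : 0 ≤ N * d * ε - 1 := by
      have := (inv_lt_iff_one_lt_mul₀ (by positivity)).1 hN
      linarith
    have h1 : ((((N * d - 1 : ℕ) : ℝ), lat (N • y - c), ((N * k - D.A c : ℤ) : ℝ)) :
        ℝ × RealSpan X × ℝ) ∈ D.coneQ := by
      have h2 := D.add_mem_coneQ (D.smul_mem_coneQ hc (t := N * d) (by positivity))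
        (D.smul_mem_coneQ (D.one_mem_coneQ (D.vertex_mem_Q' c)) hN2)
      convert h2 using 1
      have e3 : ((((N * d - 1 : ℕ) : ℝ), lat (N • y - c), ((N * k - D.A c : ℤ) : ℝ)) :
        ℝ × RealSpan X × ℝ) = (N : ℝ) • ((d : ℝ), lat y, (k : ℝ)) - (1, lat c, (D.A c : ℝ)) := by
        rw [lat_sub, ← natCast_zsmul, lat_zsmul, Nat.cast_sub hN1]
        ext <;> simp
      have e4 : (((d : ℝ), lat y, (k : ℝ)) : ℝ × RealSpan X × ℝ) = (d : ℝ) • (1, q) := by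
        rw [e]; ext <;> simp
      rw [e3, e4]; module
    refine hprime.mem_of_pow_mem N ?_
    have h3 : (⟨gradedMonomial 𝓡 K s d y k, D.gradedMonomial_mem ⟨_, ht, q, hq, e⟩⟩ :
        D.satAlgebra s) ^ N = ⟨_, D.gradedMonomial_mem h1⟩ * D.zeta s c := by
      apply Subtype.ext
      simp only [SubmonoidClass.mk_pow, MulMemClass.coe_mul]
      simp only [zeta, gradedMonomial]
      rw [ AddMonoidAlgebra.single_pow,
        AddMonoidAlgebra.single_mul_single, ← zpow_add₀ (algebraMap_uniformizer_ne_zero K hs)]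
      congr 1
      · ext
        · simp; omega
        · simp
      · rw [sub_add_cancel, mul_comm, zpow_mul, zpow_natCast]
    rw [h3]
    exact Ideal.mul_mem_left _ _ (hx c)
  refine x.not_irrelevant_le ((HomogeneousIdeal.irrelevant_le _).2 fun i hi f hf => ?_)
  have hf' : f ∈ D.grade s i := hf
  have key : (f : AddMonoidAlgebra K (ℕ × X)) ∈ (x.asHomogeneousIdeal.toIdeal.restrictScalars 𝓡).map
      (D.satAlgebra s).val.toLinearMap := by
    rw [← AddMonoidAlgebra.sum_coeff_single f.1]
    refine sum_mem fun p hp => ?_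
    rcases (D.mem_satAlgebra hs).1 f.2 p with h | ⟨k, hk, r, hr⟩
    · exact absurd h (Finsupp.mem_support_iff.1 hp)
    · have h1 : AddMonoidAlgebra.single p (f.1.coeff p) = r • gradedMonomial 𝓡 K s p.1 p.2 k := by
        rw [hr, gradedMonomial, AddMonoidAlgebra.smul_single, Algebra.smul_def]
      rw [h1]
      exact Submodule.smul_mem _ _ ⟨_, hmon _ _ _ (by rw [hf' p hp]; exact hi.ne') hk, rfl⟩
  obtain ⟨g, hg, e⟩ := key
  obtain rfl : g = f := Subtype.ext e
  exact hg

end DegenerationData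

end

end MaxDegeneration

namespace MaxDegeneration

noncomputable section

/-- A criterion for a homomorphism to be a localization at one element, in terms of spectra. -/
lemma specMap_isOpenImmersion_of_away {A B : Type u} [CommRing A] [CommRing B] (i : A →+* B)
    (hi : Function.Injective i) {p : A} (hp : IsUnit (i p)) (hs : ∀ b, ∃ n a, b * i p ^ n = i a) :
    IsOpenImmersion (Spec.map (CommRingCat.ofHom i)) ∧
      Set.range (Spec.map (CommRingCat.ofHom i)) = SetLike.coe (PrimeSpectrum.basicOpen p) := by
  let _ : Algebra A B := i.toAlgebra
  have : IsLocalization.Away p B := by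
    refine ⟨?_, ?_, ?_⟩
    · rintro ⟨_, n, rfl⟩
      rw [map_pow]
      exact hp.pow n
    · intro b
      obtain ⟨n, a, h⟩ := hs b
      exact ⟨(a, ⟨p ^ n, n, rfl⟩), (congrArg (b * ·) (map_pow i p n)).trans h⟩
    · intro x y h
      exact ⟨1, by rw [hi h]⟩
  exact ⟨IsOpenImmersion.of_isLocalization p, PrimeSpectrum.localization_away_comap_range B p⟩

/-- Two homomorphisms on standard affine open subsets of `Proj` that factor through a common
localization give the same morphism. -/
lemma specMap_awayι_eq {A B : Type u} {σ : Type*} [CommRing A] [CommRing B] [SetLike σ A]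
    [AddSubgroupClass σ A] (𝒜 : ℕ → σ) [GradedRing 𝒜] {f g : A} {d : ℕ} (hd : 0 < d) (hf : f ∈ 𝒜 d)
    (hg : g ∈ 𝒜 d)
    (a : HomogeneousLocalization.Away 𝒜 f →+* B) (b : HomogeneousLocalization.Away 𝒜 g →+* B)
    (θ : HomogeneousLocalization.Away 𝒜 (f * g) →+* B)
    (ha : ∀ z, θ (HomogeneousLocalization.awayMap 𝒜 hg rfl z) = a z)
    (hb : ∀ z, θ (HomogeneousLocalization.awayMap 𝒜 hf (mul_comm f g) z) = b z) :
    Spec.map (CommRingCat.ofHom a) ≫ Proj.awayι 𝒜 f hf hd =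
      Spec.map (CommRingCat.ofHom b) ≫ Proj.awayι 𝒜 g hg hd := by
  have ha' : a = θ.comp (HomogeneousLocalization.awayMap 𝒜 hg rfl) := RingHom.ext fun z => (ha z).symm
  have hb' : b = θ.comp (HomogeneousLocalization.awayMap 𝒜 hf (mul_comm f g)) :=
    RingHom.ext fun z => (hb z).symm
  rw [ha', hb', CommRingCat.ofHom_comp, CommRingCat.ofHom_comp, Spec.map_comp, Spec.map_comp,
    Category.assoc, Category.assoc, Proj.SpecMap_awayMap_awayι, Proj.SpecMap_awayMap_awayι]

lemma notMem_iff_mem_basicOpen {A B : Type u} {σ : Type*} [CommRing A] [CommRing B] [SetLike σ A]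
    [AddSubgroupClass σ A] (𝒜 : ℕ → σ) [GradedRing 𝒜] {z w : A} {d d' : ℕ} (hz : z ∈ 𝒜 d)
    (hw : w ∈ 𝒜 d') (hd : 0 < d) (hd' : 0 < d') (e : HomogeneousLocalization.Away 𝒜 z ≃+* B)
    (y : PrimeSpectrum B) :
    e (HomogeneousLocalization.Away.isLocalizationElem hz hw) ∉ y.asIdeal ↔
      (Spec.map (CommRingCat.ofHom e.toRingHom) ≫ Proj.awayι 𝒜 z hz hd) y ∈
        Proj.basicOpen 𝒜 w := by
  have h := Proj.awayι_preimage_basicOpen 𝒜 hz hd hw hd'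
  have h1 : Spec.map (CommRingCat.ofHom e.toRingHom) y ∈
      Proj.awayι 𝒜 z hz hd ⁻¹ᵁ Proj.basicOpen 𝒜 w ↔ Spec.map (CommRingCat.ofHom e.toRingHom) y ∈
      PrimeSpectrum.basicOpen (HomogeneousLocalization.Away.isLocalizationElem hz hw) := by
    rw [h]; rfl
  exact h1.symm

lemma prod_monomial {𝓡 K X : Type u} {ι : Type*} [CommRing 𝓡] [Field K] [Algebra 𝓡 K] [AddCommGroup X]
    {s : 𝓡} (hs : algebraMap 𝓡 K s ≠ 0) (V : Finset ι) (x : ι → X) (k : ι → ℤ) :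
    ∏ i ∈ V, monomial 𝓡 s K (x i) (k i) = monomial 𝓡 s K (∑ i ∈ V, x i) (∑ i ∈ V, k i) := by
  classical
  induction V using Finset.induction_on with
  | empty => simp [monomial_zero]
  | insert i V hi ih =>
    rw [Finset.prod_insert hi, Finset.sum_insert hi, Finset.sum_insert hi, ih, monomial_mul hs]

lemma sum_lat_prod {X : Type u} [AddCommGroup X] {ι : Type*} (V : Finset ι) (x : ι → X)
    (k : ι → ℤ) : ∑ i ∈ V, ((lat (x i), (k i : ℝ)) : RealSpan X × ℝ) =
      (lat (∑ i ∈ V, x i), ((∑ i ∈ V, k i : ℤ) : ℝ)) := by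
  classical
  induction V using Finset.induction_on with
  | empty => simp [lat]; rfl
  | insert i V hi ih =>
    rw [Finset.sum_insert hi, Finset.sum_insert hi, Finset.sum_insert hi, ih, lat_add]
    ext <;> simp

lemma specOverMap_comp {𝓡 A B C : Type u} [CommRing 𝓡] [CommRing A] [CommRing B] [CommRing C]
    [Algebra 𝓡 A] [Algebra 𝓡 B] [Algebra 𝓡 C] (f : A →ₐ[𝓡] B) (g : B →ₐ[𝓡] C) :
    specOverMap g ≫ specOverMap f = specOverMap (g.comp f) := by
  refine Over.OverMorphism.ext ?_
  exact (Spec.map_comp (CommRingCat.ofHom f.toRingHom) (CommRingCat.ofHom g.toRingHom)).symm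

lemma specOverMap_comp_assoc {𝓡 A B C : Type u} [CommRing 𝓡] [CommRing A] [CommRing B] [CommRing C]
    [Algebra 𝓡 A] [Algebra 𝓡 B] [Algebra 𝓡 C] (f : A →ₐ[𝓡] B) (g : B →ₐ[𝓡] C)
    {Z : Over (Spec (CommRingCat.of 𝓡))} (h : specOver 𝓡 A ⟶ Z) :
    specOverMap g ≫ specOverMap f ≫ h = specOverMap (g.comp f) ≫ h := by
  rw [← specOverMap_comp, Category.assoc]

lemma specOverMap_isOpenImmersion {𝓡 A B : Type u} [CommRing 𝓡] [CommRing A] [CommRing B]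
    [Algebra 𝓡 A] [Algebra 𝓡 B] (f : A →ₐ[𝓡] B) (hf : Function.Injective f) {p : A}
    (hp : IsUnit (f p)) (hs : ∀ b, ∃ n a, b * f p ^ n = f a) :
    IsOpenImmersion (specOverMap f).left ∧ ∀ y : (specOver 𝓡 A).left,
      y ∈ Set.range (specOverMap f).left ↔
        (p ∉ PrimeSpectrum.asIdeal (R := A) y : Prop) := by
  have h := specMap_isOpenImmersion_of_away f.toRingHom hf hp hs
  refine ⟨h.1, fun y => ?_⟩
  change y ∈ Set.range (Spec.map (CommRingCat.ofHom f.toRingHom)) ↔ _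
  rw [h.2]
  rfl

lemma isOpenImmersion_comp_left {S : Scheme.{u}} {Y Z W : Over S} (f : Y ⟶ Z) (g : Z ⟶ W)
    (hf : IsOpenImmersion f.left) (hg : IsOpenImmersion g.left) :
    IsOpenImmersion (f ≫ g).left := by
  rw [Over.comp_left]; infer_instance

lemma range_comp_left {S : Scheme.{u}} {Y Z W : Over S} (f : Y ⟶ Z) (g : Z ⟶ W) :
    Set.range (f ≫ g).left = g.left '' Set.range f.left := by
  rw [← Set.range_comp, Over.comp_left]; rfl

namespace DegenerationData

variable {𝓡 : Type u} [CommRing 𝓡] [IsDomain 𝓡] [IsDiscreteValuationRing 𝓡]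
  {K : Type u} [Field K] [Algebra 𝓡 K] [IsFractionRing 𝓡 K] {X : Type u} [AddCommGroup X]
  (D : DegenerationData 𝓡 K X) {s : 𝓡} [Module.Free ℤ X] [Module.Finite ℤ X] [Nontrivial X]

/-- The cover of `P̃` by the `U(c)`. -/
def vertexCover (hs : Irreducible s) : (D.P s).left.OpenCover :=
  Scheme.Cover.mkOfCovers X (fun c => (specOver 𝓡 (D.vertexAlgebra s c)).left)
    (fun c => (D.vertexImm hs c).left)
    (fun p => by
      obtain ⟨c, hc⟩ := D.exists_mem_vertexOpen hs p
      rw [← SetLike.mem_coe, ← D.range_vertexImm hs c] at hc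
      obtain ⟨y, hy⟩ := hc
      exact ⟨c, y, hy⟩)
    (fun c => D.isOpenImmersion_vertexImm hs c)

lemma locallyOfFiniteType_P (hs : Irreducible s) : LocallyOfFiniteType (D.P s).hom := by
  have : IsZariskiLocalAtSource @LocallyOfFiniteType.{u} :=
    HasRingHomProperty.instIsZariskiLocalAtSource (Q := RingHom.FiniteType)
  refine IsZariskiLocalAtSource.of_openCover (P := @LocallyOfFiniteType.{u}) (D.vertexCover hs)
    fun c => ?_
  change LocallyOfFiniteType ((D.vertexImm hs c).left ≫ (D.P s).hom)
  rw [Over.w]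
  change LocallyOfFiniteType (Spec.map (CommRingCat.ofHom (algebraMap 𝓡 (D.vertexAlgebra s c))))
  rw [HasRingHomProperty.Spec_iff (P := @LocallyOfFiniteType.{u})]
  have := D.finiteType_vertexAlgebra hs c
  exact (RingHom.finiteType_algebraMap (A := 𝓡) (B := D.vertexAlgebra s c)).2 this

/-! ### The torus embedding -/

lemma vertexAlgebra_le {c : X} {σ : PointedCone ℝ (NR X)} (h : σ ≤ D.cone {c}) :
    D.vertexAlgebra s c ≤ coneAlgebra 𝓡 s K σ := by
  rw [← vertexAlgebra_eq, coneAt_eq]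
  exact coneAlgebra_anti 𝓡 s h

/-- The inclusion of the affine torus embedding of a cone that lies in `Δ(c)`. -/
def chartAt (hs : Irreducible s) (c : X) (σ : PointedCone ℝ (NR X)) (h : σ ≤ D.cone {c}) :
    specOver 𝓡 (coneAlgebra 𝓡 s K σ) ⟶ D.P s :=
  specOverMap (Subalgebra.inclusion (D.vertexAlgebra_le h)) ≫ D.vertexImm hs c

lemma edgeMonomial_mem {c c' : X} {σ : PointedCone ℝ (NR X)} (h : σ ≤ D.cone {c}) :
    monomial 𝓡 s K (c' - c) (D.A c' - D.A c) ∈ coneAlgebra 𝓡 s K σ :=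
  D.vertexAlgebra_le h (D.monomial_mem_vertexAlgebra (D.eta_edge_le c c'))

lemma edgeMonomial_mul (hs : Irreducible s) (c c' : X) :
    monomial 𝓡 s K (c' - c) (D.A c' - D.A c) * monomial 𝓡 s K (c - c') (D.A c - D.A c') = 1 := by
  rw [monomial_mul (algebraMap_uniformizer_ne_zero K hs), ← monomial_zero (K := K) s]
  congr 1 <;> abel

/-- The homomorphism from the common localization of two standard affine open subsets. -/
def awayMulHom (hs : Irreducible s) {c c' : X} {σ : PointedCone ℝ (NR X)} (h : σ ≤ D.cone {c})
    (h' : σ ≤ D.cone {c'}) :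
    HomogeneousLocalization.Away (D.grade s) (D.zeta s c * D.zeta s c') →+*
      coneAlgebra 𝓡 s K σ :=
  have hu : D.vertexRing s c (D.zeta s c * D.zeta s c') *
      monomial 𝓡 s K (c - c') (D.A c - D.A c') = 1 := by
    rw [map_mul, vertexRing_apply, vertexRing_apply, D.vertexHom_zeta_self hs, one_mul,
      D.vertexHom_zeta hs, D.edgeMonomial_mul hs]
  (D.awayHom c (D.zeta s c * D.zeta s c') (IsUnit.of_mul_eq_one _ hu)).codRestrict
    (coneAlgebra 𝓡 s K σ) fun z => by
      obtain ⟨n, f, hf, rfl⟩ := HomogeneousLocalization.Away.mk_surjective _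
        (SetLike.mul_mem_graded (D.zeta_mem s c) (D.zeta_mem s c')) z
      rw [D.awayHom_mk _ hu]
      exact mul_mem (D.vertexAlgebra_le h (D.vertexHom_mem hs c f))
        (pow_mem (D.edgeMonomial_mem h') n)

lemma awayMulHom_mk (hs : Irreducible s) {c c' : X} {σ : PointedCone ℝ (NR X)}
    (h : σ ≤ D.cone {c}) (h' : σ ≤ D.cone {c'}) {d : ℕ}
    (hd : D.zeta s c * D.zeta s c' ∈ D.grade s d) (n : ℕ)
    (f : D.satAlgebra s) (hf : f ∈ D.grade s (n • d)) :
    (D.awayMulHom hs h h' (HomogeneousLocalization.Away.mk (D.grade s) hd n f hf) :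
      AddMonoidAlgebra K X) =
      D.vertexHom s c f * monomial 𝓡 s K (c - c') (D.A c - D.A c') ^ n := by
  have hu : D.vertexRing s c (D.zeta s c * D.zeta s c') *
      monomial 𝓡 s K (c - c') (D.A c - D.A c') = 1 := by
    rw [map_mul, vertexRing_apply, vertexRing_apply, D.vertexHom_zeta_self hs, one_mul,
      D.vertexHom_zeta hs, D.edgeMonomial_mul hs]
  exact D.awayHom_mk _ hu hd n f hf

lemma chartAt_eq (hs : Irreducible s) {c c' : X} {σ : PointedCone ℝ (NR X)} (h : σ ≤ D.cone {c})
    (h' : σ ≤ D.cone {c'}) : D.chartAt hs c σ h = D.chartAt hs c' σ h' := by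
  have key := specMap_awayι_eq (D.grade s) one_pos (D.zeta_mem s c) (D.zeta_mem s c')
    ((Subalgebra.inclusion (D.vertexAlgebra_le h)).toRingHom.comp (D.vertexEquiv hs c).toRingHom)
    ((Subalgebra.inclusion (D.vertexAlgebra_le h')).toRingHom.comp (D.vertexEquiv hs c').toRingHom)
    (D.awayMulHom hs h h') ?_ ?_
  · refine Over.OverMorphism.ext ?_
    rw [CommRingCat.ofHom_comp, CommRingCat.ofHom_comp, Spec.map_comp, Spec.map_comp,
      Category.assoc, Category.assoc] at key
    exact key
  · intro z
    obtain ⟨n, f, hf, rfl⟩ := HomogeneousLocalization.Away.mk_surjective _ (D.zeta_mem s c) z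
    apply Subtype.ext
    rw [HomogeneousLocalization.awayMap_mk]
    refine (D.awayMulHom_mk hs h h' _ _ _ _).trans ?_
    refine Eq.trans ?_ (D.vertexEquiv_mk hs c n f hf).symm
    rw [MulMemClass.coe_mul, SubmonoidClass.coe_pow, map_mul, map_pow, D.vertexHom_zeta hs,
      mul_assoc, ← mul_pow, D.edgeMonomial_mul hs, one_pow, mul_one]
  · intro z
    obtain ⟨n, f, hf, rfl⟩ := HomogeneousLocalization.Away.mk_surjective _ (D.zeta_mem s c') z
    apply Subtype.ext
    rw [HomogeneousLocalization.awayMap_mk]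
    refine (D.awayMulHom_mk hs h h' _ _ _ _).trans ?_
    refine Eq.trans ?_ (D.vertexEquiv_mk hs c' n f hf).symm
    have hf' : f ∈ D.grade s n := by rwa [nsmul_one] at hf
    rw [MulMemClass.coe_mul, SubmonoidClass.coe_pow, map_mul, map_pow,
      D.vertexHom_zeta_self hs, one_pow, mul_one, D.vertexHom_change hs c c' hf',
      D.vertexHom_zeta hs, mul_assoc, ← mul_pow, D.edgeMonomial_mul hs, one_pow, mul_one]

lemma restrict_chartAt (hs : Irreducible s) {c : X} {σ τ : PointedCone ℝ (NR X)}
    (h : σ ≤ D.cone {c}) (hτ : τ ≤ σ) :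
    specOverMap (Subalgebra.inclusion (coneAlgebra_anti 𝓡 s hτ)) ≫ D.chartAt hs c σ h =
      D.chartAt hs c τ (hτ.trans h) := by
  rw [chartAt, specOverMap_comp_assoc]
  rfl

/-- The equation of the complement of `U(c')` in `U(c)`. -/
def edgeElem (s : 𝓡) (c c' : X) : D.vertexAlgebra s c :=
  ⟨monomial 𝓡 s K (c' - c) (D.A c' - D.A c), D.monomial_mem_vertexAlgebra (D.eta_edge_le c c')⟩

lemma edgeElem_eq (hs : Irreducible s) (c c' : X) : D.edgeElem s c c' = D.vertexEquiv hs c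
    (HomogeneousLocalization.Away.isLocalizationElem (D.zeta_mem s c) (D.zeta_mem s c')) := by
  apply Subtype.ext
  refine Eq.trans ?_ (D.vertexEquiv_mk hs c _ _ _).symm
  rw [pow_one, D.vertexHom_zeta hs]
  rfl

lemma edgeElem_notMem_iff (hs : Irreducible s) (c c' : X)
    (y : (specOver 𝓡 (D.vertexAlgebra s c)).left) :
    D.edgeElem s c c' ∉ PrimeSpectrum.asIdeal (R := D.vertexAlgebra s c) y ↔
      (D.vertexImm hs c).left y ∈ D.vertexOpen s c' := by
  rw [D.edgeElem_eq hs]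
  exact notMem_iff_mem_basicOpen (D.grade s) (D.zeta_mem s c) (D.zeta_mem s c') one_pos one_pos
    (D.vertexEquiv hs c) y

lemma prod_edgeElem_pow (hs : Irreducible s) (V : Finset X) (c : X) (n : ℕ) :
    (((∏ c' ∈ V, D.edgeElem s c c') ^ n : D.vertexAlgebra s c) : AddMonoidAlgebra K X) =
      monomial 𝓡 s K (n • ∑ c' ∈ V, (c' - c)) (n * ∑ c' ∈ V, (D.A c' - D.A c)) := by
  rw [SubmonoidClass.coe_pow, SubmonoidClass.coe_finsetProd, ← monomial_pow,
    ← prod_monomial (algebraMap_uniformizer_ne_zero K hs)]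
  rfl

lemma isUnit_inclusion_prod_edgeElem (hs : Irreducible s) {V : Finset X} {c : X}
    (hle : D.vertexAlgebra s c ≤ coneAlgebra 𝓡 s K (D.cone (V : Set X))) :
    IsUnit (Subalgebra.inclusion hle (∏ c' ∈ V, D.edgeElem s c c')) := by
  rw [map_prod]
  refine Finset.prod_induction _ IsUnit (fun _ _ => IsUnit.mul) isUnit_one fun c' hc' => ?_
  have hσ : D.cone (V : Set X) ≤ D.cone {c'} := D.cone_anti (by simpa using hc')
  refine IsUnit.of_mul_eq_one ⟨_, D.edgeMonomial_mem (c := c') (c' := c) hσ⟩ ?_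
  exact Subtype.ext (D.edgeMonomial_mul hs c c')

lemma exists_mul_prod_edgeElem_mem (hs : Irreducible s) {V : Finset X} {c : X} (hc : c ∈ V)
    {b : AddMonoidAlgebra K X} (hb : b ∈ coneAlgebra 𝓡 s K (D.cone (V : Set X))) :
    ∃ n : ℕ, b * (((∏ c' ∈ V, D.edgeElem s c c') ^ n : D.vertexAlgebra s c) :
      AddMonoidAlgebra K X) ∈ D.vertexAlgebra s c := by
  rw [coneAlgebra] at hb
  induction hb using Algebra.adjoin_induction with
  | mem m hm =>
    obtain ⟨x, k, hk, rfl⟩ := hm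
    obtain ⟨N, hN⟩ := D.exists_add_mem_dual hc (m := (lat x, (k : ℝ)))
      (by simpa only [pairing_eq] using hk)
    refine ⟨N, ?_⟩
    rw [D.prod_edgeElem_pow hs, monomial_mul (algebraMap_uniformizer_ne_zero K hs)]
    refine D.monomial_mem_vertexAlgebra (D.eta_le_iff.2 fun n hn => ?_)
    rw [pairing_eq]
    convert hN n hn using 2
    have e : ∑ c' ∈ V, D.edge c (c' - c) =
        ((lat (∑ c' ∈ V, (c' - c)), ((∑ c' ∈ V, (D.A c' - D.A c) : ℤ) : ℝ)) :
          RealSpan X × ℝ) := by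
      simp only [edge, add_sub_cancel]
      exact sum_lat_prod V _ _
    rw [e, lat_add, ← natCast_zsmul, lat_zsmul]
    ext <;> simp
  | algebraMap r => exact ⟨0, by
    rw [pow_zero, OneMemClass.coe_one, mul_one]; exact Subalgebra.algebraMap_mem _ r⟩
  | add f g _ _ hf hg =>
    obtain ⟨n, hn⟩ := hf
    obtain ⟨n', hn'⟩ := hg
    refine ⟨n + n', ?_⟩
    have := add_mem (mul_mem hn ((∏ c' ∈ V, D.edgeElem s c c' : D.vertexAlgebra s c) ^ n').2)
      (mul_mem hn' ((∏ c' ∈ V, D.edgeElem s c c' : D.vertexAlgebra s c) ^ n).2)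
    convert this using 1
    rw [pow_add, MulMemClass.coe_mul]; ring
  | mul f g _ _ hf hg =>
    obtain ⟨n, hn⟩ := hf
    obtain ⟨n', hn'⟩ := hg
    refine ⟨n + n', ?_⟩
    convert mul_mem hn hn' using 1
    rw [pow_add, MulMemClass.coe_mul]; ring

/-- The range of the inclusion of the affine torus embedding of a cone of the fan. -/
lemma range_chartAt_finset (hs : Irreducible s) {V : Finset X} {c : X} (hc : c ∈ V) :
    IsOpenImmersion (D.chartAt hs c (D.cone V) (D.cone_anti (by simpa using hc))).left ∧
      Set.range (D.chartAt hs c (D.cone V) (D.cone_anti (by simpa using hc))).left =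
        ⋂ c' ∈ V, (D.vertexOpen s c' : Set (D.P s).left) := by
  have hle := D.vertexAlgebra_le (s := s) (σ := D.cone (V : Set X)) (c := c)
    (D.cone_anti (by simpa using hc))
  have key := specOverMap_isOpenImmersion (Subalgebra.inclusion hle)
    (Subalgebra.inclusion_injective _) (D.isUnit_inclusion_prod_edgeElem hs hle) (by
      rintro ⟨b, hb⟩
      obtain ⟨n, hn⟩ := D.exists_mul_prod_edgeElem_mem hs hc hb
      refine ⟨n, ⟨_, hn⟩, Subtype.ext ?_⟩
      rw [← map_pow]; rfl)
  refine ⟨isOpenImmersion_comp_left _ _ key.1 (D.isOpenImmersion_vertexImm hs c), ?_⟩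
  have h4 : ∀ y, y ∈ Set.range (specOverMap (Subalgebra.inclusion hle)).left ↔
      ∀ c' ∈ V, (D.vertexImm hs c).left y ∈ D.vertexOpen s c' := by
    intro y
    rw [key.2 y, (PrimeSpectrum.isPrime (R := D.vertexAlgebra s c) y).prod_mem_iff]
    push Not
    exact forall₂_congr fun c' _ => D.edgeElem_notMem_iff hs c c' y
  rw [chartAt, range_comp_left]
  ext q
  simp only [Set.mem_iInter]
  constructor
  · rintro ⟨y, hy, rfl⟩
    exact (h4 y).1 hy
  · intro hq
    have := hq c hc
    rw [← D.range_vertexImm hs c] at this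
    obtain ⟨y, rfl⟩ := this
    exact ⟨y, (h4 y).2 hq, rfl⟩

end DegenerationData

end

end MaxDegeneration

namespace MaxDegeneration

noncomputable section

namespace DegenerationData

variable {𝓡 : Type u} [CommRing 𝓡] [IsDomain 𝓡] [IsDiscreteValuationRing 𝓡]
  {K : Type u} [Field K] [Algebra 𝓡 K] [IsFractionRing 𝓡 K] {X : Type u} [AddCommGroup X]
  (D : DegenerationData 𝓡 K X) {s : 𝓡} [Module.Free ℤ X] [Module.Finite ℤ X] [Nontrivial X]

lemma exists_le_cone_singleton (σ : D.fan) : ∃ c, σ.1 ≤ D.cone {c} := by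
  obtain ⟨V, ⟨c, hc⟩, h⟩ := D.exists_finset_of_mem_fan σ.2
  exact ⟨c, h ▸ D.cone_anti (by simpa using hc)⟩

/-- The chart of a cone of the fan. -/
def fanChart (hs : Irreducible s) (σ : D.fan) : specOver 𝓡 (coneAlgebra 𝓡 s K σ.1) ⟶ D.P s :=
  D.chartAt hs (D.exists_le_cone_singleton σ).choose σ.1 (D.exists_le_cone_singleton σ).choose_spec

lemma fanChart_eq (hs : Irreducible s) (σ : D.fan) {c : X} (h : σ.1 ≤ D.cone {c}) :
    D.fanChart hs σ = D.chartAt hs c σ.1 h :=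
  D.chartAt_eq hs _ _

lemma range_fanChart (hs : Irreducible s) (σ : D.fan) {V : Finset X} (hV : V.Nonempty)
    (h : σ.1 = D.cone V) : IsOpenImmersion (D.fanChart hs σ).left ∧
      Set.range (D.fanChart hs σ).left = ⋂ c' ∈ V, (D.vertexOpen s c' : Set (D.P s).left) := by
  obtain ⟨c, hc⟩ := hV
  obtain ⟨σ, hσ⟩ := σ
  obtain rfl : σ = D.cone V := h
  rw [D.fanChart_eq hs _ (c := c) (D.cone_anti (by simpa using hc))]
  exact D.range_chartAt_finset hs hc

lemma vertexImm_eq_fanChart (hs : Irreducible s) (c : X) :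
    specOverMap (Subalgebra.inclusion (D.vertexAlgebra_eq (s := s) c).le) ≫
      D.fanChart hs ⟨D.coneAt c, D.coneAt_mem_fan c⟩ = D.vertexImm hs c := by
  have h : D.coneAt c ≤ D.cone {c} := (D.coneAt_eq c).le
  rw [D.fanChart_eq hs _ (c := c) h, chartAt, specOverMap_comp_assoc]
  have : (Subalgebra.inclusion (D.vertexAlgebra_eq (s := s) c).le).comp
      (Subalgebra.inclusion (D.vertexAlgebra_le h)) = AlgHom.id 𝓡 (D.vertexAlgebra s c) := rfl
  rw [this]
  have h1 : specOverMap (AlgHom.id 𝓡 (D.vertexAlgebra s c)) = 𝟙 _ :=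
    Over.OverMorphism.ext (Spec.map_id _)
  rw [h1, Category.id_comp]

/-- `P̃` is the torus embedding given by the fan `Δ`. -/
def torusEmbedding (hs : Irreducible s) : TorusEmbedding s K D.fan (D.P s) where
  chart := D.fanChart hs
  isOpenImmersion σ := by
    obtain ⟨V, hV, h⟩ := D.exists_finset_of_mem_fan σ.2
    exact (D.range_fanChart hs σ hV h).1
  restrict σ τ h := by
    obtain ⟨c, hc⟩ := D.exists_le_cone_singleton σ
    rw [D.fanChart_eq hs σ hc, D.fanChart_eq hs τ (h.trans hc), D.restrict_chartAt hs hc h]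
  cover p := by
    obtain ⟨c, hc⟩ := D.exists_mem_vertexOpen hs p
    refine ⟨⟨D.coneAt c, D.coneAt_mem_fan c⟩, ?_⟩
    rw [(D.range_fanChart hs ⟨D.coneAt c, D.coneAt_mem_fan c⟩ (Finset.singleton_nonempty c)
      (by simp [coneAt_eq])).2]
    simpa using hc
  inter σ τ ρ h := by
    classical
    obtain ⟨V, hV, hσ⟩ := D.exists_finset_of_mem_fan σ.2
    obtain ⟨W, hW, hτ⟩ := D.exists_finset_of_mem_fan τ.2
    have hρ : ρ.1 = D.cone ((V ∪ W : Finset X) : Set X) := by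
      rw [h, hσ, hτ, Finset.coe_union, cone_union]
    rw [(D.range_fanChart hs σ hV hσ).2, (D.range_fanChart hs τ hW hτ).2,
      (D.range_fanChart hs ρ (hV.mono Finset.subset_union_left) hρ).2]
    ext p
    simp only [Set.mem_inter_iff, Set.mem_iInter, Finset.mem_union, or_imp, forall_and]

end DegenerationData

/-! ### The half-line fan and the structure morphism -/

section HalfLine

variable {𝓡 : Type u} [CommRing 𝓡] [IsDomain 𝓡] {K : Type u} [Field K] [Algebra 𝓡 K]
  [IsFractionRing 𝓡 K] {s : 𝓡}

/-- The map to the terminal object. -/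
def toBase (Y : Over (Spec (CommRingCat.of 𝓡))) : Y ⟶ Over.mk (𝟙 (Spec (CommRingCat.of 𝓡))) :=
  Over.homMk Y.hom

lemma toBase_unique {Y : Over (Spec (CommRingCat.of 𝓡))}
    (f g : Y ⟶ Over.mk (𝟙 (Spec (CommRingCat.of 𝓡)))) : f = g := by
  refine Over.OverMorphism.ext ?_
  exact (Category.comp_id _).symm.trans ((Over.w f).trans ((Over.w g).symm.trans
    (Category.comp_id _)))

lemma pairing_halfLine (x : PUnit.{u + 1}) (k : ℤ) :
    (∀ v ∈ PointedCone.hull ℝ {((1, 0) : NR PUnit.{u + 1})}, 0 ≤ pairing v x k) ↔ 0 ≤ k := by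
  constructor
  · intro h
    have := h _ (Submodule.subset_span rfl)
    simpa [pairing] using this
  · intro h v hv
    obtain ⟨a, rfl⟩ := Submodule.mem_span_singleton.1 hv
    change 0 ≤ ((a : ℝ) * 1) * k + ((a : ℝ) • (0 : Module.Dual ℝ (RealSpan PUnit))) (lat x)
    have : (0 : ℝ) ≤ k := by exact_mod_cast h
    have ha : (0 : ℝ) ≤ (a : ℝ) := a.2
    simpa using mul_nonneg ha this

lemma range_toBase (p : 𝓡) (σ : PointedCone ℝ (NR PUnit.{u + 1}))
    (hp : IsUnit (algebraMap 𝓡 (coneAlgebra 𝓡 s K σ) p))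
    (hs : ∀ b ∈ coneAlgebra 𝓡 s K σ, ∃ (n : ℕ) (a : 𝓡),
      b * algebraMap 𝓡 _ p ^ n = algebraMap 𝓡 _ a) :
    IsOpenImmersion (toBase (specOver 𝓡 (coneAlgebra 𝓡 s K σ))).left ∧
      ∀ y : PrimeSpectrum 𝓡, y ∈ Set.range (toBase (specOver 𝓡 (coneAlgebra 𝓡 s K σ))).left ↔
        p ∉ y.asIdeal := by
  have h := specMap_isOpenImmersion_of_away (algebraMap 𝓡 (coneAlgebra 𝓡 s K σ)) ?_ hp ?_
  · refine ⟨h.1, fun y => ?_⟩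
    change y ∈ Set.range (Spec.map (CommRingCat.ofHom (algebraMap 𝓡 (coneAlgebra 𝓡 s K σ)))) ↔ _
    rw [h.2]
    rfl
  · intro a b hab
    have h1 : algebraMap 𝓡 (AddMonoidAlgebra K PUnit.{u + 1}) a = algebraMap 𝓡 _ b :=
      congrArg Subtype.val hab
    rw [AddMonoidAlgebra.coe_algebraMap] at h1
    have h2 := congrArg (fun z => AddMonoidAlgebra.coeff z 0) h1
    simp only [Function.comp_apply, AddMonoidAlgebra.coeff_single, Finsupp.single_eq_same] at h2
    exact IsFractionRing.injective 𝓡 K h2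
  · rintro ⟨b, hb⟩
    obtain ⟨n, a, e⟩ := hs b hb
    refine ⟨n, a, Subtype.ext ?_⟩
    rw [MulMemClass.coe_mul, SubmonoidClass.coe_pow]
    exact e

lemma single_punit_ext {f g : AddMonoidAlgebra K PUnit.{u + 1}} (h : f.coeff 0 = g.coeff 0) :
    f = g := by
  ext
  exact h

lemma coeff_mul_algebraMap (f : AddMonoidAlgebra K PUnit.{u + 1}) (a : 𝓡) :
    (f * algebraMap 𝓡 _ a).coeff 0 = f.coeff 0 * algebraMap 𝓡 K a := by
  rw [AddMonoidAlgebra.coe_algebraMap, Function.comp_apply]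
  have h : f = AddMonoidAlgebra.single 0 (f.coeff 0) := single_punit_ext (by
    simp [AddMonoidAlgebra.coeff_single])
  conv_lhs => rw [h]
  rw [AddMonoidAlgebra.single_mul_single]
  simp [AddMonoidAlgebra.coeff_single]

lemma range_toBase_halfLine (hs : algebraMap 𝓡 K s ≠ 0) :
    IsOpenImmersion (toBase (specOver 𝓡 (coneAlgebra 𝓡 s K
      (PointedCone.hull ℝ {((1, 0) : NR PUnit.{u + 1})})))).left ∧
      ∀ y : PrimeSpectrum 𝓡, y ∈ Set.range (toBase (specOver 𝓡 (coneAlgebra 𝓡 s K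
      (PointedCone.hull ℝ {((1, 0) : NR PUnit.{u + 1})})))).left := by
  have h := range_toBase (s := s) (K := K) 1 (PointedCone.hull ℝ {((1, 0) : NR PUnit.{u + 1})})
    (by rw [map_one]; exact isUnit_one) (by
    intro b hb
    refine ⟨0, ?_⟩
    rcases (mem_coneAlgebra hs).1 hb 0 with h | ⟨k, hk, r, hr⟩
    · exact ⟨0, single_punit_ext (by simp [h])⟩
    · have hk' : 0 ≤ k := (pairing_halfLine 0 k).1 hk
      lift k to ℕ using hk'
      refine ⟨r * s ^ k, single_punit_ext ?_⟩
      rw [pow_zero, mul_one, hr, AddMonoidAlgebra.coe_algebraMap]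
      simp [AddMonoidAlgebra.coeff_single])
  exact ⟨h.1, fun y => (h.2 y).2 ((Ideal.ne_top_iff_one _).1 y.2.ne_top)⟩

lemma range_toBase_bot (hs : algebraMap 𝓡 K s ≠ 0) :
    IsOpenImmersion (toBase (specOver 𝓡 (coneAlgebra 𝓡 s K
      (⊥ : PointedCone ℝ (NR PUnit.{u + 1}))))).left ∧
      ∀ y : PrimeSpectrum 𝓡, y ∈ Set.range (toBase (specOver 𝓡 (coneAlgebra 𝓡 s K
      (⊥ : PointedCone ℝ (NR PUnit.{u + 1}))))).left ↔ s ∉ y.asIdeal := by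
  refine range_toBase s _ ?_ ?_
  · have hmem : monomial 𝓡 s K (0 : PUnit.{u + 1}) (-1) ∈ coneAlgebra 𝓡 s K
        (⊥ : PointedCone ℝ (NR PUnit.{u + 1})) := monomial_mem_coneAlgebra (by
      intro v hv
      rw [Submodule.mem_bot] at hv
      simp [hv, pairing])
    refine IsUnit.of_mul_eq_one ⟨_, hmem⟩ (Subtype.ext ?_)
    change algebraMap 𝓡 (AddMonoidAlgebra K PUnit.{u + 1}) s * monomial 𝓡 s K 0 (-1) = 1
    rw [mul_comm]
    refine single_punit_ext ?_
    rw [coeff_mul_algebraMap]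
    simp [monomial, AddMonoidAlgebra.coeff_single, AddMonoidAlgebra.one_def, hs]
  · intro b hb
    rcases (mem_coneAlgebra hs).1 hb 0 with h | ⟨k, hk, r, hr⟩
    · exact ⟨0, 0, single_punit_ext (by simp [h])⟩
    · refine ⟨(-k).toNat, r * s ^ k.toNat, single_punit_ext ?_⟩
      rw [← map_pow, coeff_mul_algebraMap, hr, AddMonoidAlgebra.coe_algebraMap]
      simp only [Function.comp_apply, AddMonoidAlgebra.coeff_single, Finsupp.single_eq_same,
        map_mul, map_pow, mul_assoc]
      rw [← zpow_natCast, ← zpow_natCast, ← zpow_add₀ hs]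
      congr 2; omega

lemma halfLine_cases (σ : (halfLineFan : Set (PointedCone ℝ (NR PUnit.{u + 1})))) :
    σ.1 = ⊥ ∨ σ.1 = PointedCone.hull ℝ {(1, 0)} := by
  simpa [halfLineFan] using σ.2

/-- The base `S` is the torus embedding given by the half-line. -/
def halfLineEmbedding (hs : algebraMap 𝓡 K s ≠ 0) :
    TorusEmbedding s K halfLineFan (Over.mk (𝟙 (Spec (CommRingCat.of 𝓡)))) where
  chart σ := toBase _
  isOpenImmersion := by
    rintro ⟨σ, h⟩
    rcases halfLine_cases ⟨σ, h⟩ with h' | h' <;> obtain rfl : σ = _ := h'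
    exacts [(range_toBase_bot hs).1, (range_toBase_halfLine hs).1]
  restrict _ _ _ := toBase_unique _ _
  cover p := ⟨⟨PointedCone.hull ℝ {(1, 0)}, Or.inr rfl⟩, (range_toBase_halfLine hs).2 p⟩
  inter := by
    rintro ⟨σ, hσ⟩ ⟨τ, hτ⟩ ⟨ρ, hρ⟩ h
    simp only at h ⊢
    ext p
    rcases halfLine_cases ⟨σ, hσ⟩ with h1 | h1 <;> obtain rfl : σ = _ := h1
    · obtain rfl : ρ = ⊥ := by rw [h, bot_inf_eq]
      rw [Set.mem_inter_iff, and_iff_left_of_imp]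
      intro h2
      rcases halfLine_cases ⟨τ, hτ⟩ with h1 | h1 <;> obtain rfl : τ = _ := h1
      exacts [h2, (range_toBase_halfLine hs).2 p]
    · obtain rfl : ρ = τ := by
        rw [h, inf_eq_right]
        rcases halfLine_cases ⟨τ, hτ⟩ with h1 | h1 <;> obtain rfl : τ = _ := h1
        exacts [bot_le, le_rfl]
      rw [Set.mem_inter_iff, and_iff_right]
      exact (range_toBase_halfLine hs).2 p

lemma pairing_mapNR {X X' : Type u} [AddCommGroup X] [AddCommGroup X'] (φ : X' →ₗ[ℤ] X) (v : NR X)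
    (x : X') (k : ℤ) : pairing (mapNR φ v) x k = pairing v (φ x) k := by
  simp [pairing, mapNR, lat]

/-- The homomorphism of affine coordinate rings given by a map of cones. -/
def coneAlgebraMap {X X' : Type u} [AddCommGroup X] [AddCommGroup X'] (s : 𝓡) (φ : X' →ₗ[ℤ] X)
    {σ : PointedCone ℝ (NR X)} {σ' : PointedCone ℝ (NR X')} (h : ∀ v ∈ σ, mapNR φ v ∈ σ') :
    coneAlgebra 𝓡 s K σ' →ₐ[𝓡] coneAlgebra 𝓡 s K σ :=
  ((AddMonoidAlgebra.mapDomainAlgHom 𝓡 K φ).comp (coneAlgebra 𝓡 s K σ').val).codRestrict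
    (coneAlgebra 𝓡 s K σ) fun f => by
      have : coneAlgebra 𝓡 s K σ' ≤ (coneAlgebra 𝓡 s K σ).comap
          (AddMonoidAlgebra.mapDomainAlgHom 𝓡 K φ) := by
        refine Algebra.adjoin_le ?_
        rintro _ ⟨x, k, hk, rfl⟩
        change AddMonoidAlgebra.mapDomain φ (AddMonoidAlgebra.single _ _) ∈ coneAlgebra 𝓡 s K σ
        rw [AddMonoidAlgebra.mapDomain_single]
        refine monomial_mem_coneAlgebra fun v hv => ?_
        rw [← pairing_mapNR]
        exact hk _ (h v hv)
      exact this f.2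

end HalfLine

namespace DegenerationData

variable {𝓡 : Type u} [CommRing 𝓡] [IsDomain 𝓡] [IsDiscreteValuationRing 𝓡]
  {K : Type u} [Field K] [Algebra 𝓡 K] [IsFractionRing 𝓡 K] {X : Type u} [AddCommGroup X]
  (D : DegenerationData 𝓡 K X) {s : 𝓡} [Module.Free ℤ X] [Module.Finite ℤ X] [Nontrivial X]

lemma isToricMorphism_structure (hs : Irreducible s) :
    IsToricMorphism (D.torusEmbedding hs)
      (halfLineEmbedding (algebraMap_uniformizer_ne_zero K hs)) (0 : PUnit.{u + 1} →ₗ[ℤ] X)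
      (Over.homMk (D.P s).hom) := by
  refine ⟨fun σ hσ => ⟨PointedCone.hull ℝ {(1, 0)}, Or.inr rfl, fun v hv => ?_⟩,
    fun σ σ' h => ⟨coneAlgebraMap s 0 h, fun f => rfl, toBase_unique _ _⟩⟩
  obtain ⟨c, hc⟩ := D.exists_le_cone_singleton ⟨σ, hσ⟩
  have h0 := (D.mem_cone.1 (hc hv)).1
  refine Submodule.mem_span_singleton.2 ⟨⟨v.1, h0⟩, ?_⟩
  change (v.1 • (1 : ℝ), v.1 • (0 : Module.Dual ℝ (RealSpan PUnit))) = _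
  ext x
  · simp [mapNR]
  · simp [mapNR]

end DegenerationData

end

end MaxDegeneration

namespace MaxDegeneration

noncomputable section

section Frames

open TopologicalSpace Opposite

variable {Z : Scheme.{u}}

/-! ### Sections of sheaves of modules and frames -/

/-- Restriction of sections of a sheaf of modules. -/
def res (M : Z.Modules) {U V : Z.Opens} (h : V ≤ U) : Γ(M, U) →+ Γ(M, V) :=
  (M.presheaf.map (homOfLE h).op).hom

/-- Restriction of functions. -/
def resF {U V : Z.Opens} (h : V ≤ U) : Γ(Z, U) →+* Γ(Z, V) :=
  (Z.presheaf.map (homOfLE h).op).hom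

variable {M N : Z.Modules} {U V W : Z.Opens}

lemma res_smul (h : V ≤ U) (f : Γ(Z, U)) (t : Γ(M, U)) :
    res M h (f • t) = resF h f • res M h t := M.map_smul (homOfLE h) f t

lemma res_res (h : V ≤ U) (h' : W ≤ V) (t : Γ(M, U)) :
    res M h' (res M h t) = res M (h'.trans h) t := by
  change (M.presheaf.map (homOfLE h).op ≫ M.presheaf.map (homOfLE h').op) t = _
  rw [← Functor.map_comp]; rfl

lemma res_self (t : Γ(M, U)) : res M le_rfl t = t := by
  change (M.presheaf.map (𝟙 (op U))) t = t
  rw [CategoryTheory.Functor.map_id]; rfl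

lemma app_res (φ : M ⟶ N) (h : V ≤ U) (t : Γ(M, U)) :
    φ.app V (res M h t) = res N h (φ.app U t) :=
  (ConcreteCategory.congr_hom (φ.mapPresheaf.naturality (homOfLE h).op) t :)

lemma eq_of_res_eq {s t : Γ(M, U)} (h : ∀ z ∈ U, ∃ (W : Z.Opens) (hW : W ≤ U), z ∈ W ∧
    res M hW s = res M hW t) : s = t := by
  choose! W hW hz h using h
  refine TopCat.Sheaf.eq_of_locally_eq' ⟨M.presheaf, M.isSheaf⟩ (fun z : U => W z.1) U
    (fun z => homOfLE (hW z.1 z.2)) (fun z hz' => Opens.mem_iSup.2 ⟨⟨z, hz'⟩, hz z hz'⟩) s t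
    fun z => h z.1 z.2

lemma eq_of_resF_eq {s t : Γ(Z, U)} (h : ∀ z ∈ U, ∃ (W : Z.Opens) (hW : W ≤ U), z ∈ W ∧
    resF hW s = resF hW t) : s = t := by
  choose! W hW hz h using h
  refine TopCat.Sheaf.eq_of_locally_eq' Z.sheaf (fun z : U => W z.1) U
    (fun z => homOfLE (hW z.1 z.2)) (fun z hz' => Opens.mem_iSup.2 ⟨⟨z, hz'⟩, hz z hz'⟩) s t
    fun z => h z.1 z.2

lemma exists_glue {ι : Type u} (W : ι → Z.Opens) (hW : ∀ i, W i ≤ U) (hU : U ≤ iSup W)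
    (t : ∀ i, Γ(M, W i)) (h : ∀ i j, res M (inf_le_left : W i ⊓ W j ≤ W i) (t i) =
      res M (inf_le_right : W i ⊓ W j ≤ W j) (t j)) :
    ∃ s : Γ(M, U), ∀ i, res M (hW i) s = t i :=
  (TopCat.Sheaf.existsUnique_gluing' ⟨M.presheaf, M.isSheaf⟩ W U (fun i => homOfLE (hW i)) hU t
    h).exists

lemma exists_glueF {ι : Type u} (W : ι → Z.Opens) (hW : ∀ i, W i ≤ U) (hU : U ≤ iSup W)
    (t : ∀ i, Γ(Z, W i)) (h : ∀ i j, resF (inf_le_left : W i ⊓ W j ≤ W i) (t i) =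
      resF (inf_le_right : W i ⊓ W j ≤ W j) (t j)) :
    ∃ s : Γ(Z, U), ∀ i, resF (hW i) s = t i :=
  (TopCat.Sheaf.existsUnique_gluing' Z.sheaf W U (fun i => homOfLE (hW i)) hU t h).exists

lemma IsFrame.res {t : Γ(M, U)} (ht : IsFrame M U t) (h : V ≤ U) :
    IsFrame M V (MaxDegeneration.res M h t) := by
  intro W hW
  have := ht W (hW.trans h)
  convert this using 3
  exact res_res h hW t

lemma IsFrame.ext {t : Γ(M, U)} (ht : IsFrame M U t) {f g : Γ(Z, U)} (h : f • t = g • t) :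
    f = g := by
  refine (ht U le_rfl).1 ?_
  change f • MaxDegeneration.res M le_rfl t = g • MaxDegeneration.res M le_rfl t
  rwa [res_self]

lemma IsFrame.exists {t : Γ(M, U)} (ht : IsFrame M U t) (x : Γ(M, U)) :
    ∃ f : Γ(Z, U), f • t = x := by
  obtain ⟨f, hf⟩ := (ht U le_rfl).2 x
  change f • MaxDegeneration.res M le_rfl t = x at hf
  exact ⟨f, by rwa [res_self] at hf⟩

lemma isFrame_of_bijective {t : Γ(M, U)} (h : ∀ (V : Z.Opens) (h : V ≤ U),
    (∀ f : Γ(Z, V), f • res M h t = 0 → f = 0) ∧ ∀ x, ∃ f : Γ(Z, V), f • res M h t = x) :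
    IsFrame M U t := by
  refine fun V hV => ⟨fun f g hfg => ?_, fun x => (h V hV).2 x⟩
  have : (f - g) • res M hV t = 0 := by rw [sub_smul]; exact sub_eq_zero.2 hfg
  exact sub_eq_zero.1 ((h V hV).1 _ this)

lemma isFrame_of_locally {t : Γ(M, U)}
    (h0 : ∀ (V : Z.Opens) (h : V ≤ U) (f : Γ(Z, V)), f • res M h t = 0 → f = 0)
    (h1 : ∀ (V : Z.Opens) (h : V ≤ U) (x : Γ(M, V)), ∀ z ∈ V, ∃ (W : Z.Opens) (hW : W ≤ V), z ∈ W ∧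
      ∃ f : Γ(Z, W), f • res M (hW.trans h) t = res M hW x) : IsFrame M U t := by
  refine isFrame_of_bijective fun V hV => ⟨h0 V hV, fun x => ?_⟩
  choose W hW hz f hf using fun z : V => h1 V hV x z.1 z.2
  obtain ⟨g, hg⟩ := exists_glueF (U := V) W hW (fun z hzV => Opens.mem_iSup.2 ⟨⟨z, hzV⟩, hz _⟩) f
    (fun z z' => by
      have e1 := congrArg (res M (inf_le_left : W z ⊓ W z' ≤ _)) (hf z)
      have e2 := congrArg (res M (inf_le_right : W z ⊓ W z' ≤ _)) (hf z')
      rw [res_smul, res_res, res_res] at e1 e2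
      refine sub_eq_zero.1 (h0 _ (inf_le_left.trans ((hW z).trans hV)) _ ?_)
      rw [sub_smul, e1, e2, sub_self])
  refine ⟨g, eq_of_res_eq fun z hzV => ⟨W ⟨z, hzV⟩, hW _, hz _, ?_⟩⟩
  rw [res_smul, res_res, hg, hf]

lemma isFrame_of_cover {t : Γ(M, U)} (h : ∀ z ∈ U, ∃ (W : Z.Opens) (hW : W ≤ U), z ∈ W ∧
    IsFrame M W (res M hW t)) : IsFrame M U t := by
  choose! W hW hz h using h
  refine isFrame_of_locally (fun V hV f hf => ?_) fun V hV x z hzV => ?_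
  · refine eq_of_resF_eq fun z hzV => ⟨W z ⊓ V, inf_le_right, ⟨hz z (hV hzV), hzV⟩, ?_⟩
    rw [map_zero]
    refine ((h z (hV hzV)).res (inf_le_left : W z ⊓ V ≤ W z)).ext ?_
    have := congrArg (res M (inf_le_right : W z ⊓ V ≤ V)) hf
    rw [res_smul, res_res, map_zero] at this
    rw [res_res, zero_smul]
    exact this
  · have := (h z (hV hzV)).res (inf_le_left : W z ⊓ V ≤ W z)
    rw [res_res] at this
    exact ⟨W z ⊓ V, inf_le_right, ⟨hz z (hV hzV), hzV⟩, this.exists (res M inf_le_right x)⟩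

lemma IsFrame.unit_smul {t : Γ(M, U)} (ht : IsFrame M U t) {f : Γ(Z, U)} (hf : IsUnit f) :
    IsFrame M U (f • t) := by
  refine isFrame_of_bijective fun V hV => ?_
  obtain ⟨g, hg⟩ := (hf.map (resF hV)).exists_right_inv
  have h1 := ht.res hV
  refine ⟨fun a ha => ?_, fun x => ?_⟩
  · rw [res_smul, smul_smul] at ha
    have h2 : a * resF hV f = 0 := h1.ext (by rw [ha, zero_smul])
    rw [← mul_one a, ← hg, ← mul_assoc, h2, zero_mul]
  · obtain ⟨a, ha⟩ := h1.exists x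
    exact ⟨a * g, by rw [res_smul, smul_smul, mul_assoc, mul_comm g, hg, mul_one, ha]⟩

lemma IsFrame.isUnit_of_smul {t : Γ(M, U)} (ht : IsFrame M U t) {f : Γ(Z, U)}
    (hf : IsFrame M U (f • t)) : IsUnit f := by
  obtain ⟨g, hg⟩ := hf.exists t
  rw [smul_smul] at hg
  exact IsUnit.of_mul_eq_one g (by rw [mul_comm]; exact ht.ext (by rw [hg, one_smul]))

/-- Morphisms out of a sheaf that is generated by frames on a cover can be constructed on the
frames. -/
lemma exists_hom_of_frames {ι : Type u} (U : ι → Z.Opens) (hU : ∀ z, ∃ i, z ∈ U i)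
    (e : ∀ i, Γ(M, U i)) (he : ∀ i, IsFrame M (U i) (e i)) (n : ∀ i, Γ(N, U i))
    (h : ∀ i j (f : Γ(Z, U i ⊓ U j)), f • res M inf_le_left (e i) = res M inf_le_right (e j) →
      f • res N inf_le_left (n i) = res N inf_le_right (n j)) :
    ∃ φ : M ⟶ N, ∀ i, φ.app (U i) (e i) = n i := by
  have hglue : ∀ (V : Z.Opens) (x : Γ(M, V)), ∃ y : Γ(N, V), ∀ i (W : Z.Opens) (hV : W ≤ V)
      (hi : W ≤ U i) (f : Γ(Z, W)), f • res M hi (e i) = res M hV x →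
        f • res N hi (n i) = res N hV y := by
    intro V x
    choose f hf using fun i => ((he i).res (inf_le_left : U i ⊓ V ≤ U i)).exists
      (res M inf_le_right x)
    have key : ∀ i j (W : Z.Opens) (hi : W ≤ U i) (hj : W ≤ U j) (a b : Γ(Z, W)),
        a • res M hi (e i) = b • res M hj (e j) → a • res N hi (n i) = b • res N hj (n j) := by
      intro i j W hi hj a b hab
      obtain ⟨v, hv⟩ := ((he i).res (inf_le_left : U i ⊓ U j ≤ U i)).exists
        (res M inf_le_right (e j))
      have hW : W ≤ U i ⊓ U j := le_inf hi hj
      have h1 := congrArg (res M hW) hv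
      have h2 := congrArg (res N hW) (h i j v hv)
      rw [res_smul, res_res, res_res] at h1 h2
      rw [← h1, smul_smul] at hab
      rw [← h2, smul_smul, ((he i).res hi).ext hab]
    obtain ⟨y, hy⟩ := exists_glue (M := N) (U := V) (fun i => U i ⊓ V) (fun i => inf_le_right)
      (fun z hz => by
        obtain ⟨i, hi⟩ := hU z
        exact Opens.mem_iSup.2 ⟨i, hi, hz⟩) (fun i => f i • res N inf_le_left (n i)) (fun i j => by
        rw [res_smul, res_smul, res_res, res_res]
        refine key i j _ _ _ _ _ ?_
        have h1 := congrArg (res M (inf_le_left : (U i ⊓ V) ⊓ (U j ⊓ V) ≤ _)) (hf i)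
        have h2 := congrArg (res M (inf_le_right : (U i ⊓ V) ⊓ (U j ⊓ V) ≤ _)) (hf j)
        rw [res_smul, res_res, res_res] at h1 h2
        rw [h1, h2])
    refine ⟨y, fun i W hV hi g hg => ?_⟩
    have hW : W ≤ U i ⊓ V := le_inf hi hV
    have h1 := congrArg (res N hW) (hy i)
    rw [res_smul, res_res, res_res] at h1
    rw [h1]
    refine key i i W hi hi g _ ?_
    have h2 := congrArg (res M hW) (hf i)
    rw [res_smul, res_res, res_res] at h2
    rw [hg, h2]
  choose F hF using hglue
  have huniq : ∀ (V : Z.Opens) (x : Γ(M, V)) (y : Γ(N, V)), (∀ i (W : Z.Opens) (hV : W ≤ V)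
      (hi : W ≤ U i) (f : Γ(Z, W)), f • res M hi (e i) = res M hV x →
        f • res N hi (n i) = res N hV y) → y = F V x := by
    intro V x y hy
    refine eq_of_res_eq fun z hz => ?_
    obtain ⟨i, hi⟩ := hU z
    obtain ⟨f, hf⟩ := ((he i).res (inf_le_left : U i ⊓ V ≤ U i)).exists (res M inf_le_right x)
    exact ⟨U i ⊓ V, inf_le_right, ⟨hi, hz⟩, by
      rw [← hy i _ inf_le_right inf_le_left f hf, ← hF V x i _ inf_le_right inf_le_left f hf]⟩
  have hlin : ∀ (V : Z.Opens) (r : Γ(Z, V)) (x x' : Γ(M, V)),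
      F V (r • x + x') = r • F V x + F V x' := by
    intro V r x x'
    refine (huniq V _ _ fun i W hV hi f hf => ?_).symm
    obtain ⟨g, hg⟩ := ((he i).res hi).exists (res M hV x)
    obtain ⟨g', hg'⟩ := ((he i).res hi).exists (res M hV x')
    have h1 := hF V x i W hV hi g hg
    have h2 := hF V x' i W hV hi g' hg'
    rw [map_add, res_smul, ← h1, ← h2, smul_smul, ← add_smul]
    rw [map_add, res_smul, ← hg, ← hg', smul_smul, ← add_smul] at hf
    rw [((he i).res hi).ext hf]
  have hres : ∀ (V W : Z.Opens) (hW : W ≤ V) (x : Γ(M, V)),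
      res N hW (F V x) = F W (res M hW x) := by
    intro V W hW x
    refine huniq W _ _ fun i W' hV hi f hf => ?_
    rw [res_res] at hf ⊢
    exact hF V x i W' _ hi f hf
  have hadd : ∀ (V : Z.Opens) (x x' : Γ(M, V)), F V (x + x') = F V x + F V x' := by
    intro V x x'
    have := hlin V 1 x x'
    rwa [one_smul, one_smul] at this
  have hF0 : ∀ V, F V 0 = 0 := by
    intro V
    have := hadd V 0 0
    rwa [add_zero, left_eq_add] at this
  let φ₀ : M.presheaf ⟶ N.presheaf :=
    { app := fun V => AddCommGrpCat.ofHom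
        { toFun := F V.unop
          map_zero' := hF0 _
          map_add' := hadd V.unop }
      naturality := fun V W i => by
        ext x
        exact (hres V.unop W.unop i.unop.le x).symm }
  let φ : M ⟶ N := ⟨PresheafOfModules.homMk φ₀ fun V r x => by
    have := hlin V.unop r x 0
    rwa [add_zero, hF0, add_zero] at this⟩
  refine ⟨φ, fun i => (huniq (U i) (e i) (n i) ?_).symm⟩
  intro j W hV hi f hf
  have hW : W ≤ U j ⊓ U i := le_inf hi hV
  obtain ⟨v, hv⟩ := ((he j).res (inf_le_left : U j ⊓ U i ≤ U j)).exists
    (res M inf_le_right (e i))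
  have h1 := congrArg (res M hW) hv
  have h2 := congrArg (res N hW) (h j i v hv)
  rw [res_smul, res_res, res_res] at h1 h2
  rw [← h2, ((he j).res hi).ext (hf.trans h1.symm)]

end Frames

end

end MaxDegeneration

namespace MaxDegeneration

noncomputable section

namespace SerreTwist

/-! ### Frames of Serre's twisting sheaves -/

open TopologicalSpace Opposite

variable {A : Type u} {σ : Type*} [CommRing A] [SetLike σ A] [AddSubgroupClass σ A]
  (𝒜 : ℕ → σ) [GradedRing 𝒜] {n m : ℕ}

variable {𝒜} {U V : (Proj 𝒜).Opens}

/-- A point of an open subset of `Proj A`, as a homogeneous prime ideal. -/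
abbrev pt (x : U) : ProjectiveSpectrum 𝒜 := x.1

/-- The value of a section of `𝒪(n)` at a point. -/
def stalkVal (t : Γ(twist 𝒜 n, U)) (x : U) : Fiber 𝒜 (pt x) :=
  (show sections 𝒜 n (op U) from t).1 x

/-- The value of a function at a point. -/
def stalkValF (f : Γ(Proj 𝒜, U)) (x : U) :
    HomogeneousLocalization.AtPrime 𝒜 (pt x).asHomogeneousIdeal.toIdeal :=
  (show (ProjectiveSpectrum.Proj.structureSheaf 𝒜).1.obj (op U) from f).1 x

lemma stalkVal_ext {t t' : Γ(twist 𝒜 n, U)} (h : ∀ x, stalkVal t x = stalkVal t' x) : t = t' :=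
  Subtype.ext (funext h)

lemma stalkValF_ext {f f' : Γ(Proj 𝒜, U)} (h : ∀ x, stalkValF f x = stalkValF f' x) : f = f' :=
  Subtype.ext (funext h)

lemma stalkVal_smul (f : Γ(Proj 𝒜, U)) (t : Γ(twist 𝒜 n, U)) (x : U) :
    stalkVal (f • t) x = (stalkValF f x).val * stalkVal t x := rfl

lemma stalkVal_res (h : V ≤ U) (t : Γ(twist 𝒜 n, U)) (x : V) :
    stalkVal (res _ h t) x = stalkVal t ⟨x.1, h x.2⟩ := rfl

/-- The section of `𝒪(n)` over `U` given by an element of degree `n`. -/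
def sectionOn (U : (Proj 𝒜).Opens) (z : A) (hz : z ∈ 𝒜 n) : Γ(twist 𝒜 n, U) :=
  res _ le_top (toSection 𝒜 n z hz)

lemma stalkVal_sectionOn (z : A) (hz : z ∈ 𝒜 n) (x : U) :
    stalkVal (sectionOn U z hz) x = algebraMap A _ z := rfl

lemma stalkVal_zero (x : U) : stalkVal (0 : Γ(twist 𝒜 n, U)) x = 0 := rfl

lemma stalkValF_mul (f g : Γ(Proj 𝒜, U)) (x : U) :
    stalkValF (f * g) x = stalkValF f x * stalkValF g x := rfl

lemma stalkValF_pow (f : Γ(Proj 𝒜, U)) (k : ℕ) (x : U) :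
    stalkValF (f ^ k) x = stalkValF f x ^ k := by
  induction k with
  | zero => rw [pow_zero, pow_zero]; rfl
  | succ k ih => rw [pow_succ, pow_succ, stalkValF_mul, ih]

lemma isUnit_algebraMap_fiber {x : ProjectiveSpectrum 𝒜} {z : A} :
    IsUnit (algebraMap A (Fiber 𝒜 x) z) ↔ z ∉ x.asHomogeneousIdeal :=
  IsLocalization.AtPrime.isUnit_to_map_iff _ x.asHomogeneousIdeal.toIdeal z

/-- A homogeneous element of degree `n` gives a frame of `𝒪(n)` where it does not vanish. -/
lemma isFrame_toSection {z : A} (hz : z ∈ 𝒜 n) (hU : U ≤ Proj.basicOpen 𝒜 z) :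
    IsFrame (twist 𝒜 n) U (sectionOn U z hz) := by
  have hunit : ∀ x ∈ U, IsUnit (algebraMap A (Fiber 𝒜 x) z) := fun x hx =>
    isUnit_algebraMap_fiber.2 (hU hx)
  refine isFrame_of_bijective fun V hV => ⟨fun f hf => stalkValF_ext fun x => ?_, fun t => ?_⟩
  · have h1 := congrArg (stalkVal · x) hf
    simp only [stalkVal_smul, stalkVal_res, stalkVal_sectionOn, stalkVal_zero] at h1
    rw [(hunit x.1 (hV x.2)).mul_left_eq_zero] at h1
    exact HomogeneousLocalization.val_injective _ (h1.trans (HomogeneousLocalization.val_zero).symm)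
  · have key : ∀ x : V, ∃ (W : (Proj 𝒜).Opens) (_ : x.1 ∈ W) (i : W ≤ V) (k : ℕ) (r d : 𝒜 k)
        (hd : ∀ y : W, d.1 ∉ (pt y).asHomogeneousIdeal.toIdeal), ∀ y : W,
          (HomogeneousLocalization.mk ⟨k, r, d, hd y⟩ :
            HomogeneousLocalization.AtPrime 𝒜 (pt y).asHomogeneousIdeal.toIdeal).val *
              algebraMap A _ z = stalkVal t ⟨y.1, i y.2⟩ := by
      intro x
      obtain ⟨W, hW, i, k, r, d, hr, hd, hd', w⟩ := (show sections 𝒜 n (op V) from t).2 x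
      refine ⟨W, hW, i.le, k + n, ⟨r, hr⟩, ⟨d * z, SetLike.mul_mem_graded hd hz⟩, fun y =>
        mul_notMem 𝒜 (pt y) (hd' y) (hU (hV (i y).2)), fun y => ?_⟩
      refine Eq.trans ?_ (w y).symm
      rw [HomogeneousLocalization.val_mk, ← Localization.mk_one_eq_algebraMap, Localization.mk_mul,
        Localization.mk_eq_mk_iff, Localization.r_iff_exists]
      exact ⟨1, by simp only [OneMemClass.coe_one, one_mul, Submonoid.coe_mul]; ring⟩
    have key' : ∀ x : V, ∃ a : HomogeneousLocalization.AtPrime 𝒜 (pt x).asHomogeneousIdeal.toIdeal,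
        a.val * algebraMap A _ z = stalkVal t x := by
      intro x
      obtain ⟨W, hW, i, k, r, d, hd, w⟩ := key x
      exact ⟨_, w ⟨x.1, hW⟩⟩
    choose a ha using key'
    refine ⟨(⟨a, fun x => ?_⟩ : (ProjectiveSpectrum.Proj.structureSheaf 𝒜).1.obj (op V)),
      stalkVal_ext fun x => ha x⟩
    obtain ⟨W, hW, i, k, r, d, hd, w⟩ := key x
    refine ⟨W, hW, homOfLE i, k, r, d, hd, fun y => HomogeneousLocalization.val_injective _ ?_⟩
    exact (hunit y.1 (hV (i y.2))).mul_left_injective ((ha ⟨y.1, i y.2⟩).trans (w y).symm)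

lemma notMem_of_isFrame {g : A} (hg : g ∈ 𝒜 n)
    (h : IsFrame (twist 𝒜 n) U (sectionOn U g hg)) {x : ProjectiveSpectrum 𝒜}
    (hx : x ∈ U) {z : A} (hz : z ∈ 𝒜 n) (hzx : z ∉ x.asHomogeneousIdeal) :
    g ∉ x.asHomogeneousIdeal := by
  obtain ⟨f, hf⟩ := h.exists (sectionOn U z hz)
  have h1 := congrArg (stalkVal · ⟨x, hx⟩) hf
  simp only [stalkVal_smul, stalkVal_res, stalkVal_sectionOn] at h1
  rw [← isUnit_algebraMap_fiber] at hzx ⊢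
  rw [← h1] at hzx
  exact isUnit_of_mul_isUnit_right hzx

lemma isInvertibleSheaf_twist (h : ∀ x : Proj 𝒜, ∃ z ∈ 𝒜 n, x ∈ Proj.basicOpen 𝒜 z) :
    IsInvertibleSheaf (twist 𝒜 n) := by
  intro x
  obtain ⟨z, hz, hx⟩ := h x
  exact ⟨_, _, hx, isFrame_toSection hz le_rfl⟩

lemma smul_toSection_pow {z z' : A} (hz : z ∈ 𝒜 1) (hz' : z' ∈ 𝒜 1) (f : Γ(Proj 𝒜, U)) (k : ℕ)
    (hk : z ^ k ∈ 𝒜 k) (hk' : z' ^ k ∈ 𝒜 k)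
    (h : f • sectionOn U z hz = sectionOn U z' hz') :
    f ^ k • sectionOn U (z ^ k) hk = sectionOn U (z' ^ k) hk' := by
  refine stalkVal_ext fun x => ?_
  have h1 := congrArg (stalkVal · x) h
  simp only [stalkVal_smul, stalkVal_res, stalkVal_sectionOn, stalkValF_pow] at h1 ⊢
  rw [HomogeneousLocalization.val_pow, map_pow, map_pow, ← mul_pow, h1]

end SerreTwist

/-! ### Tensor powers of invertible sheaves -/

section TensorPow

open TopologicalSpace Opposite

variable {Z : Scheme.{u}} {M : Z.Modules} {U V : Z.Opens}

/-- The tensor power of a section, in the presheaf tensor power. -/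
def presheafPow (e : Γ(M, U)) : ∀ n, (presheafTensorPow M n).obj (op U)
  | 0 => (1 : Γ(Z, U))
  | n + 1 => TensorProduct.tmul Γ(Z, U) (presheafPow e n) e

lemma presheafPow_res (h : V ≤ U) (e : Γ(M, U)) (n : ℕ) :
    (presheafTensorPow M n).map (homOfLE h).op (presheafPow e n) = presheafPow (res M h e) n := by
  induction n with
  | zero => exact map_one (Z.presheaf.map (homOfLE h).op).hom
  | succ n ih =>
    refine (PresheafOfModules.Monoidal.tensorObj_map_tmul (M₁ := presheafTensorPow M n)
      (M₂ := M.val) (homOfLE h).op (presheafPow e n) e).trans ?_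
    rw [ih]
    rfl

lemma smul_pow_tmul_smul {R A N : Type*} [CommRing R] [AddCommGroup A] [AddCommGroup N]
    [Module R A] [Module R N] (f : R) (n : ℕ) (a : A) (e : N) :
    (f ^ n • a) ⊗ₜ[R] (f • e) = f ^ (n + 1) • (a ⊗ₜ[R] e) := by
  rw [TensorProduct.smul_tmul_smul, pow_succ]

lemma bijective_smul_tmul {R A N : Type*} [CommRing R] [AddCommGroup A] [AddCommGroup N]
    [Module R A] [Module R N] {a : A} {e : N} (ha : Function.Bijective fun f : R => f • a)
    (he : Function.Bijective fun f : R => f • e) :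
    Function.Bijective fun f : R => f • (a ⊗ₜ[R] e) := by
  let φ := (TensorProduct.lid R R).symm ≪≫ₗ TensorProduct.congr
    (LinearEquiv.ofBijective (LinearMap.toSpanSingleton R A a) ha)
    (LinearEquiv.ofBijective (LinearMap.toSpanSingleton R N e) he)
  convert φ.bijective using 1
  ext f
  rw [TensorProduct.smul_tmul']
  simp only [φ, LinearEquiv.trans_apply, TensorProduct.lid_symm_apply, TensorProduct.congr_tmul]
  change (f • a) ⊗ₜ[R] e = ((1 : R) • a) ⊗ₜ[R] (f • e)
  rw [one_smul, TensorProduct.smul_tmul]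

/-- The scalar multiplication by a function on the sections of a presheaf of modules. -/
instance (n : ℕ) : Module Γ(Z, U) ((presheafTensorPow M n).obj (op U)) :=
  ((presheafTensorPow M n).obj (op U)).isModule

lemma presheafPow_smul (f : Γ(Z, U)) (e : Γ(M, U))
    (n : ℕ) : presheafPow (f • e) n = f ^ n • presheafPow e n := by
  induction n with
  | zero => rw [pow_zero, one_smul]; rfl
  | succ n ih =>
    refine (congrArg (fun a => TensorProduct.tmul Γ(Z, U) a (f • e)) ih).trans ?_
    exact smul_pow_tmul_smul f n (presheafPow e n) e

lemma bijective_presheafPow (e : Γ(M, U))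
    (he : Function.Bijective fun f : Γ(Z, U) => f • e) (n : ℕ) :
    Function.Bijective fun f : Γ(Z, U) => f • presheafPow e n := by
  induction n with
  | zero =>
    change Function.Bijective fun f : Γ(Z, U) => f * 1
    simp only [mul_one]
    exact Function.bijective_id
  | succ n ih => exact bijective_smul_tmul ih he

/-- The map from the sections of the presheaf tensor power to those of the tensor power. -/
def toTensorPow (n : ℕ) (U : Z.Opens) :
    (presheafTensorPow M n).obj (op U) →+ Γ(tensorPow M n, U) :=
  ((CategoryTheory.toSheafify (Opens.grothendieckTopology Z)
    (presheafTensorPow M n).presheaf).app (op U)).hom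

lemma toTensorPow_res {n : ℕ} (h : V ≤ U) (x : (presheafTensorPow M n).obj (op U)) :
    toTensorPow n V ((presheafTensorPow M n).map (homOfLE h).op x) =
      res (tensorPow M n) h (toTensorPow n U x) :=
  ConcreteCategory.congr_hom ((CategoryTheory.toSheafify (Opens.grothendieckTopology Z)
    (presheafTensorPow M n).presheaf).naturality (homOfLE h).op) x

lemma toTensorPow_smul {n : ℕ} (f : Γ(Z, U)) (x : (presheafTensorPow M n).obj (op U)) :
    toTensorPow n U (f • x) = f • toTensorPow n U x :=
  (((PresheafOfModules.sheafificationAdjunction (𝟙 Z.ringCatSheaf.obj)).unit.app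
    (presheafTensorPow M n)).app (op U)).hom.map_smul f x

lemma exists_res_eq_zero {n : ℕ} (x : (presheafTensorPow M n).obj (op U))
    (hx : toTensorPow n U x = 0) {z : Z} (hz : z ∈ U) : ∃ (W : Z.Opens) (hW : W ≤ U), z ∈ W ∧
      (presheafTensorPow M n).map (homOfLE hW).op x = 0 := by
  obtain ⟨W, i, hi, hW⟩ := Presheaf.equalizerSieve_mem (Opens.grothendieckTopology Z)
    (CategoryTheory.toSheafify (Opens.grothendieckTopology Z)
    (presheafTensorPow M n).presheaf) x 0 (hx.trans (map_zero (toTensorPow n U)).symm) z hz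
  exact ⟨W, i.le, hW, hi.trans (map_zero ((presheafTensorPow M n).presheaf.map i.op).hom)⟩

lemma exists_toTensorPow_eq {n : ℕ} (x : Γ(tensorPow M n, U)) {z : Z} (hz : z ∈ U) :
    ∃ (W : Z.Opens) (hW : W ≤ U) (y : (presheafTensorPow M n).obj (op W)), z ∈ W ∧
      toTensorPow n W y = res _ hW x := by
  obtain ⟨W, i, ⟨y, hy⟩, hW⟩ := Presheaf.imageSieve_mem (Opens.grothendieckTopology Z)
    (CategoryTheory.toSheafify (Opens.grothendieckTopology Z)
    (presheafTensorPow M n).presheaf) x z hz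
  exact ⟨W, i.le, y, hW, hy⟩

/-- The tensor power of a section. -/
def sectionPow (e : Γ(M, U)) (n : ℕ) : Γ(tensorPow M n, U) := toTensorPow n U (presheafPow e n)

lemma res_sectionPow (h : V ≤ U) (e : Γ(M, U)) (n : ℕ) :
    res _ h (sectionPow e n) = sectionPow (res M h e) n := by
  rw [sectionPow, ← toTensorPow_res, presheafPow_res]
  rfl

lemma sectionPow_smul (f : Γ(Z, U)) (e : Γ(M, U)) (n : ℕ) :
    sectionPow (f • e) n = f ^ n • sectionPow e n := by
  rw [sectionPow, presheafPow_smul, toTensorPow_smul]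
  rfl

lemma IsFrame.sectionPow {e : Γ(M, U)} (he : IsFrame M U e) (n : ℕ) :
    IsFrame (tensorPow M n) U (MaxDegeneration.sectionPow e n) := by
  have hb : ∀ {V : Z.Opens} (hV : V ≤ U), Function.Bijective fun f : Γ(Z, V) =>
      f • presheafPow (MaxDegeneration.res M hV e) n := fun hV => bijective_presheafPow _ (he _ hV) n
  refine isFrame_of_locally (fun V hV f hf => eq_of_resF_eq fun z hz => ?_) fun V hV x z hz => ?_
  · rw [res_sectionPow, MaxDegeneration.sectionPow, ← toTensorPow_smul] at hf
    obtain ⟨W, hW, hzW, h⟩ := exists_res_eq_zero _ hf hz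
    refine ⟨W, hW, hzW, (hb (hW.trans hV)).1 ?_⟩
    have h1 := ((presheafTensorPow M n).map_smul (homOfLE hW).op f
      (presheafPow (MaxDegeneration.res M hV e) n)).symm.trans h
    rw [presheafPow_res, res_res] at h1
    rw [map_zero]
    simp only [zero_smul]
    exact h1
  · obtain ⟨W, hW, y, hzW, hy⟩ := exists_toTensorPow_eq x hz
    obtain ⟨f, hf⟩ := (hb (hW.trans hV)).2 y
    refine ⟨W, hW, hzW, f, ?_⟩
    rw [← hy, ← hf, toTensorPow_smul, res_sectionPow]
    rfl

lemma mem_nonvanishing {t : Γ(M, ⊤)} {z : Z} :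
    z ∈ nonvanishing M t ↔ ∃ U : Z.Opens, IsFrame M U (res M le_top t) ∧ z ∈ U :=
  Opens.mem_sSup

end TensorPow

namespace SerreTwist

open TopologicalSpace Opposite

variable {A : Type u} {σ : Type*} [CommRing A] [SetLike σ A] [AddSubgroupClass σ A]
  {𝒜 : ℕ → σ} [GradedRing 𝒜]

lemma pow_mem {z : A} (hz : z ∈ 𝒜 1) (n : ℕ) : z ^ n ∈ 𝒜 n := by
  have := SetLike.pow_mem_graded n hz
  rwa [nsmul_one] at this

/-- A homogeneous element of degree `n` gives a global section of `𝒪(1)^{⊗ n}`. -/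
lemma exists_tensorPow_section (hgen : ∀ x : Proj 𝒜, ∃ z ∈ 𝒜 1, x ∈ Proj.basicOpen 𝒜 z) {n : ℕ}
    {g : A} (hg : g ∈ 𝒜 n) :
    ∃ t : Γ(tensorPow (twist 𝒜 1) n, ⊤), nonvanishing _ t = Proj.basicOpen 𝒜 g := by
  let U : 𝒜 1 → (Proj 𝒜).Opens := fun z => Proj.basicOpen 𝒜 z.1
  let e : ∀ z : 𝒜 1, Γ(twist 𝒜 1, U z) := fun z => sectionOn (U z) z.1 z.2
  have he : ∀ z, IsFrame (twist 𝒜 1) (U z) (e z) := fun z => isFrame_toSection z.2 le_rfl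
  have hE : ∀ (z : 𝒜 1) (V : (Proj 𝒜).Opens), V ≤ U z →
      IsFrame (twist 𝒜 n) V (sectionOn V (z.1 ^ n) (pow_mem z.2 n)) := fun z V hV =>
    isFrame_toSection _ (hV.trans (by
      intro x hx
      exact fun hmem => hx (x.isPrime.mem_of_pow_mem n hmem)))
  choose f hf using fun z => (hE z (U z) le_rfl).exists (sectionOn (U z) g hg)
  have hf' : ∀ (z : 𝒜 1) (V : (Proj 𝒜).Opens) (hV : V ≤ U z),
      resF hV (f z) • sectionOn V (z.1 ^ n) (pow_mem z.2 n) = sectionOn V g hg := fun z V hV => by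
    have := congrArg (res _ hV) (hf z)
    rwa [res_smul] at this
  obtain ⟨t, ht⟩ := exists_glue (M := tensorPow (twist 𝒜 1) n) (U := ⊤) U (fun z => le_top)
    (fun x _ => by
      obtain ⟨z, hz, hx⟩ := hgen x
      exact Opens.mem_iSup.2 ⟨⟨z, hz⟩, hx⟩) (fun z => f z • sectionPow (e z) n) (fun z z' => by
    obtain ⟨v, hv⟩ := ((he z).res (inf_le_left : U z ⊓ U z' ≤ U z)).exists (res _ inf_le_right (e z'))
    have h1 := smul_toSection_pow z.2 z'.2 v n (pow_mem z.2 n) (pow_mem z'.2 n) hv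
    rw [res_smul, res_smul, res_sectionPow, res_sectionPow, ← hv, sectionPow_smul, smul_smul]
    congr 1
    refine (hE z _ inf_le_left).ext ?_
    rw [mul_smul, h1, hf', hf'])
  have ht' : ∀ (z : 𝒜 1) (V : (Proj 𝒜).Opens) (hV : V ≤ U z), res _ le_top t =
      resF hV (f z) • sectionPow (sectionOn V z.1 z.2) n := fun z V hV => by
    have := congrArg (res _ hV) (ht z)
    rwa [res_smul, res_res, res_sectionPow] at this
  have he' : ∀ (z : 𝒜 1) (V : (Proj 𝒜).Opens), V ≤ U z →
      IsFrame (tensorPow (twist 𝒜 1) n) V (sectionPow (sectionOn V z.1 z.2) n) := fun z V hV =>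
    ((he z).res hV).sectionPow n
  refine ⟨t, le_antisymm (fun x hx => ?_) fun x hx => mem_nonvanishing.2 ⟨_, ?_, hx⟩⟩
  · obtain ⟨V, hV, hxV⟩ := mem_nonvanishing.1 hx
    obtain ⟨z, hz, hxz⟩ := hgen x
    have hW := inf_le_right (a := V) (b := U ⟨z, hz⟩)
    have h1 := hV.res (inf_le_left : V ⊓ U ⟨z, hz⟩ ≤ V)
    rw [res_res, ht' ⟨z, hz⟩ _ hW] at h1
    have h2 := (hE ⟨z, hz⟩ _ hW).unit_smul ((he' ⟨z, hz⟩ _ hW).isUnit_of_smul h1)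
    rw [hf'] at h2
    exact notMem_of_isFrame hg h2 ⟨hxV, hxz⟩ (pow_mem hz n)
      fun hmem => hxz (x.isPrime.mem_of_pow_mem n hmem)
  · refine isFrame_of_cover fun y hy => ?_
    obtain ⟨z, hz, hyz⟩ := hgen y
    have hW := inf_le_right (a := Proj.basicOpen 𝒜 g) (b := U ⟨z, hz⟩)
    refine ⟨_ ⊓ U ⟨z, hz⟩, inf_le_left, ⟨hy, hyz⟩, ?_⟩
    rw [res_res, ht' ⟨z, hz⟩ _ hW]
    refine (he' ⟨z, hz⟩ _ hW).unit_smul ((hE ⟨z, hz⟩ _ hW).isUnit_of_smul ?_)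
    rw [hf']
    exact isFrame_toSection hg inf_le_left

lemma isAmpleSheaf_twist (hgen : ∀ x : Proj 𝒜, ∃ z ∈ 𝒜 1, x ∈ Proj.basicOpen 𝒜 z) :
    IsAmpleSheaf (twist 𝒜 1) := by
  refine ⟨isInvertibleSheaf_twist hgen, Opens.isBasis_iff_nbhd.2 fun {V x} hx => ?_⟩
  obtain ⟨_, ⟨f, rfl⟩, hxf, hfV⟩ := Opens.isBasis_iff_nbhd.1 (Proj.isBasis_basicOpen 𝒜) hx
  rw [Proj.basicOpen_eq_iSup_proj] at hxf hfV
  obtain ⟨i, hi⟩ := Opens.mem_iSup.1 hxf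
  obtain ⟨z, hz, hxz⟩ := hgen x
  have hg : GradedRing.proj 𝒜 i f * z ∈ 𝒜 (i + 1) :=
    SetLike.mul_mem_graded (SetLike.coe_mem _) hz
  obtain ⟨t, ht⟩ := exists_tensorPow_section hgen hg
  refine ⟨_, ⟨Proj.isAffineOpen_basicOpen 𝒜 _ hg i.succ_pos, i + 1, t, by omega, ht.symm⟩, ?_, ?_⟩
  · rw [Proj.basicOpen_mul]
    exact ⟨hi, hxz⟩
  · rw [Proj.basicOpen_mul]
    exact inf_le_left.trans ((le_iSup (fun i => Proj.basicOpen 𝒜 (GradedRing.proj 𝒜 i f)) i).trans hfV)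

end SerreTwist

namespace DegenerationData

variable {𝓡 : Type u} [CommRing 𝓡] [IsDomain 𝓡] [IsDiscreteValuationRing 𝓡]
  {K : Type u} [Field K] [Algebra 𝓡 K] [IsFractionRing 𝓡 K] {X : Type u} [AddCommGroup X]
  (D : DegenerationData 𝓡 K X) {s : 𝓡} [Module.Free ℤ X] [Module.Finite ℤ X] [Nontrivial X]

lemma isAmpleSheaf_L (hs : Irreducible s) : IsAmpleSheaf (D.L s) :=
  SerreTwist.isAmpleSheaf_twist fun x => by
    obtain ⟨c, hc⟩ := D.exists_mem_vertexOpen hs x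
    exact ⟨_, D.zeta_mem s c, hc⟩

end DegenerationData

end

end MaxDegeneration

namespace MaxDegeneration

noncomputable section

/-! ### Points with values in affine schemes -/

section Points

open MonoidalCategory CartesianMonoidalCategory
open scoped MonObj

variable {𝓡 : Type u} [CommRing 𝓡] {A B : Type u} [CommRing A] [Algebra 𝓡 A] [CommRing B]
  [Algebra 𝓡 B] {Y Y' : Over (Spec (CommRingCat.of 𝓡))}

/-- The ring homomorphism that corresponds to a point of `Spec A` with values in `Y`. -/
def funOf (u : Y ⟶ specOver 𝓡 A) : A →+* Γ(Y.left, ⊤) :=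
  u.left.appTop.hom.comp (Scheme.ΓSpecIso (CommRingCat.of A)).inv.hom

lemma funOf_apply (u : Y ⟶ specOver 𝓡 A) (f : A) :
    funOf u f = u.left.appTop (specFunction f) := rfl

variable (Y) in
/-- The structure homomorphism of a scheme over `Spec 𝓡`. -/
def baseFun : 𝓡 →+* Γ(Y.left, ⊤) :=
  Y.hom.appTop.hom.comp (Scheme.ΓSpecIso (CommRingCat.of 𝓡)).inv.hom

lemma appTop_specMap (φ : A →+* B) (f : A) :
    (Spec.map (CommRingCat.ofHom φ)).appTop (specFunction f) = specFunction (φ f) :=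
  (ConcreteCategory.congr_hom
    (Scheme.ΓSpecIso_inv_naturality (CommRingCat.ofHom φ)) f).symm

lemma funOf_comp (g : Y' ⟶ Y) (u : Y ⟶ specOver 𝓡 A) (f : A) :
    funOf (g ≫ u) f = g.left.appTop (funOf u f) := rfl

lemma funOf_specOverMap (u : Y ⟶ specOver 𝓡 B) (φ : A →ₐ[𝓡] B) (f : A) :
    funOf (u ≫ specOverMap φ) f = funOf u (φ f) := by
  rw [funOf_comp, funOf_apply, funOf_apply]
  exact congrArg u.left.appTop (appTop_specMap φ.toRingHom f)

lemma funOf_algebraMap (u : Y ⟶ specOver 𝓡 A) (r : 𝓡) :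
    funOf u (algebraMap 𝓡 A r) = baseFun Y r := by
  have h : u.left ≫ Spec.map (CommRingCat.ofHom (algebraMap 𝓡 A)) = Y.hom := Over.w u
  rw [funOf_apply, ← appTop_specMap]
  exact congrArg (fun v : Y.left ⟶ Spec (CommRingCat.of 𝓡) => v.appTop (specFunction r)) h

lemma funOf_injective {u v : Y ⟶ specOver 𝓡 A} (h : ∀ f, funOf u f = funOf v f) : u = v := by
  refine Over.OverMorphism.ext (ext_of_isAffine (Y := Spec (CommRingCat.of A)) ?_)
  have h1 : (Scheme.ΓSpecIso (CommRingCat.of A)).inv ≫ u.left.appTop =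
      (Scheme.ΓSpecIso (CommRingCat.of A)).inv ≫ v.left.appTop := by
    ext f; exact h f
  exact (cancel_epi _).1 h1

lemma exists_funOf_eq (φ : A →+* Γ(Y.left, ⊤)) (hφ : ∀ r, φ (algebraMap 𝓡 A r) = baseFun Y r) :
    ∃ u : Y ⟶ specOver 𝓡 A, funOf u = φ := by
  let v : Y.left ⟶ Spec (CommRingCat.of A) := Y.left.toSpecΓ ≫ Spec.map (CommRingCat.ofHom φ)
  have hv : ∀ f : A, v.appTop (specFunction f) = φ f := by
    intro f
    have h1 : v.appTop (specFunction f) = Y.left.toSpecΓ.appTop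
        ((Spec.map (CommRingCat.ofHom φ)).appTop (specFunction f)) := by
      rw [Scheme.Hom.comp_appTop]; rfl
    rw [h1, appTop_specMap, Scheme.toSpecΓ_appTop]
    exact ConcreteCategory.congr_hom (Scheme.ΓSpecIso Γ(Y.left, ⊤)).inv_hom_id (φ f)
  refine ⟨Over.homMk v (ext_of_isAffine (Y := Spec (CommRingCat.of 𝓡)) ?_), RingHom.ext hv⟩
  rw [← cancel_epi (Scheme.ΓSpecIso (CommRingCat.of 𝓡)).inv]
  ext r
  refine Eq.trans ?_ (hφ r)
  rw [← hv, ← appTop_specMap]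
  change (v ≫ Spec.map (CommRingCat.ofHom (algebraMap 𝓡 A))).appTop (specFunction r) = _
  rw [Scheme.Hom.comp_appTop]
  rfl

end Points

/-! ### The action of the torus on affine torus embeddings -/

section AffineAction

open MonoidalCategory CartesianMonoidalCategory
open scoped MonObj

/-- A subalgebra of a group algebra that is generated by homogeneous elements. -/
def IsHomogeneousSubalgebra {𝓡 K X : Type u} [CommRing 𝓡] [Field K] [Algebra 𝓡 K] [AddCommGroup X]
    (A : Subalgebra 𝓡 (AddMonoidAlgebra K X)) : Prop :=
  ∀ f ∈ A, ∀ x, AddMonoidAlgebra.single x (f.coeff x) ∈ A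

variable {𝓡 K X : Type u} [CommRing 𝓡] [Field K] [Algebra 𝓡 K] [AddCommGroup X]
  {A : Subalgebra 𝓡 (AddMonoidAlgebra K X)} {Y Y' : Over (Spec (CommRingCat.of 𝓡))}

lemma isHomogeneousSubalgebra_coneAlgebra {s : 𝓡} (hs : algebraMap 𝓡 K s ≠ 0)
    (σ : PointedCone ℝ (NR X)) : IsHomogeneousSubalgebra (coneAlgebra 𝓡 s K σ) := by
  intro f hf x
  rw [mem_coneAlgebra hs] at hf ⊢
  intro x'
  classical
  rw [AddMonoidAlgebra.coeff_single, Finsupp.single_apply]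
  split_ifs with h
  · exact h ▸ hf x
  · exact Or.inl rfl

/-- The coaction on the group algebra `K[X]`. -/
def groupCoaction : AddMonoidAlgebra K X →+* AddMonoidAlgebra (AddMonoidAlgebra K X) X :=
  AddMonoidAlgebra.liftNCRingHom
    (AddMonoidAlgebra.singleZeroRingHom.comp AddMonoidAlgebra.singleZeroRingHom)
    { toFun := fun x => AddMonoidAlgebra.single x.toAdd (AddMonoidAlgebra.single x.toAdd 1)
      map_one' := rfl
      map_mul' := fun x y => by
        rw [AddMonoidAlgebra.single_mul_single, AddMonoidAlgebra.single_mul_single, one_mul]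
        rfl }
    fun _ _ => Commute.all _ _

lemma groupCoaction_single (x : X) (k : K) : groupCoaction (AddMonoidAlgebra.single x k) =
    AddMonoidAlgebra.single x (AddMonoidAlgebra.single x k) := by
  refine (AddMonoidAlgebra.liftNC_single _ _ _ _).trans ?_
  change AddMonoidAlgebra.single 0 (AddMonoidAlgebra.single 0 k) *
    AddMonoidAlgebra.single x (AddMonoidAlgebra.single x 1) = _
  rw [AddMonoidAlgebra.single_mul_single, AddMonoidAlgebra.single_mul_single, zero_add, mul_one]

lemma eq_single_of_support {f : AddMonoidAlgebra K X} {x : X} (hf : f.coeff.support ⊆ {x}) :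
    f = AddMonoidAlgebra.single x (f.coeff x) := by
  conv_lhs => rw [← AddMonoidAlgebra.sum_coeff_single f]
  exact Finsupp.sum_of_support_subset _ hf _ (fun _ _ => AddMonoidAlgebra.single_zero _) |>.trans
    (Finset.sum_singleton _ _)

lemma exists_coaction (hA : IsHomogeneousSubalgebra A) : ∃ δ : A →+* AddMonoidAlgebra A X,
    ∀ (x : X) (f : A), f.1.coeff.support ⊆ {x} → δ f = AddMonoidAlgebra.single x f := by
  let i : AddMonoidAlgebra A X →+* AddMonoidAlgebra (AddMonoidAlgebra K X) X :=
    AddMonoidAlgebra.mapRingHom X (A.subtype : A →+* AddMonoidAlgebra K X)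
  have hi_single : ∀ (x : X) (f : A),
      i (AddMonoidAlgebra.single x f) = AddMonoidAlgebra.single x f.1 := fun x f =>
    AddMonoidAlgebra.mapRingHom_single _ _ _
  have hi : Function.Injective i := fun f g hfg => by
    ext1
    refine Finsupp.ext fun x => Subtype.ext ?_
    exact DFunLike.congr_fun (congrArg AddMonoidAlgebra.coeff hfg) x
  have hex : ∀ f : A, ∃ g, i g = groupCoaction f.1 := fun f => by
    refine ⟨∑ x ∈ f.1.coeff.support, AddMonoidAlgebra.single x ⟨_, hA f.1 f.2 x⟩, ?_⟩
    conv_rhs => rw [← AddMonoidAlgebra.sum_coeff_single f.1]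
    rw [map_sum, Finsupp.sum, map_sum]
    exact Finset.sum_congr rfl fun x _ => by rw [hi_single, groupCoaction_single]
  choose δ hδ using hex
  refine ⟨{ toFun := δ, map_one' := hi ?_, map_mul' := fun f g => hi ?_, map_zero' := hi ?_,
            map_add' := fun f g => hi ?_ }, fun x f hf => hi ?_⟩
  · rw [hδ, map_one]; exact map_one _
  · rw [map_mul, hδ, hδ, hδ]; exact map_mul _ _ _
  · rw [hδ, map_zero]; exact map_zero _
  · rw [map_add, hδ, hδ, hδ]; exact map_add _ _ _
  · refine (hδ f).trans ?_
    rw [hi_single, eq_single_of_support hf, groupCoaction_single]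

lemma exists_mulPt (hA : IsHomogeneousSubalgebra A) (t : Y ⟶ splitTorus 𝓡 X)
    (u : Y ⟶ specOver 𝓡 A) : ∃ v : Y ⟶ specOver 𝓡 A, ∀ (x : X) (f : A),
      f.1.coeff.support ⊆ {x} →
        funOf v f = funOf t (AddMonoidAlgebra.single x 1) * funOf u f := by
  obtain ⟨δ, hδ⟩ := exists_coaction hA
  let φ : A →+* Γ(Y.left, ⊤) := (AddMonoidAlgebra.liftNCRingHom (funOf u)
    ((funOf t : AddMonoidAlgebra 𝓡 X →* Γ(Y.left, ⊤)).comp (AddMonoidAlgebra.of 𝓡 X))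
    fun _ _ => Commute.all _ _).comp δ
  have hφ : ∀ (x : X) (f : A), f.1.coeff.support ⊆ {x} →
      φ f = funOf t (AddMonoidAlgebra.single x 1) * funOf u f := by
    intro x f hf
    change AddMonoidAlgebra.liftNC _ _ (δ f) = _
    rw [hδ x f hf, mul_comm]
    exact AddMonoidAlgebra.liftNC_single _ _ _ _
  obtain ⟨v, hv⟩ := exists_funOf_eq φ fun r => by
    rw [hφ 0, funOf_algebraMap]
    · erw [map_one]
      exact one_mul _
    · intro y hy
      rw [Finset.mem_singleton]
      by_contra hne
      refine Finsupp.mem_support_iff.1 hy ?_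
      change (AddMonoidAlgebra.single 0 (algebraMap 𝓡 K r)).coeff y = 0
      rw [AddMonoidAlgebra.coeff_single, Finsupp.single_eq_of_ne hne]
  exact ⟨v, fun x f hf => by rw [hv, hφ x f hf]⟩

/-- The product of a point of the torus and a point of an affine torus embedding. -/
def mulPt (hA : IsHomogeneousSubalgebra A) (t : Y ⟶ splitTorus 𝓡 X) (u : Y ⟶ specOver 𝓡 A) :
    Y ⟶ specOver 𝓡 A := (exists_mulPt hA t u).choose

lemma funOf_mulPt (hA : IsHomogeneousSubalgebra A) (t : Y ⟶ splitTorus 𝓡 X)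
    (u : Y ⟶ specOver 𝓡 A) {x : X} {f : A} (hf : f.1.coeff.support ⊆ {x}) :
    funOf (mulPt hA t u) f = funOf t (AddMonoidAlgebra.single x 1) * funOf u f :=
  (exists_mulPt hA t u).choose_spec x f hf

lemma funOf_ext (hA : IsHomogeneousSubalgebra A) {u v : Y ⟶ specOver 𝓡 A}
    (h : ∀ (x : X) (f : A), f.1.coeff.support ⊆ {x} → funOf u f = funOf v f) : u = v := by
  refine funOf_injective fun f => ?_
  have hf : f = ∑ x ∈ f.1.coeff.support, (⟨_, hA f.1 f.2 x⟩ : A) := by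
    refine Subtype.ext ?_
    conv_lhs => rw [← AddMonoidAlgebra.sum_coeff_single f.1]
    exact (map_sum A.val (fun x => (⟨_, hA f.1 f.2 x⟩ : A)) _).symm
  rw [hf, map_sum, map_sum]
  exact Finset.sum_congr rfl fun x _ => h x _ Finsupp.support_single_subset

lemma comp_mulPt (hA : IsHomogeneousSubalgebra A) (g : Y' ⟶ Y) (t : Y ⟶ splitTorus 𝓡 X)
    (u : Y ⟶ specOver 𝓡 A) : g ≫ mulPt hA t u = mulPt hA (g ≫ t) (g ≫ u) :=
  funOf_ext hA fun x f hf => by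
    rw [funOf_mulPt hA _ _ hf, funOf_comp, funOf_mulPt hA _ _ hf, map_mul, funOf_comp, funOf_comp]

lemma mulPt_inclusion {B : Subalgebra 𝓡 (AddMonoidAlgebra K X)} (hA : IsHomogeneousSubalgebra A)
    (hB : IsHomogeneousSubalgebra B) (h : A ≤ B) (t : Y ⟶ splitTorus 𝓡 X)
    (u : Y ⟶ specOver 𝓡 B) : mulPt hB t u ≫ specOverMap (Subalgebra.inclusion h) =
      mulPt hA t (u ≫ specOverMap (Subalgebra.inclusion h)) :=
  funOf_ext hA fun x f hf => by
    rw [funOf_mulPt hA _ _ hf, funOf_specOverMap, funOf_specOverMap, funOf_mulPt hB _ _ (by exact hf)]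

lemma funOf_one_single (x : X) :
    funOf (toUnit Y ≫ η[splitTorus 𝓡 X]) (AddMonoidAlgebra.single x 1) = 1 := by
  have h := appTop_specMap (Bialgebra.counitAlgHom 𝓡 (AddMonoidAlgebra 𝓡 X)).toRingHom
    (AddMonoidAlgebra.single x 1)
  have h1 : (Bialgebra.counitAlgHom 𝓡 (AddMonoidAlgebra 𝓡 X)).toRingHom
    (AddMonoidAlgebra.single x 1) = 1 := by simp
  rw [h1] at h
  refine (congrArg Y.hom.appTop h).trans ?_
  exact map_one (baseFun Y)

lemma funOf_mul_single (t t' : Y ⟶ splitTorus 𝓡 X) (x : X) :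
    funOf (lift t t' ≫ μ[splitTorus 𝓡 X]) (AddMonoidAlgebra.single x 1) =
      funOf t (AddMonoidAlgebra.single x 1) * funOf t' (AddMonoidAlgebra.single x 1) := by
  let q := (pullbackSpecIso 𝓡 (AddMonoidAlgebra 𝓡 X) (AddMonoidAlgebra 𝓡 X)).hom
  let χ : AddMonoidAlgebra 𝓡 X := AddMonoidAlgebra.single x 1
  have hL : q.appTop (specFunction (Algebra.TensorProduct.includeLeftRingHom χ)) =
      (fst (splitTorus 𝓡 X) (splitTorus 𝓡 X)).left.appTop (specFunction χ) := by
    rw [← appTop_specMap]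
    exact congrArg (fun v => v.appTop (specFunction χ))
      (pullbackSpecIso_hom_fst 𝓡 (AddMonoidAlgebra 𝓡 X) (AddMonoidAlgebra 𝓡 X))
  have hR : q.appTop (specFunction
      (RingHomClass.toRingHom (Algebra.TensorProduct.includeRight (R := 𝓡)
        (A := AddMonoidAlgebra 𝓡 X)) χ)) =
      (snd (splitTorus 𝓡 X) (splitTorus 𝓡 X)).left.appTop (specFunction χ) := by
    rw [← appTop_specMap]
    exact congrArg (fun v => v.appTop (specFunction χ))
      (pullbackSpecIso_hom_snd 𝓡 (AddMonoidAlgebra 𝓡 X) (AddMonoidAlgebra 𝓡 X))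
  have hμ : μ[splitTorus 𝓡 X].left.appTop (specFunction χ) =
      (fst (splitTorus 𝓡 X) (splitTorus 𝓡 X)).left.appTop (specFunction χ) *
      (snd (splitTorus 𝓡 X) (splitTorus 𝓡 X)).left.appTop (specFunction χ) := by
    rw [← hL, ← hR]
    refine (congrArg q.appTop (appTop_specMap
      (Bialgebra.comulAlgHom 𝓡 (AddMonoidAlgebra 𝓡 X)).toRingHom χ)).trans ?_
    have h1 : (Bialgebra.comulAlgHom 𝓡 (AddMonoidAlgebra 𝓡 X)).toRingHom χ = 
      Algebra.TensorProduct.includeLeftRingHom χ *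
      RingHomClass.toRingHom (Algebra.TensorProduct.includeRight (R := 𝓡)
        (A := AddMonoidAlgebra 𝓡 X)) χ := by
      simp [χ, AddMonoidAlgebra.comul_single]
    rw [h1]
    refine (congrArg q.appTop (map_mul (Scheme.ΓSpecIso _).inv.hom _ _)).trans ?_
    exact map_mul q.appTop.hom _ _
  have h1 : funOf t χ = (lift t t').left.appTop
      ((fst (splitTorus 𝓡 X) (splitTorus 𝓡 X)).left.appTop (specFunction χ)) := by
    conv_lhs => rw [← lift_fst t t']
    rfl
  have h2 : funOf t' χ = (lift t t').left.appTop
      ((snd (splitTorus 𝓡 X) (splitTorus 𝓡 X)).left.appTop (specFunction χ)) := by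
    conv_lhs => rw [← lift_snd t t']
    rfl
  rw [h1, h2, ← map_mul, ← hμ]
  rfl

lemma one_mulPt (hA : IsHomogeneousSubalgebra A) (u : Y ⟶ specOver 𝓡 A) :
    mulPt hA (toUnit Y ≫ η[splitTorus 𝓡 X]) u = u :=
  funOf_ext hA fun x f hf => by
    rw [funOf_mulPt hA _ _ hf, funOf_one_single, one_mul]

lemma mul_mulPt (hA : IsHomogeneousSubalgebra A) (t t' : Y ⟶ splitTorus 𝓡 X)
    (u : Y ⟶ specOver 𝓡 A) :
    mulPt hA (lift t t' ≫ μ[splitTorus 𝓡 X]) u = mulPt hA t (mulPt hA t' u) :=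
  funOf_ext hA fun x f hf => by
    rw [funOf_mulPt hA _ _ hf, funOf_mulPt hA _ _ hf, funOf_mulPt hA _ _ hf, funOf_mul_single,
      mul_assoc]

end AffineAction

end

end MaxDegeneration

namespace MaxDegeneration

noncomputable section

/-! ### Local constructions of morphisms over a base -/

section OverGluing

variable {S : Scheme.{u}} {U P Y Z : Over S}

lemma exists_lift_of_isOpenImmersion (f : U ⟶ P) (hf : IsOpenImmersion f.left) (p : Y ⟶ P)
    (h : Set.range p.left ⊆ Set.range f.left) : ∃ u : Y ⟶ U, u ≫ f = p := by
  refine ⟨Over.homMk (IsOpenImmersion.lift f.left p.left h) ?_,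
    Over.OverMorphism.ext (IsOpenImmersion.lift_fac _ _ _)⟩
  rw [← Over.w f, IsOpenImmersion.lift_fac_assoc, Over.w]

lemma eq_of_comp_isOpenImmersion (f : U ⟶ P) (hf : IsOpenImmersion f.left) {u v : Y ⟶ U}
    (h : u ≫ f = v ≫ f) : u = v := by
  refine Over.OverMorphism.ext ((cancel_mono f.left).1 ?_)
  rw [← Over.comp_left, h, Over.comp_left]

/-- An open subscheme, as a scheme over the base. -/
def openOver (W : Y.left.Opens) : Over S := Over.mk (W.ι ≫ Y.hom)

/-- The inclusion of an open subscheme, over the base. -/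
def openOverι (W : Y.left.Opens) : openOver W ⟶ Y := Over.homMk W.ι

lemma range_openOverι (W : Y.left.Opens) : Set.range (openOverι W).left = W :=
  W.range_ι

lemma isOpenImmersion_openOverι (W : Y.left.Opens) : IsOpenImmersion (openOverι W).left :=
  inferInstanceAs (IsOpenImmersion W.ι)

lemma eq_of_openOverι {q q' : Y ⟶ Z} (h : ∀ y : Y.left, ∃ W : Y.left.Opens, y ∈ W ∧
    openOverι W ≫ q = openOverι W ≫ q') : q = q' := by
  refine Over.OverMorphism.ext (Scheme.hom_ext_of_forall _ _ fun y => ?_)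
  obtain ⟨W, hy, hW⟩ := h y
  exact ⟨W, hy, congrArg (fun f => f.left) hW⟩

lemma exists_glue_openOver {ι : Type u} (W : ι → Y.left.Opens) (hW : ∀ y, ∃ i, y ∈ W i)
    (f : ∀ i, openOver (W i) ⟶ Z)
    (h : ∀ (i j) (Y' : Over S) (g : Y' ⟶ openOver (W i)) (g' : Y' ⟶ openOver (W j)),
      g ≫ openOverι (W i) = g' ≫ openOverι (W j) → g ≫ f i = g' ≫ f j) :
    ∃ F : Y ⟶ Z, ∀ i, openOverι (W i) ≫ F = f i := by
  have hcov : TopologicalSpace.IsOpenCover W := by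
    refine TopologicalSpace.Opens.ext (Set.eq_univ_of_forall fun y => ?_)
    obtain ⟨i, hi⟩ := hW y
    exact TopologicalSpace.Opens.mem_iSup.2 ⟨i, hi⟩
  let 𝒰 := Y.left.openCoverOfIsOpenCover W hcov
  have hf : ∀ i j, Limits.pullback.fst (𝒰.f i) (𝒰.f j) ≫ (f i).left =
      Limits.pullback.snd (𝒰.f i) (𝒰.f j) ≫ (f j).left := by
    intro i j
    let Y' : Over S := Over.mk (Limits.pullback.fst (𝒰.f i) (𝒰.f j) ≫ (openOver (W i)).hom)
    have hw : Limits.pullback.fst (𝒰.f i) (𝒰.f j) ≫ (W i).ι =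
      Limits.pullback.snd (𝒰.f i) (𝒰.f j) ≫ (W j).ι := Limits.pullback.condition
    let g : Y' ⟶ openOver (W i) := Over.homMk (Limits.pullback.fst (𝒰.f i) (𝒰.f j)) rfl
    let g' : Y' ⟶ openOver (W j) := Over.homMk (Limits.pullback.snd (𝒰.f i) (𝒰.f j))
      ((Category.assoc _ _ _).symm.trans ((congrArg (· ≫ Y.hom) hw).symm.trans
        (Category.assoc _ _ _)))
    exact congrArg (fun f => f.left) (h i j Y' g g' (Over.OverMorphism.ext hw))
  have hF : ∀ i, (W i).ι ≫ 𝒰.glueMorphisms (fun i => (f i).left) hf = (f i).left :=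
    𝒰.ι_glueMorphisms _ hf
  refine ⟨Over.homMk (𝒰.glueMorphisms (fun i => (f i).left) hf) ?_, fun i =>
    Over.OverMorphism.ext (hF i)⟩
  refine Scheme.hom_ext_of_forall _ _ fun y => ?_
  obtain ⟨i, hi⟩ := hW y
  refine ⟨W i, hi, ?_⟩
  rw [← Category.assoc, hF]
  exact Over.w (f i)

end OverGluing

/-! ### The action of the torus on a torus embedding -/

section TorusAction

open MonoidalCategory CartesianMonoidalCategory
open scoped MonObj

variable {𝓡 K X : Type u} [CommRing 𝓡] [Field K] [Algebra 𝓡 K] [AddCommGroup X] {s : 𝓡}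
  {Δ : Set (PointedCone ℝ (NR X))} {P Y Z : Over (Spec (CommRingCat.of 𝓡))}
  (E : TorusEmbedding s K Δ P)

include E in
lemma TorusEmbedding.hom_ext (p : Y ⟶ P) {q q' : Y ⟶ Z}
    (h : ∀ (Y' : Over (Spec (CommRingCat.of 𝓡))) (g : Y' ⟶ Y) (σ : Δ)
      (u : Y' ⟶ specOver 𝓡 (coneAlgebra 𝓡 s K σ.1)), u ≫ E.chart σ = g ≫ p → g ≫ q = g ≫ q') :
    q = q' := by
  refine eq_of_openOverι fun y => ?_
  obtain ⟨σ, hσ⟩ := E.cover (p.left y)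
  have := E.isOpenImmersion σ
  let W : Y.left.Opens := p.left ⁻¹ᵁ (E.chart σ).left.opensRange
  obtain ⟨u, hu⟩ := exists_lift_of_isOpenImmersion (E.chart σ) (E.isOpenImmersion σ)
    (openOverι W ≫ p) (by
      rw [range_comp_left, range_openOverι]
      rintro _ ⟨z, hz, rfl⟩
      exact hz)
  exact ⟨W, hσ, h _ _ σ u hu⟩

variable (hs : algebraMap 𝓡 K s ≠ 0) (hΔ : ∀ σ τ : Δ, ∃ ρ : Δ, ρ.1 = σ.1 ⊓ τ.1)

/-- The product of a point of the torus and a point of a chart. -/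
abbrev mulChart (σ : Δ) (t : Y ⟶ splitTorus 𝓡 X) (u : Y ⟶ specOver 𝓡 (coneAlgebra 𝓡 s K σ.1)) :
    Y ⟶ specOver 𝓡 (coneAlgebra 𝓡 s K σ.1) :=
  mulPt (isHomogeneousSubalgebra_coneAlgebra hs σ.1) t u

include hΔ in
lemma mulChart_chart_eq {σ τ : Δ} (t : Y ⟶ splitTorus 𝓡 X)
    {u : Y ⟶ specOver 𝓡 (coneAlgebra 𝓡 s K σ.1)} {v : Y ⟶ specOver 𝓡 (coneAlgebra 𝓡 s K τ.1)}
    (h : u ≫ E.chart σ = v ≫ E.chart τ) :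
    mulChart hs σ t u ≫ E.chart σ = mulChart hs τ t v ≫ E.chart τ := by
  obtain ⟨ρ, hρ⟩ := hΔ σ τ
  obtain ⟨w, hw⟩ := exists_lift_of_isOpenImmersion (E.chart ρ) (E.isOpenImmersion ρ)
    (u ≫ E.chart σ) (by
      rw [← E.inter σ τ ρ hρ]
      refine Set.subset_inter ?_ ?_
      · rw [range_comp_left]; exact Set.image_subset_range _ _
      · rw [h, range_comp_left]; exact Set.image_subset_range _ _)
  have hσ : ρ.1 ≤ σ.1 := hρ.le.trans inf_le_left
  have hτ : ρ.1 ≤ τ.1 := hρ.le.trans inf_le_right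
  have hu : u = w ≫ specOverMap (Subalgebra.inclusion (coneAlgebra_anti 𝓡 s hσ)) :=
    eq_of_comp_isOpenImmersion _ (E.isOpenImmersion σ) (by
      rw [Category.assoc, E.restrict σ ρ hσ, hw])
  have hv : v = w ≫ specOverMap (Subalgebra.inclusion (coneAlgebra_anti 𝓡 s hτ)) :=
    eq_of_comp_isOpenImmersion _ (E.isOpenImmersion τ) (by
      rw [Category.assoc, E.restrict τ ρ hτ, hw, h])
  rw [hu, hv, mulChart, mulChart, ← mulPt_inclusion _ (isHomogeneousSubalgebra_coneAlgebra hs ρ.1),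
    ← mulPt_inclusion _ (isHomogeneousSubalgebra_coneAlgebra hs ρ.1), Category.assoc,
    Category.assoc, E.restrict σ ρ hσ, E.restrict τ ρ hτ]

include hΔ in
lemma exists_torusAct : ∃ act : splitTorus 𝓡 X ⊗ P ⟶ P,
    ∀ (Y : Over (Spec (CommRingCat.of 𝓡))) (t : Y ⟶ splitTorus 𝓡 X) (σ : Δ)
      (u : Y ⟶ specOver 𝓡 (coneAlgebra 𝓡 s K σ.1)),
      lift t (u ≫ E.chart σ) ≫ act = mulChart hs σ t u ≫ E.chart σ := by
  have := E.isOpenImmersion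
  let pr := snd (splitTorus 𝓡 X) P
  let W : Δ → (splitTorus 𝓡 X ⊗ P).left.Opens := fun σ => pr.left ⁻¹ᵁ (E.chart σ).left.opensRange
  choose u hu using fun σ => exists_lift_of_isOpenImmersion (E.chart σ) (E.isOpenImmersion σ)
    (openOverι (W σ) ≫ pr) (by
      rw [range_comp_left, range_openOverι]
      rintro _ ⟨z, hz, rfl⟩
      exact hz)
  obtain ⟨act, hact⟩ := exists_glue_openOver W (fun y => E.cover (pr.left y))
    (fun σ => mulChart hs σ (openOverι (W σ) ≫ fst _ _) (u σ) ≫ E.chart σ) (by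
      intro σ τ Y' g g' hg
      rw [← Category.assoc, ← Category.assoc, mulChart, mulChart, comp_mulPt, comp_mulPt,
        ← Category.assoc, hg, Category.assoc]
      refine mulChart_chart_eq E hs hΔ _ ?_
      rw [Category.assoc, Category.assoc, hu, hu, ← Category.assoc, hg, Category.assoc])
  refine ⟨act, fun Y t σ v => ?_⟩
  obtain ⟨g, hg⟩ := exists_lift_of_isOpenImmersion (openOverι (W σ)) (isOpenImmersion_openOverι _)
    (lift t (v ≫ E.chart σ)) (by
      rw [range_openOverι]
      rintro _ ⟨y, rfl⟩
      change (lift t (v ≫ E.chart σ) ≫ pr).left y ∈ Set.range _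
      rw [lift_snd]
      exact ⟨v.left y, rfl⟩)
  have hv : g ≫ u σ = v := eq_of_comp_isOpenImmersion _ (E.isOpenImmersion σ) (by
    rw [Category.assoc, hu, ← Category.assoc, hg, lift_snd])
  rw [← hg, Category.assoc, hact, ← Category.assoc, mulChart, comp_mulPt, hv, ← Category.assoc, hg,
    lift_fst]

/-- The action of the torus on a torus embedding. -/
def torusAct : splitTorus 𝓡 X ⊗ P ⟶ P := (exists_torusAct E hs hΔ).choose

lemma lift_torusAct (t : Y ⟶ splitTorus 𝓡 X) {σ : Δ}
    (u : Y ⟶ specOver 𝓡 (coneAlgebra 𝓡 s K σ.1)) :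
    lift t (u ≫ E.chart σ) ≫ torusAct E hs hΔ = mulChart hs σ t u ≫ E.chart σ :=
  (exists_torusAct E hs hΔ).choose_spec Y t σ u

/-- The torus acts on a torus embedding. -/
def torusAction : GroupAction (splitTorus 𝓡 X) P where
  act := torusAct E hs hΔ
  one_act := by
    refine E.hom_ext (snd (𝟙_ _) P) fun Y g σ u hu => ?_
    have h1 : g ≫ η[splitTorus 𝓡 X] ▷ P =
        lift (toUnit Y ≫ η[splitTorus 𝓡 X]) (u ≫ E.chart σ) := by
      refine CartesianMonoidalCategory.hom_ext _ _ ?_ ?_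
      · rw [Category.assoc, whiskerRight_fst, lift_fst, ← Category.assoc]
        congr 1
        exact toUnit_unique _ _
      · rw [Category.assoc, whiskerRight_snd, lift_snd, hu]
    rw [← Category.assoc, h1, lift_torusAct, mulChart, one_mulPt, hu, leftUnitor_hom]
  mul_act := by
    refine E.hom_ext (snd _ _ ≫ snd _ _) fun Y g σ u hu => ?_
    have h1 : g ≫ (α_ _ _ P).inv ≫ μ[splitTorus 𝓡 X] ▷ P =
        lift (lift (g ≫ fst _ _) (g ≫ snd _ _ ≫ fst _ _) ≫ μ[splitTorus 𝓡 X])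
          (u ≫ E.chart σ) := by
      refine CartesianMonoidalCategory.hom_ext _ _ ?_ ?_
      · rw [Category.assoc, Category.assoc, whiskerRight_fst, lift_fst, ← Category.assoc,
          ← Category.assoc]
        congr 1
        refine CartesianMonoidalCategory.hom_ext _ _ ?_ ?_ <;> simp
      · rw [Category.assoc, Category.assoc, whiskerRight_snd, lift_snd, hu]
        simp
    have h2 : g ≫ splitTorus 𝓡 X ◁ torusAct E hs hΔ = lift (g ≫ fst _ _)
        (mulChart hs σ (g ≫ snd _ _ ≫ fst _ _) u ≫ E.chart σ) := by
      refine CartesianMonoidalCategory.hom_ext _ _ ?_ ?_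
      · rw [Category.assoc, whiskerLeft_fst, lift_fst]
      · rw [Category.assoc, whiskerLeft_snd, lift_snd, ← lift_torusAct E hs hΔ, ← Category.assoc]
        congr 1
        refine CartesianMonoidalCategory.hom_ext _ _ ?_ ?_
        · simp
        · rw [lift_snd, hu, Category.assoc]
    calc g ≫ (α_ _ _ P).inv ≫ μ[splitTorus 𝓡 X] ▷ P ≫ torusAct E hs hΔ
        = (g ≫ (α_ _ _ P).inv ≫ μ[splitTorus 𝓡 X] ▷ P) ≫ torusAct E hs hΔ := by
          simp only [Category.assoc]
      _ = (g ≫ splitTorus 𝓡 X ◁ torusAct E hs hΔ) ≫ torusAct E hs hΔ := by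
          rw [h1, lift_torusAct, h2, lift_torusAct, mulChart, mul_mulPt]
      _ = _ := Category.assoc _ _ _

end TorusAction

end

end MaxDegeneration

namespace MaxDegeneration

noncomputable section

/-! ### Group actions -/

section GroupActions

open MonoidalCategory CartesianMonoidalCategory
open scoped MonObj

variable {S : Scheme.{u}} {G G' P Y : Over S} [MonObj G] [MonObj G']

/-- The action obtained from a homomorphism of monoid schemes. -/
def GroupAction.comap (ρ : GroupAction G P) (φ : G' ⟶ G) (hη : η[G'] ≫ φ = η[G])
    (hμ : μ[G'] ≫ φ = (φ ⊗ₘ φ) ≫ μ[G]) : GroupAction G' P where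
  act := φ ▷ P ≫ ρ.act
  one_act := by
    rw [← comp_whiskerRight_assoc, hη, ρ.one_act]
  mul_act := by
    have h1 : (α_ G' G' P).inv ≫ (μ[G'] ≫ φ) ▷ P =
        (φ ⊗ₘ φ ▷ P) ≫ (α_ G G P).inv ≫ μ[G] ▷ P := by
      rw [hμ]
      refine CartesianMonoidalCategory.hom_ext _ _ ?_ ?_
      · have e : (α_ G' G' P).inv ≫ fst _ _ ≫ (φ ⊗ₘ φ) =
            (φ ⊗ₘ φ ▷ P) ≫ (α_ G G P).inv ≫ fst _ _ := by
          refine CartesianMonoidalCategory.hom_ext _ _ ?_ ?_ <;> simp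
        simpa only [Category.assoc, whiskerRight_fst] using congrArg (· ≫ μ[G]) e
      · simp
    have h2 : G' ◁ (φ ▷ P ≫ ρ.act) ≫ φ ▷ P = (φ ⊗ₘ φ ▷ P) ≫ G ◁ ρ.act := by
      refine CartesianMonoidalCategory.hom_ext _ _ ?_ ?_ <;> simp
    calc (α_ G' G' P).inv ≫ μ[G'] ▷ P ≫ φ ▷ P ≫ ρ.act
        = ((α_ G' G' P).inv ≫ (μ[G'] ≫ φ) ▷ P) ≫ ρ.act := by
          rw [comp_whiskerRight]; simp only [Category.assoc]
      _ = (φ ⊗ₘ φ ▷ P) ≫ (α_ G G P).inv ≫ μ[G] ▷ P ≫ ρ.act := by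
          rw [h1]; simp only [Category.assoc]
      _ = (G' ◁ (φ ▷ P ≫ ρ.act) ≫ φ ▷ P) ≫ ρ.act := by
          rw [ρ.mul_act, h2, Category.assoc]
      _ = _ := Category.assoc _ _ _

lemma GroupAction.lift_one_act (ρ : GroupAction G P) (p : Y ⟶ P) :
    lift (toUnit Y ≫ η[G]) p ≫ ρ.act = p := by
  have h : lift (toUnit Y ≫ η[G]) p = lift (toUnit Y) p ≫ η[G] ▷ P := by
    refine CartesianMonoidalCategory.hom_ext _ _ ?_ ?_ <;> simp
  rw [h, Category.assoc, ρ.one_act, leftUnitor_hom, lift_snd]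

lemma GroupAction.lift_mul_act (ρ : GroupAction G P) (t t' : Y ⟶ G) (p : Y ⟶ P) :
    lift (lift t t' ≫ μ[G]) p ≫ ρ.act = lift t (lift t' p ≫ ρ.act) ≫ ρ.act := by
  have h1 : lift (lift t t' ≫ μ[G]) p = lift t (lift t' p) ≫ (α_ G G P).inv ≫ μ[G] ▷ P := by
    refine CartesianMonoidalCategory.hom_ext _ _ ?_ ?_
    · have e : lift t t' = lift t (lift t' p) ≫ (α_ G G P).inv ≫ fst _ _ := by
        refine CartesianMonoidalCategory.hom_ext _ _ ?_ ?_ <;> simp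
      simpa only [Category.assoc, whiskerRight_fst, lift_fst] using congrArg (· ≫ μ[G]) e
    · simp
  have h2 : lift t (lift t' p ≫ ρ.act) = lift t (lift t' p) ≫ G ◁ ρ.act := by
    refine CartesianMonoidalCategory.hom_ext _ _ ?_ ?_ <;> simp
  rw [h1, h2]
  simp only [Category.assoc]
  rw [ρ.mul_act]

end GroupActions

/-! ### Split tori -/

section SplitTori

open MonoidalCategory CartesianMonoidalCategory
open scoped MonObj

variable {𝓡 : Type u} [CommRing 𝓡] {Λ Λ' : Type u} [AddCommGroup Λ] [AddCommGroup Λ']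
  {Y P : Over (Spec (CommRingCat.of 𝓡))}

lemma torus_hom_ext {t t' : Y ⟶ splitTorus 𝓡 Λ}
    (h : ∀ x, funOf t (AddMonoidAlgebra.single x 1) = funOf t' (AddMonoidAlgebra.single x 1)) :
    t = t' := by
  refine funOf_injective fun f => ?_
  induction f using AddMonoidAlgebra.induction_linear with
  | zero => rw [map_zero, map_zero]
  | add f g hf hg => rw [map_add, map_add, hf, hg]
  | single x r =>
    have : (AddMonoidAlgebra.single x r : AddMonoidAlgebra 𝓡 Λ) =
        algebraMap 𝓡 (AddMonoidAlgebra 𝓡 Λ) r * AddMonoidAlgebra.single x 1 := by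
      rw [← Algebra.smul_def, AddMonoidAlgebra.smul_single, smul_eq_mul, mul_one]
    rw [this, map_mul, map_mul, funOf_algebraMap, funOf_algebraMap, h]

lemma funOf_comp_splitTorusMap (t : Y ⟶ splitTorus 𝓡 Λ') (φ : Λ →+ Λ') (x : Λ) :
    funOf (t ≫ splitTorusMap 𝓡 φ) (AddMonoidAlgebra.single x 1) =
      funOf t (AddMonoidAlgebra.single (φ x) 1) := by
  rw [funOf_specOverMap]
  congr 1
  exact AddMonoidAlgebra.mapDomain_single

lemma funOf_single_zero (t : Y ⟶ splitTorus 𝓡 Λ) :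
    funOf t (AddMonoidAlgebra.single (0 : Λ) 1) = 1 := map_one _

lemma funOf_single_add (t : Y ⟶ splitTorus 𝓡 Λ) (x y : Λ) :
    funOf t (AddMonoidAlgebra.single (x + y) 1) =
      funOf t (AddMonoidAlgebra.single x 1) * funOf t (AddMonoidAlgebra.single y 1) := by
  rw [← map_mul, AddMonoidAlgebra.single_mul_single, mul_one]

lemma one_splitTorusMap (φ : Λ →+ Λ') :
    η[splitTorus 𝓡 Λ'] ≫ splitTorusMap 𝓡 φ = η[splitTorus 𝓡 Λ] := by
  have h : ∀ (M : Type u) [AddCommGroup M],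
      η[splitTorus 𝓡 M] = toUnit _ ≫ η[splitTorus 𝓡 M] := fun M _ => by
    rw [toUnit_unique (toUnit (𝟙_ _)) (𝟙 _), Category.id_comp]
  refine torus_hom_ext fun x => ?_
  rw [funOf_comp_splitTorusMap, h Λ, h Λ', funOf_one_single, funOf_one_single]

lemma mul_splitTorusMap (φ : Λ →+ Λ') :
    μ[splitTorus 𝓡 Λ'] ≫ splitTorusMap 𝓡 φ =
      (splitTorusMap 𝓡 φ ⊗ₘ splitTorusMap 𝓡 φ) ≫ μ[splitTorus 𝓡 Λ] := by
  have h1 : μ[splitTorus 𝓡 Λ'] = lift (fst _ _) (snd _ _) ≫ μ[splitTorus 𝓡 Λ'] := by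
    rw [lift_fst_snd, Category.id_comp]
  have h2 : splitTorusMap 𝓡 φ ⊗ₘ splitTorusMap 𝓡 φ =
      lift (fst _ _ ≫ splitTorusMap 𝓡 φ) (snd _ _ ≫ splitTorusMap 𝓡 φ) := by
    refine CartesianMonoidalCategory.hom_ext _ _ ?_ ?_ <;> simp
  refine torus_hom_ext fun x => ?_
  rw [funOf_comp_splitTorusMap, h1, h2, funOf_mul_single, funOf_mul_single,
    funOf_comp_splitTorusMap, funOf_comp_splitTorusMap]

/-- The inverse of a point of a torus. -/
def invPt (t : Y ⟶ splitTorus 𝓡 Λ) : Y ⟶ splitTorus 𝓡 Λ :=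
  t ≫ splitTorusMap 𝓡 (-AddMonoidHom.id Λ)

lemma lift_invPt_mul (t : Y ⟶ splitTorus 𝓡 Λ) :
    lift (invPt t) t ≫ μ[splitTorus 𝓡 Λ] = toUnit Y ≫ η[splitTorus 𝓡 Λ] := by
  refine torus_hom_ext fun x => ?_
  rw [funOf_mul_single, funOf_one_single, invPt, funOf_comp_splitTorusMap, ← funOf_single_add]
  simp [funOf_single_zero]

lemma GroupAction.lift_invPt_act (ρ : GroupAction (splitTorus 𝓡 Λ) P) (t : Y ⟶ splitTorus 𝓡 Λ)
    (p : Y ⟶ P) : lift (invPt t) (lift t p ≫ ρ.act) ≫ ρ.act = p := by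
  rw [← ρ.lift_mul_act, lift_invPt_mul, ρ.lift_one_act]

end SplitTori

open MonoidalCategory CartesianMonoidalCategory in
lemma lift_torusAct_of_eq {𝓡 K X : Type u} [CommRing 𝓡] [Field K] [Algebra 𝓡 K] [AddCommGroup X]
    {s : 𝓡} {Δ : Set (PointedCone ℝ (NR X))} {P Y : Over (Spec (CommRingCat.of 𝓡))}
    (E : TorusEmbedding s K Δ P) (hs : algebraMap 𝓡 K s ≠ 0)
    (hΔ : ∀ σ τ : Δ, ∃ ρ : Δ, ρ.1 = σ.1 ⊓ τ.1) (σ : Δ) {A : Subalgebra 𝓡 (AddMonoidAlgebra K X)}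
    (hA : IsHomogeneousSubalgebra A) (h : coneAlgebra 𝓡 s K σ.1 = A) {j : specOver 𝓡 A ⟶ P}
    (hj : specOverMap (Subalgebra.inclusion h.le) ≫ E.chart σ = j) (t : Y ⟶ splitTorus 𝓡 X)
    (u : Y ⟶ specOver 𝓡 A) :
    lift t (u ≫ j) ≫ torusAct E hs hΔ = mulPt hA t u ≫ j := by
  subst hj
  rw [← Category.assoc, lift_torusAct, ← Category.assoc, mulChart, mulPt_inclusion]

namespace DegenerationData

open MonoidalCategory CartesianMonoidalCategory
open scoped MonObj

variable {𝓡 : Type u} [CommRing 𝓡] [IsDomain 𝓡] [IsDiscreteValuationRing 𝓡]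
  {K : Type u} [Field K] [Algebra 𝓡 K] [IsFractionRing 𝓡 K] {X : Type u} [AddCommGroup X]
  (D : DegenerationData 𝓡 K X) {s : 𝓡} [Module.Free ℤ X] [Module.Finite ℤ X] [Nontrivial X]
  {Y : Over (Spec (CommRingCat.of 𝓡))}

lemma fan_inter (σ τ : D.fan) : ∃ ρ : D.fan, ρ.1 = σ.1 ⊓ τ.1 :=
  ⟨⟨_, D.isFan_fan.face _ σ.2 _ (D.isFan_fan.inter _ σ.2 _ τ.2).1⟩, rfl⟩

lemma isHomogeneousSubalgebra_vertexAlgebra (hs : Irreducible s) (c : X) :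
    IsHomogeneousSubalgebra (D.vertexAlgebra s c) := by
  rw [← D.vertexAlgebra_eq]
  exact isHomogeneousSubalgebra_coneAlgebra (algebraMap_uniformizer_ne_zero K hs) _

/-- The action of the torus `T` on `P̃`. -/
def action (hs : Irreducible s) : GroupAction (splitTorus 𝓡 X) (D.P s) :=
  torusAction (D.torusEmbedding hs) (algebraMap_uniformizer_ne_zero K hs) D.fan_inter

lemma lift_action (hs : Irreducible s) (c : X) (t : Y ⟶ splitTorus 𝓡 X)
    (u : Y ⟶ specOver 𝓡 (D.vertexAlgebra s c)) :
    lift t (u ≫ D.vertexImm hs c) ≫ (D.action hs).act =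
      mulPt (D.isHomogeneousSubalgebra_vertexAlgebra hs c) t u ≫ D.vertexImm hs c := by
  exact lift_torusAct_of_eq (D.torusEmbedding hs) _ D.fan_inter ⟨D.coneAt c, D.coneAt_mem_fan c⟩ _
    (D.vertexAlgebra_eq c) (D.vertexImm_eq_fanChart hs c) t u

lemma isGivenByGrading_action (hs : Irreducible s) :
    D.IsGivenByGrading s (D.vertexImm hs) (D.action hs) := by
  intro c
  refine ⟨mulPt (D.isHomogeneousSubalgebra_vertexAlgebra hs c) (fst _ _) (snd _ _), ?_,
    fun x f hf => funOf_mulPt _ _ _ hf⟩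
  rw [← D.lift_action]
  congr 1

/-- The action of the torus `T × 𝔾_m` on `P̃`. -/
def bigAction (hs : Irreducible s) : GroupAction (splitTorus 𝓡 (X × ℤ)) (D.P s) :=
  (D.action hs).comap (splitTorusMap 𝓡 (AddMonoidHom.inl X ℤ)) (one_splitTorusMap _)
    (mul_splitTorusMap _)

lemma lift_bigAction (hs : Irreducible s) (c : X) (t : Y ⟶ splitTorus 𝓡 (X × ℤ))
    (u : Y ⟶ specOver 𝓡 (D.vertexAlgebra s c)) :
    lift t (u ≫ D.vertexImm hs c) ≫ (D.bigAction hs).act =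
      mulPt (D.isHomogeneousSubalgebra_vertexAlgebra hs c)
        (t ≫ splitTorusMap 𝓡 (AddMonoidHom.inl X ℤ)) u ≫ D.vertexImm hs c := by
  rw [← D.lift_action]
  change lift t (u ≫ D.vertexImm hs c) ≫ _ ▷ _ ≫ _ = _
  rw [lift_whiskerRight_assoc]

lemma exists_lift_vertexImm (hs : Irreducible s) (c : X) (p : Y ⟶ D.P s)
    (h : ∀ y, p.left y ∈ D.vertexOpen s c) : ∃ u, u ≫ D.vertexImm hs c = p :=
  exists_lift_of_isOpenImmersion _ (D.isOpenImmersion_vertexImm hs c) p (by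
    rw [range_vertexImm]
    rintro _ ⟨y, rfl⟩
    exact h y)

lemma comp_vertexImm_mem (hs : Irreducible s) (c : X)
    (u : Y ⟶ specOver 𝓡 (D.vertexAlgebra s c)) (y : Y.left) :
    (u ≫ D.vertexImm hs c).left y ∈ D.vertexOpen s c := by
  have : (u ≫ D.vertexImm hs c).left y ∈ (D.vertexOpen s c : Set (D.P s).left) := by
    rw [← D.range_vertexImm hs]
    exact ⟨u.left y, rfl⟩
  exact this

lemma bigAction_preimage_vertexOpen (hs : Irreducible s) (c : X) :
    (D.bigAction hs).act.left ⁻¹ᵁ D.vertexOpen s c =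
      (snd (splitTorus 𝓡 (X × ℤ)) (D.P s)).left ⁻¹ᵁ D.vertexOpen s c := by
  let a := (D.bigAction hs).act
  let p := snd (splitTorus 𝓡 (X × ℤ)) (D.P s)
  refine le_antisymm (fun y hy => ?_) fun y hy => ?_
  · let W := a.left ⁻¹ᵁ D.vertexOpen s c
    obtain ⟨u, hu⟩ := D.exists_lift_vertexImm hs c (openOverι W ≫ a) fun z => z.2
    have h := (D.bigAction hs).lift_invPt_act (openOverι W ≫ fst _ _) (openOverι W ≫ p)
    have h1 : lift (openOverι W ≫ fst _ _) (openOverι W ≫ p) = openOverι W := by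
      rw [← comp_lift, lift_fst_snd, Category.comp_id]
    rw [h1] at h
    change lift _ (openOverι W ≫ a) ≫ _ = _ at h
    rw [← hu, lift_bigAction] at h
    have h2 := D.comp_vertexImm_mem hs c (mulPt (D.isHomogeneousSubalgebra_vertexAlgebra hs c)
      (invPt (openOverι W ≫ fst _ _) ≫ splitTorusMap 𝓡 (AddMonoidHom.inl X ℤ)) u)
      (show W from ⟨y, hy⟩)
    rw [h] at h2
    exact h2
  · let W := p.left ⁻¹ᵁ D.vertexOpen s c
    obtain ⟨u, hu⟩ := D.exists_lift_vertexImm hs c (openOverι W ≫ p) fun z => z.2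
    have h1 : openOverι W = lift (openOverι W ≫ fst _ _) (openOverι W ≫ p) := by
      rw [← comp_lift, lift_fst_snd, Category.comp_id]
    have h2 : openOverι W ≫ a = _ ≫ a := congrArg (· ≫ a) h1
    rw [← hu, lift_bigAction] at h2
    have h3 := D.comp_vertexImm_mem hs c (mulPt (D.isHomogeneousSubalgebra_vertexAlgebra hs c)
      ((openOverι W ≫ fst _ _) ≫ splitTorusMap 𝓡 (AddMonoidHom.inl X ℤ)) u)
      (show W from ⟨y, hy⟩)
    rw [← h2] at h3
    exact h3

end DegenerationData

end

end MaxDegeneration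

namespace MaxDegeneration

noncomputable section

section PullbackSections

open TopologicalSpace Opposite

variable {Q W Y Y' Z : Scheme.{u}}

/-! ### Pullbacks of global sections -/

lemma app_unit_comp (g : W ⟶ Z) (M : Z.Modules) {N : W.Modules}
    (φ : (Scheme.Modules.pullback g).obj M ⟶ N) (t : Γ(M, ⊤)) :
    (((Scheme.Modules.pullbackPushforwardAdjunction g).homEquiv M N φ).app ⊤ t : Γ(N, ⊤)) =
      φ.app ⊤ (pullbackSection g M t) := by
  rw [Adjunction.homEquiv_unit]
  rfl

lemma map_pullbackSection (g : W ⟶ Z) {M N : Z.Modules} (φ : M ⟶ N) (t : Γ(M, ⊤)) :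
    ((Scheme.Modules.pullback g).map φ).app ⊤ (pullbackSection g M t) =
      pullbackSection g N (φ.app ⊤ t) := by
  have h := (Scheme.Modules.pullbackPushforwardAdjunction g).unit.naturality φ
  exact (ConcreteCategory.congr_hom (congrArg (fun ψ => Scheme.Modules.Hom.app ψ ⊤) h) t).symm

lemma pullbackSection_smul (g : W ⟶ Z) (M : Z.Modules) (f : Γ(Z, ⊤)) (t : Γ(M, ⊤)) :
    pullbackSection g M (f • t) = g.appTop f • pullbackSection g M t :=
  Scheme.Modules.Hom.app_smul ((Scheme.Modules.pullbackPushforwardAdjunction g).unit.app M) f t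

lemma appLE_smul_pullbackSection (g : W ⟶ Z) (M : Z.Modules) {V : Z.Opens} {O : W.Opens}
    (hO : O ≤ g ⁻¹ᵁ V) (f : Γ(Z, V)) {t t' : Γ(M, ⊤)}
    (h : f • res M (le_top : V ≤ ⊤) t = res M le_top t') :
    g.appLE V O hO f • res _ (le_top : O ≤ ⊤) (pullbackSection g M t) =
      res _ le_top (pullbackSection g M t') := by
  let η : M ⟶ (Scheme.Modules.pushforward g).obj ((Scheme.Modules.pullback g).obj M) :=
    (Scheme.Modules.pullbackPushforwardAdjunction g).unit.app M
  have h1 := congrArg (η.app V) h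
  rw [Scheme.Modules.Hom.app_smul, app_res, app_res] at h1
  have h2 := congrArg (res ((Scheme.Modules.pullback g).obj M) hO) h1
  change res ((Scheme.Modules.pullback g).obj M) hO (g.app V f •
    res ((Scheme.Modules.pullback g).obj M) le_top (pullbackSection g M t)) =
    res ((Scheme.Modules.pullback g).obj M) hO
    (res ((Scheme.Modules.pullback g).obj M) le_top (pullbackSection g M t')) at h2
  rw [res_smul, res_res, res_res] at h2
  exact h2

lemma pullbackComp_inv_pullbackSection (f : W ⟶ Y) (g : Y ⟶ Z) (M : Z.Modules) (t : Γ(M, ⊤)) :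
    ((Scheme.Modules.pullbackComp f g).inv.app M).app ⊤ (pullbackSection (f ≫ g) M t) =
      pullbackSection f _ (pullbackSection g M t) := by
  have h := unit_conjugateEquiv
    ((Scheme.Modules.pullbackPushforwardAdjunction g).comp
      (Scheme.Modules.pullbackPushforwardAdjunction f))
    (Scheme.Modules.pullbackPushforwardAdjunction (f ≫ g)) (Scheme.Modules.pullbackComp f g).inv M
  rw [Scheme.Modules.conjugateEquiv_pullbackComp_inv] at h
  exact (ConcreteCategory.congr_hom (congrArg (fun ψ => Scheme.Modules.Hom.app ψ ⊤) h) t).symm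

lemma pullbackComp_hom_pullbackSection (f : W ⟶ Y) (g : Y ⟶ Z) (M : Z.Modules) (t : Γ(M, ⊤)) :
    ((Scheme.Modules.pullbackComp f g).hom.app M).app ⊤
      (pullbackSection f _ (pullbackSection g M t)) = pullbackSection (f ≫ g) M t := by
  rw [← pullbackComp_inv_pullbackSection]
  exact ConcreteCategory.congr_hom (congrArg (fun ψ => Scheme.Modules.Hom.app ψ ⊤)
    ((Scheme.Modules.pullbackComp f g).inv_hom_id_app M)) _

lemma pullbackCongr_hom_pullbackSection {f g : W ⟶ Z} (h : f = g) (M : Z.Modules) (t : Γ(M, ⊤)) :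
    ((Scheme.Modules.pullbackCongr h).hom.app M).app ⊤ (pullbackSection f M t) =
      pullbackSection g M t := by
  subst h
  rfl

lemma pullbackComparison_pullbackSection (f : W ⟶ Y) (g : Y ⟶ Z) (f' : W ⟶ Y') (g' : Y' ⟶ Z)
    (h : f ≫ g = f' ≫ g') (M : Z.Modules) (t : Γ(M, ⊤)) :
    (pullbackComparison f g f' g' h M).app ⊤ (pullbackSection f _ (pullbackSection g M t)) =
      pullbackSection f' _ (pullbackSection g' M t) := by
  refine Eq.trans ?_ (pullbackComp_inv_pullbackSection f' g' M t)
  refine congrArg (((Scheme.Modules.pullbackComp f' g').inv.app M).app ⊤) ?_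
  refine Eq.trans ?_ (pullbackCongr_hom_pullbackSection h M t)
  exact congrArg (((Scheme.Modules.pullbackCongr h).hom.app M).app ⊤)
    (pullbackComp_hom_pullbackSection f g M t)

/-! ### Sheaves whose morphisms are determined on given global sections -/

/-- Morphisms out of `M` are determined by their values on the global sections `e`. -/
def Detects {J : Type*} (M : Z.Modules) (e : J → Γ(M, ⊤)) : Prop :=
  ∀ (N : Z.Modules) (φ ψ : M ⟶ N), (∀ j, φ.app ⊤ (e j) = ψ.app ⊤ (e j)) → φ = ψ

lemma Detects.pullback {J : Type*} {M : Z.Modules} {e : J → Γ(M, ⊤)} (he : Detects M e)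
    (g : W ⟶ Z) : Detects ((Scheme.Modules.pullback g).obj M)
      (fun j => pullbackSection g M (e j)) := by
  intro N φ ψ h
  refine ((Scheme.Modules.pullbackPushforwardAdjunction g).homEquiv M N).injective (he _ _ _ ?_)
  intro j
  exact (app_unit_comp g M φ (e j)).trans ((h j).trans (app_unit_comp g M ψ (e j)).symm)

lemma detects_of_isFrame {J : Type*} {M : Z.Modules} {e : J → Γ(M, ⊤)} (U : J → Z.Opens)
    (hU : ∀ z, ∃ i, z ∈ U i) (he : ∀ i, IsFrame M (U i) (res M le_top (e i))) : Detects M e := by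
  intro N φ ψ h
  ext V x
  refine eq_of_res_eq fun z hz => ?_
  obtain ⟨i, hi⟩ := hU z
  refine ⟨U i ⊓ V, inf_le_right, ⟨hi, hz⟩, ?_⟩
  obtain ⟨f, hf⟩ := ((he i).res (inf_le_left : U i ⊓ V ≤ U i)).exists (res M inf_le_right x)
  rw [← app_res, ← app_res, ← hf, Scheme.Modules.Hom.app_smul, Scheme.Modules.Hom.app_smul,
    res_res, app_res, app_res, h]

/-! ### Morphisms between pullbacks -/

/-- A morphism `a^* M → b^* M` that multiplies the pullbacks of the sections `e j` by functions
`k j`, when the sections `e j` differ from frames by functions `F i j` whose pullbacks are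
compatible with the `k j`. -/
lemma exists_pullback_hom (a b : Q ⟶ Z) {M : Z.Modules} {I : Type u} {J : Type*}
    (e : J → Γ(M, ⊤)) (ν : I → J) (U : I → Z.Opens) (hU : ∀ z, ∃ i, z ∈ U i)
    (he : ∀ i, IsFrame M (U i) (res M le_top (e (ν i)))) (k : J → Γ(Q, ⊤))
    (hab : ∀ i, a ⁻¹ᵁ U i ≤ b ⁻¹ᵁ U i)
    (hF : ∀ i j, ∃ F : Γ(Z, U i), F • res M (le_top : U i ≤ ⊤) (e (ν i)) = res M le_top (e j) ∧
      a.appLE (U i) (a ⁻¹ᵁ U i) le_rfl F * resF le_top (k (ν i)) =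
        resF le_top (k j) * b.appLE (U i) (a ⁻¹ᵁ U i) (hab i) F) :
    ∃ φ : (Scheme.Modules.pullback a).obj M ⟶ (Scheme.Modules.pullback b).obj M,
      ∀ j, φ.app ⊤ (pullbackSection a M (e j)) = k j • pullbackSection b M (e j) := by
  choose F hF hk using hF
  let N := (Scheme.Modules.pullback b).obj M
  let N' := (Scheme.Modules.pushforward a).obj N
  let m : J → Γ(N', ⊤) := fun j => (k j • pullbackSection b M (e j) : Γ(N, ⊤))
  have key : ∀ i j, F i j • res N' le_top (m (ν i)) = res N' (le_top : U i ≤ ⊤) (m j) := by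
    intro i j
    change a.app (U i) (F i j) • res N (le_top : a ⁻¹ᵁ U i ≤ ⊤)
      (k (ν i) • pullbackSection b M (e (ν i))) =
      res N (le_top : a ⁻¹ᵁ U i ≤ ⊤) (k j • pullbackSection b M (e j))
    rw [res_smul, res_smul, smul_smul, ← appLE_smul_pullbackSection b M (hab i) (F i j) (hF i j),
      smul_smul, ← hk, Scheme.Hom.appLE_eq_app]
  obtain ⟨φ, hφ⟩ := exists_hom_of_frames (M := M) (N := N') U hU _ he
    (fun i => res N' le_top (m (ν i))) (by
      intro i j f hf
      have h1 := congrArg (res M (inf_le_left : U i ⊓ U j ≤ U i)) (hF i (ν j))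
      have h2 := congrArg (res N' (inf_le_left : U i ⊓ U j ≤ U i)) (key i (ν j))
      rw [res_smul, res_res] at h1 h2
      rw [res_res] at h1 h2 hf ⊢
      rw [res_res] at hf ⊢
      rw [← h2, ((he i).res inf_le_left).ext (f := f) (g := resF inf_le_left (F i (ν j)))
        (by rw [res_res, hf, h1])])
  refine ⟨((Scheme.Modules.pullbackPushforwardAdjunction a).homEquiv M N).symm φ, fun j => ?_⟩
  rw [← app_unit_comp, Equiv.apply_symm_apply]
  change φ.app ⊤ (e j) = m j
  refine eq_of_res_eq fun z _ => ?_
  obtain ⟨i, hi⟩ := hU z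
  refine ⟨U i, le_top, hi, ?_⟩
  rw [← app_res, ← hF i j, Scheme.Modules.Hom.app_smul, hφ, key]

end PullbackSections

end

end MaxDegeneration

namespace MaxDegeneration

noncomputable section

open MonoidalCategory CartesianMonoidalCategory
open scoped MonObj

/-! ### Functions on the standard open subsets of `Proj` -/

lemma appLE_apply_comp {X Y Z : Scheme.{u}} (f : X ⟶ Y) (g : Y ⟶ Z) {U : Z.Opens} {V : Y.Opens}
    {W : X.Opens} (h : V ≤ g ⁻¹ᵁ U) (h' : W ≤ f ⁻¹ᵁ V) (h'' : W ≤ (f ≫ g) ⁻¹ᵁ U) (F : Γ(Z, U)) :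
    (f ≫ g).appLE U W h'' F = f.appLE V W h' (g.appLE U V h F) :=
  (ConcreteCategory.congr_hom (Scheme.Hom.appLE_comp_appLE f g U V W h h') F).symm

lemma appLE_congr_hom {X Y : Scheme.{u}} {f g : X ⟶ Y} (h : f = g) {U : Y.Opens} {W : X.Opens}
    (hf : W ≤ f ⁻¹ᵁ U) (hg : W ≤ g ⁻¹ᵁ U) (F : Γ(Y, U)) : f.appLE U W hf F = g.appLE U W hg F := by
  subst h; rfl

lemma appLE_top_top {X Y : Scheme.{u}} (f : X ⟶ Y) (h : (⊤ : X.Opens) ≤ f ⁻¹ᵁ ⊤) (F : Γ(Y, ⊤)) :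
    f.appLE ⊤ ⊤ h F = f.appTop F :=
  ConcreteCategory.congr_hom (Scheme.Hom.appLE_eq_app (f := f) (U := ⊤)) F

lemma appLE_ι_injective {Y : Scheme.{u}} (O : Y.Opens) (h : (⊤ : O.toScheme.Opens) ≤ O.ι ⁻¹ᵁ O)
    {F G : Γ(Y, O)} (hFG : O.ι.appLE O ⊤ h F = O.ι.appLE O ⊤ h G) : F = G := by
  have hι : O.ι.appLE O ⊤ h = O.topIso.inv := by
    rw [Scheme.Opens.ι_appLE, Scheme.Opens.topIso_inv]
    rfl
  rw [hι] at hFG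
  exact ((ConcreteCategory.bijective_of_isIso O.topIso.inv).1 hFG)

lemma appLE_ι_resF {Y : Scheme.{u}} (O : Y.Opens) (h : (⊤ : O.toScheme.Opens) ≤ O.ι ⁻¹ᵁ O)
    (F : Γ(Y, ⊤)) : O.ι.appLE O ⊤ h (resF le_top F) = O.ι.appTop F := by
  have := ConcreteCategory.congr_hom
    (Scheme.Hom.map_appLE O.ι h (homOfLE (le_top : O ≤ ⊤)).op) F
  exact this.trans (appLE_top_top _ _ _)

section Away

variable {A : Type u} {σ : Type*} [CommRing A] [SetLike σ A] [AddSubgroupClass σ A]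
  (𝒜 : ℕ → σ) [GradedRing 𝒜] {f : A} {m : ℕ}

lemma awayι_appLE (hf : f ∈ 𝒜 m) (hm : 0 < m) (h : ⊤ ≤ Proj.awayι 𝒜 f hf hm ⁻¹ᵁ Proj.basicOpen 𝒜 f)
    (z : HomogeneousLocalization.Away 𝒜 f) :
    (Proj.awayι 𝒜 f hf hm).appLE (Proj.basicOpen 𝒜 f) ⊤ h (Proj.awayToSection 𝒜 f z) =
      specFunction z := by
  let U := Proj.basicOpen 𝒜 f
  let i := Proj.basicOpenIsoSpec 𝒜 f hf hm
  have h1 : (⊤ : U.toScheme.Opens) ≤ U.ι ⁻¹ᵁ U := by simp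
  have h2 : i.hom.appTop (specFunction z) = U.ι.appLE U ⊤ h1 (Proj.awayToSection 𝒜 f z) := by
    have hι : U.ι.appLE U ⊤ h1 = U.topIso.inv := by
      rw [Scheme.Opens.ι_appLE, Scheme.Opens.topIso_inv]
      rfl
    rw [hι]
    have h3 := ConcreteCategory.congr_hom (Proj.basicOpenToSpec_app_top 𝒜 f) (specFunction z)
    refine h3.trans ?_
    have h4 := ConcreteCategory.congr_hom
      (Scheme.ΓSpecIso (CommRingCat.of (HomogeneousLocalization.Away 𝒜 f))).inv_hom_id z
    exact congrArg (fun w => U.topIso.inv (Proj.awayToSection 𝒜 f w)) h4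
  have h5 := appLE_apply_comp i.inv U.ι h1 (by simp) h (Proj.awayToSection 𝒜 f z)
  refine h5.trans ?_
  refine (congrArg (i.inv.appLE ⊤ ⊤ (by simp)) h2.symm).trans ?_
  refine (appLE_top_top i.inv _ _).trans ?_
  exact ConcreteCategory.congr_hom (congrArg Scheme.Hom.appTop i.inv_hom_id) (specFunction z)

lemma appLE_awayToSection (hf : f ∈ 𝒜 m) (hm : 0 < m) {B : Type u} [CommRing B]
    {e : HomogeneousLocalization.Away 𝒜 f →+* B} {g : Spec (CommRingCat.of B) ⟶ Proj 𝒜}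
    (hg : g = Spec.map (CommRingCat.ofHom e) ≫ Proj.awayι 𝒜 f hf hm)
    (h : ⊤ ≤ g ⁻¹ᵁ Proj.basicOpen 𝒜 f)
    {z : HomogeneousLocalization.Away 𝒜 f} {w : B} (hw : e z = w) :
    g.appLE (Proj.basicOpen 𝒜 f) ⊤ h (Proj.awayToSection 𝒜 f z) = specFunction w := by
  subst hg hw
  have hle : ⊤ ≤ Proj.awayι 𝒜 f hf hm ⁻¹ᵁ Proj.basicOpen 𝒜 f := fun x _ => by
    rw [← Proj.opensRange_awayι 𝒜 f hf hm]
    exact ⟨x, rfl⟩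
  refine (appLE_apply_comp (Spec.map (CommRingCat.ofHom e)) (Proj.awayι 𝒜 f hf hm) hle le_top
    h _).trans ?_
  refine (congrArg _ (awayι_appLE 𝒜 hf hm hle z)).trans ?_
  refine (appLE_top_top _ _ _).trans ?_
  exact appTop_specMap e z

lemma awayToSection_smul_sectionOn (hf : f ∈ 𝒜 1) {g : A} (hg : g ∈ 𝒜 1) :
    (Proj.awayToSection 𝒜 f (HomogeneousLocalization.Away.mk 𝒜 hf 1 g (by simpa using hg)) :
      Γ(Proj 𝒜, Proj.basicOpen 𝒜 f)) • SerreTwist.sectionOn (Proj.basicOpen 𝒜 f) f hf =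
      SerreTwist.sectionOn (Proj.basicOpen 𝒜 f) g hg := by
  refine SerreTwist.stalkVal_ext fun x => ?_
  rw [SerreTwist.stalkVal_smul, SerreTwist.stalkVal_sectionOn, SerreTwist.stalkVal_sectionOn]
  have h := ProjectiveSpectrum.Proj.awayToSection_apply 𝒜 f
    (HomogeneousLocalization.Away.mk 𝒜 hf 1 g (by simpa using hg)) x
  refine (congrArg (· * _) h).trans ?_
  rw [HomogeneousLocalization.Away.val_mk, Localization.mk_eq_mk', IsLocalization.map_mk']
  simp

end Away

namespace DegenerationData

variable {𝓡 : Type u} [CommRing 𝓡] [IsDomain 𝓡] [IsDiscreteValuationRing 𝓡]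
  {K : Type u} [Field K] [Algebra 𝓡 K] [IsFractionRing 𝓡 K] {X : Type u} [AddCommGroup X]
  (D : DegenerationData 𝓡 K X) {s : 𝓡} [Module.Free ℤ X] [Module.Finite ℤ X] [Nontrivial X]
  {Y : Over (Spec (CommRingCat.of 𝓡))}

/-! ### The sections of `L̃` on the charts -/

lemma isFrame_sectionL_zeta (c : X) : IsFrame (D.L s) (D.vertexOpen s c)
    (res _ le_top (D.sectionL s (D.zeta s c) (D.zeta_mem s c))) :=
  SerreTwist.isFrame_toSection (D.zeta_mem s c) le_rfl

/-- The function on `D₊(ζ_c)` given by an element of the homogeneous localization at `ζ_c`. -/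
def awayFunction (c : X) (z : HomogeneousLocalization.Away (D.grade s) (D.zeta s c)) :
    Γ((D.P s).left, D.vertexOpen s c) :=
  Proj.awayToSection (D.grade s) (D.zeta s c) z

lemma vertexImm_appLE (hs : Irreducible s) (c : X)
    (h : ⊤ ≤ (D.vertexImm hs c).left ⁻¹ᵁ D.vertexOpen s c)
    (z : HomogeneousLocalization.Away (D.grade s) (D.zeta s c)) :
    (D.vertexImm hs c).left.appLE (D.vertexOpen s c) ⊤ h (D.awayFunction c z) =
      specFunction (D.vertexEquiv hs c z) := by
  exact appLE_awayToSection (D.grade s) (D.zeta_mem s c) one_pos (D.vertexImm_left hs c) h rfl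

/-- The function `g / ζ_c` on `D₊(ζ_c)`. -/
lemma exists_vertexFunction (hs : Irreducible s) (c : X) {g : D.satAlgebra s}
    (hg : g ∈ D.grade s 1) : ∃ F : Γ((D.P s).left, D.vertexOpen s c),
      F • res (D.L s) (le_top : D.vertexOpen s c ≤ ⊤)
        (D.sectionL s (D.zeta s c) (D.zeta_mem s c)) = res (D.L s) le_top (D.sectionL s g hg) ∧
      ∀ (Y : Over (Spec (CommRingCat.of 𝓡))) (u : Y ⟶ specOver 𝓡 (D.vertexAlgebra s c))
        (h : ⊤ ≤ (u ≫ D.vertexImm hs c).left ⁻¹ᵁ D.vertexOpen s c),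
        (u ≫ D.vertexImm hs c).left.appLE (D.vertexOpen s c) ⊤ h F =
          funOf u ⟨D.vertexHom s c g, D.vertexHom_mem hs c g⟩ := by
  let z := HomogeneousLocalization.Away.mk (D.grade s) (D.zeta_mem s c) 1 g (by simpa using hg)
  refine ⟨D.awayFunction c z, awayToSection_smul_sectionOn (D.grade s) (D.zeta_mem s c) hg,
    fun Y u h => ?_⟩
  have hle : ⊤ ≤ (D.vertexImm hs c).left ⁻¹ᵁ D.vertexOpen s c := fun x _ =>
    D.comp_vertexImm_mem hs c (𝟙 _) x
  refine (appLE_apply_comp u.left (D.vertexImm hs c).left hle le_top h _).trans ?_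
  refine (congrArg _ (D.vertexImm_appLE hs c hle z)).trans ?_
  refine (appLE_top_top _ _ _).trans ?_
  rw [funOf_apply]
  congr 2
  exact Subtype.ext (D.vertexEquiv_mk hs c 1 g (by simpa using hg))

lemma support_vertexHom (c : X) {x : X} {g : AddMonoidAlgebra K (ℕ × X)}
    (hg : g.coeff.support ⊆ {(1, x)}) : (D.vertexHom s c g).coeff.support ⊆ {x - c} := by
  classical
  obtain ⟨k, rfl⟩ : ∃ k, g = AddMonoidAlgebra.single (1, x) k :=
    ⟨g.coeff (1, x), by
      ext p
      rw [AddMonoidAlgebra.coeff_single, Finsupp.single_apply]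
      split_ifs with h
      · rw [h]
      · exact Finsupp.notMem_support_iff.1 fun hp => h (Finset.mem_singleton.1 (hg hp)).symm⟩
  rw [vertexHom_single, one_smul, AddMonoidAlgebra.coeff_single]
  exact Finsupp.support_single_subset

/-- The torus acts on the function `g / ζ_c` through the character `x - c`, if `g` is homogeneous of
degree `(x, 1)`. -/
lemma bigAction_appLE (hs : Irreducible s) (c x : X) {g : D.satAlgebra s}
    (hx : (g : AddMonoidAlgebra K (ℕ × X)).coeff.support ⊆ {(1, x)})
    (F : Γ((D.P s).left, D.vertexOpen s c))
    (hF : ∀ (Y : Over (Spec (CommRingCat.of 𝓡))) (u : Y ⟶ specOver 𝓡 (D.vertexAlgebra s c))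
        (h : ⊤ ≤ (u ≫ D.vertexImm hs c).left ⁻¹ᵁ D.vertexOpen s c),
        (u ≫ D.vertexImm hs c).left.appLE (D.vertexOpen s c) ⊤ h F =
          funOf u ⟨D.vertexHom s c g, D.vertexHom_mem hs c g⟩)
    {O : (splitTorus 𝓡 (X × ℤ) ⊗ D.P s).left.Opens}
    (ha : O ≤ (D.bigAction hs).act.left ⁻¹ᵁ D.vertexOpen s c)
    (hp : O ≤ (snd (splitTorus 𝓡 (X × ℤ)) (D.P s)).left ⁻¹ᵁ D.vertexOpen s c) :
    (D.bigAction hs).act.left.appLE _ O ha F =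
      resF le_top (funOf (fst (splitTorus 𝓡 (X × ℤ)) (D.P s))
        (AddMonoidAlgebra.single (x - c, (0 : ℤ)) 1)) *
      (snd (splitTorus 𝓡 (X × ℤ)) (D.P s)).left.appLE _ O hp F := by
  have hO : (⊤ : O.toScheme.Opens) ≤ O.ι ⁻¹ᵁ O := by simp
  obtain ⟨u, hu⟩ := D.exists_lift_vertexImm hs c (openOverι O ≫ snd _ _) fun z => hp z.2
  have h1 : openOverι O = lift (openOverι O ≫ fst _ _) (openOverι O ≫ snd _ _) := by
    rw [← comp_lift, lift_fst_snd, Category.comp_id]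
  have h2 : openOverι O ≫ (D.bigAction hs).act = mulPt
      (D.isHomogeneousSubalgebra_vertexAlgebra hs c) ((openOverι O ≫ fst _ _) ≫
        splitTorusMap 𝓡 (AddMonoidHom.inl X ℤ)) u ≫ D.vertexImm hs c := by
    rw [← lift_bigAction, hu, ← h1]
  apply appLE_ι_injective O hO
  have hle : ∀ v : openOver O ⟶ specOver 𝓡 (D.vertexAlgebra s c),
      ⊤ ≤ (v ≫ D.vertexImm hs c).left ⁻¹ᵁ D.vertexOpen s c := fun v x _ =>
    D.comp_vertexImm_mem hs c v x
  have e1 : O.ι.appLE O ⊤ hO ((D.bigAction hs).act.left.appLE _ O ha F) =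
      funOf (mulPt (D.isHomogeneousSubalgebra_vertexAlgebra hs c) ((openOverι O ≫ fst _ _) ≫
        splitTorusMap 𝓡 (AddMonoidHom.inl X ℤ)) u)
        ⟨D.vertexHom s c g, D.vertexHom_mem hs c g⟩ := by
    rw [← hF _ _ (hle _)]
    refine (appLE_apply_comp O.ι (D.bigAction hs).act.left ha hO
      (fun z _ => ha z.2) F).symm.trans ?_
    exact appLE_congr_hom (congrArg (fun v : openOver O ⟶ D.P s => v.left) h2) _ _ F
  have e2 : O.ι.appLE O ⊤ hO ((snd (splitTorus 𝓡 (X × ℤ)) (D.P s)).left.appLE _ O hp F) =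
      funOf u ⟨D.vertexHom s c g, D.vertexHom_mem hs c g⟩ := by
    rw [← hF _ _ (hle _)]
    refine (appLE_apply_comp O.ι (snd (splitTorus 𝓡 (X × ℤ)) (D.P s)).left hp hO
      (fun z _ => hp z.2) F).symm.trans ?_
    exact appLE_congr_hom (congrArg (fun v : openOver O ⟶ D.P s => v.left) hu.symm) _ _ F
  rw [map_mul, e1, e2, appLE_ι_resF, funOf_mulPt _ _ _ (D.support_vertexHom c hx),
    funOf_comp_splitTorusMap]
  rfl

end DegenerationData

end

end MaxDegeneration

namespace MaxDegeneration

noncomputable section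

open MonoidalCategory CartesianMonoidalCategory
open scoped MonObj

section Cocycle

variable {S : Scheme.{u}} {G P : Over S} [MonObj G]

/-! ### The linearization -/

lemma hom_app_smul {Z : Scheme.{u}} {M N : Z.Modules} (φ : M ⟶ N) (f : Γ(Z, ⊤)) {t : Γ(M, ⊤)}
    {t' : Γ(N, ⊤)} (h : φ.app ⊤ t = t') : φ.app ⊤ (f • t) = f • t' := by
  rw [Scheme.Modules.Hom.app_smul, h]

lemma map_pullbackSection_smul {W Z : Scheme.{u}} (g : W ⟶ Z) {M N : Z.Modules} (φ : M ⟶ N)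
    {f : Γ(Z, ⊤)} {t : Γ(M, ⊤)} {t' : Γ(N, ⊤)} (h : φ.app ⊤ t = f • t') :
    ((Scheme.Modules.pullback g).map φ).app ⊤ (pullbackSection g M t) =
      g.appTop f • pullbackSection g N t' := by
  rw [map_pullbackSection, h, pullbackSection_smul]

lemma cocycle_of_multiplicative {W Q Z : Scheme.{u}} {m b q : W ⟶ Q} {a p : Q ⟶ Z}
    (h₁ : m ≫ a = b ≫ a) (h₂ : b ≫ p = q ≫ a) (h₃ : q ≫ p = m ≫ p) {L : Z.Modules} {J : Type*}
    {e : J → Γ(L, ⊤)} (he : Detects L e)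
    (φ : (Scheme.Modules.pullback a).obj L ⟶ (Scheme.Modules.pullback p).obj L)
    (χ : J → Γ(Q, ⊤))
    (hφ : ∀ j, φ.app ⊤ (pullbackSection a L (e j)) = χ j • pullbackSection p L (e j))
    (hχ : ∀ j, m.appTop (χ j) = b.appTop (χ j) * q.appTop (χ j)) :
    (Scheme.Modules.pullback m).map φ = pullbackComparison m a b a h₁ L ≫
      (Scheme.Modules.pullback b).map φ ≫ pullbackComparison b p q a h₂ L ≫
      (Scheme.Modules.pullback q).map φ ≫ pullbackComparison q p m p h₃ L := by
  refine (he.pullback a).pullback m _ _ _ fun j => ?_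
  have e₁ := pullbackComparison_pullbackSection m a b a h₁ L (e j)
  have e₂ := map_pullbackSection_smul b φ (hφ j)
  have e₃ := hom_app_smul _ (b.appTop (χ j))
    (pullbackComparison_pullbackSection b p q a h₂ L (e j))
  have e₄ := hom_app_smul _ (b.appTop (χ j)) (map_pullbackSection_smul q φ (hφ j))
  have e₅ := hom_app_smul _ (b.appTop (χ j)) (hom_app_smul _ (q.appTop (χ j))
    (pullbackComparison_pullbackSection q p m p h₃ L (e j)))
  have e₆ := map_pullbackSection_smul m φ (hφ j)
  rw [e₆, hχ j, mul_smul]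
  generalize pullbackComparison m a b a h₁ L = c₁ at *
  generalize pullbackComparison b p q a h₂ L = c₂ at *
  generalize pullbackComparison q p m p h₃ L = c₃ at *
  generalize (Scheme.Modules.pullback b).map φ = φ₁ at *
  generalize (Scheme.Modules.pullback q).map φ = φ₂ at *
  rw [Scheme.Modules.Hom.comp_app, Scheme.Modules.Hom.comp_app, Scheme.Modules.Hom.comp_app,
    Scheme.Modules.Hom.comp_app]
  simp only [AddCommGrpCat.comp_apply]
  rw [e₁, e₂, e₃, e₄, e₅]

end Cocycle

section TorusFunctions

variable {𝓡 : Type u} [CommRing 𝓡] {Λ : Type u} [AddCommGroup Λ]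
  {P : Over (Spec (CommRingCat.of 𝓡))}

lemma funOf_fst_mul (ρ : GroupAction (splitTorus 𝓡 Λ) P) (x : Λ) :
    ((α_ (splitTorus 𝓡 Λ) (splitTorus 𝓡 Λ) P).inv ≫ μ[splitTorus 𝓡 Λ] ▷ P).left.appTop
      (funOf (fst (splitTorus 𝓡 Λ) P) (AddMonoidAlgebra.single x 1)) =
      (splitTorus 𝓡 Λ ◁ ρ.act).left.appTop
        (funOf (fst (splitTorus 𝓡 Λ) P) (AddMonoidAlgebra.single x 1)) *
      (snd (splitTorus 𝓡 Λ) (splitTorus 𝓡 Λ ⊗ P)).left.appTop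
        (funOf (fst (splitTorus 𝓡 Λ) P) (AddMonoidAlgebra.single x 1)) := by
  rw [← funOf_comp, ← funOf_comp, ← funOf_comp, whiskerLeft_fst, ← funOf_mul_single,
    Category.assoc, whiskerRight_fst, ← Category.assoc]
  have h : (α_ (splitTorus 𝓡 Λ) (splitTorus 𝓡 Λ) P).inv ≫ fst (splitTorus 𝓡 Λ ⊗ splitTorus 𝓡 Λ) P =
      lift (fst (splitTorus 𝓡 Λ) (splitTorus 𝓡 Λ ⊗ P))
        (snd (splitTorus 𝓡 Λ) (splitTorus 𝓡 Λ ⊗ P) ≫ fst (splitTorus 𝓡 Λ) P) := by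
    apply CartesianMonoidalCategory.hom_ext <;> simp
  rw [h]

end TorusFunctions

namespace DegenerationData

variable {𝓡 : Type u} [CommRing 𝓡] [IsDomain 𝓡] [IsDiscreteValuationRing 𝓡]
  {K : Type u} [Field K] [Algebra 𝓡 K] [IsFractionRing 𝓡 K] {X : Type u} [AddCommGroup X]
  (D : DegenerationData 𝓡 K X) {s : 𝓡} [Module.Free ℤ X] [Module.Finite ℤ X] [Nontrivial X]

/-- The elements of `R` that are homogeneous of degree `(x, 1)`. -/
def BihomogeneousElement (s : 𝓡) : Type u :=
  {q : X × D.satAlgebra s // q.2 ∈ D.grade s 1 ∧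
    (q.2 : AddMonoidAlgebra K (ℕ × X)).coeff.support ⊆ {(1, q.1)}}

/-- The section of `L̃` given by an element of degree `(x, 1)`. -/
def BihomogeneousElement.sectionL {D : DegenerationData 𝓡 K X} (q : D.BihomogeneousElement s) :
    Γ(D.L s, ⊤) :=
  D.sectionL s q.1.2 q.2.1

/-- The element `ζ_c` of degree `(c, 1)`. -/
def bihomogeneousZeta (s : 𝓡) (c : X) : D.BihomogeneousElement s :=
  ⟨(c, D.zeta s c), D.zeta_mem s c, Finsupp.support_single_subset⟩

lemma detects_zeta (hs : Irreducible s) :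
    Detects (D.L s) (fun c => (D.bihomogeneousZeta s c).sectionL) :=
  detects_of_isFrame (D.vertexOpen s) (D.exists_mem_vertexOpen hs) D.isFrame_sectionL_zeta

/-- The function on `(T × 𝔾_m) × P̃` given by a character. -/
def characterFun (s : 𝓡) (x : X) (n : ℤ) : Γ((splitTorus 𝓡 (X × ℤ) ⊗ D.P s).left, ⊤) :=
  funOf (fst (splitTorus 𝓡 (X × ℤ)) (D.P s)) (AddMonoidAlgebra.single (x, n) 1)

lemma characterFun_mul (x y : X) (n m : ℤ) :
    D.characterFun s x n * D.characterFun s y m = D.characterFun s (x + y) (n + m) := by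
  rw [characterFun, characterFun, ← funOf_single_add]
  rfl

lemma characterFun_zero : D.characterFun s 0 0 = 1 := funOf_single_zero _

lemma exists_act_hom_snd (hs : Irreducible s) :
    ∃ φ : (Scheme.Modules.pullback (D.bigAction hs).act.left).obj (D.L s) ⟶
      (Scheme.Modules.pullback (snd (splitTorus 𝓡 (X × ℤ)) (D.P s)).left).obj (D.L s),
      ∀ q : D.BihomogeneousElement s, φ.app ⊤ (pullbackSection _ _ q.sectionL) =
        D.characterFun s q.1.1 1 • pullbackSection _ _ q.sectionL := by
  refine exists_pullback_hom _ _ (fun q : D.BihomogeneousElement s => q.sectionL)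
    (D.bihomogeneousZeta s) (D.vertexOpen s) (D.exists_mem_vertexOpen hs)
    D.isFrame_sectionL_zeta (fun q => D.characterFun s q.1.1 1)
    (fun c => (D.bigAction_preimage_vertexOpen hs c).le) fun c q => ?_
  obtain ⟨F, hF, hF'⟩ := D.exists_vertexFunction hs c q.2.1
  refine ⟨F, hF, ?_⟩
  rw [D.bigAction_appLE hs c q.1.1 q.2.2 F hF' le_rfl (D.bigAction_preimage_vertexOpen hs c).le]
  change resF le_top (D.characterFun s (q.1.1 - c) 0) * _ * resF le_top (D.characterFun s c 1) = _
  rw [mul_right_comm, ← map_mul, characterFun_mul, sub_add_cancel, zero_add]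

lemma exists_snd_hom_act (hs : Irreducible s) :
    ∃ φ : (Scheme.Modules.pullback (snd (splitTorus 𝓡 (X × ℤ)) (D.P s)).left).obj (D.L s) ⟶
      (Scheme.Modules.pullback (D.bigAction hs).act.left).obj (D.L s),
      ∀ q : D.BihomogeneousElement s, φ.app ⊤ (pullbackSection _ _ q.sectionL) =
        D.characterFun s (-q.1.1) (-1) • pullbackSection _ _ q.sectionL := by
  refine exists_pullback_hom _ _ (fun q : D.BihomogeneousElement s => q.sectionL)
    (D.bihomogeneousZeta s) (D.vertexOpen s) (D.exists_mem_vertexOpen hs)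
    D.isFrame_sectionL_zeta (fun q => D.characterFun s (-q.1.1) (-1))
    (fun c => (D.bigAction_preimage_vertexOpen hs c).ge) fun c q => ?_
  obtain ⟨F, hF, hF'⟩ := D.exists_vertexFunction hs c q.2.1
  refine ⟨F, hF, ?_⟩
  rw [D.bigAction_appLE hs c q.1.1 q.2.2 F hF' (D.bigAction_preimage_vertexOpen hs c).ge le_rfl]
  change _ * resF le_top (D.characterFun s (-c) (-1)) =
    _ * (resF le_top (D.characterFun s (q.1.1 - c) 0) * _)
  rw [← mul_assoc, ← map_mul, characterFun_mul, mul_comm, add_zero]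
  congr 3
  abel

/-- The isomorphism `act^* L̃ ≅ pr₂^* L̃`. -/
lemma exists_act_iso_snd (hs : Irreducible s) :
    ∃ φ : (Scheme.Modules.pullback (D.bigAction hs).act.left).obj (D.L s) ≅
      (Scheme.Modules.pullback (snd (splitTorus 𝓡 (X × ℤ)) (D.P s)).left).obj (D.L s),
      ∀ q : D.BihomogeneousElement s, φ.hom.app ⊤ (pullbackSection _ _ q.sectionL) =
        D.characterFun s q.1.1 1 • pullbackSection _ _ q.sectionL := by
  obtain ⟨φ, hφ⟩ := D.exists_act_hom_snd hs
  obtain ⟨ψ, hψ⟩ := D.exists_snd_hom_act hs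
  refine ⟨⟨φ, ψ, (D.detects_zeta hs).pullback _ _ _ _ fun c => ?_,
    (D.detects_zeta hs).pullback _ _ _ _ fun c => ?_⟩, hφ⟩
  · have h := (congrArg (ψ.app ⊤) (hφ (D.bihomogeneousZeta s c))).trans
      (hom_app_smul ψ _ (hψ (D.bihomogeneousZeta s c)))
    rw [smul_smul, characterFun_mul, add_neg_cancel, add_neg_cancel, characterFun_zero,
      one_smul] at h
    exact h
  · have h := (congrArg (φ.app ⊤) (hψ (D.bihomogeneousZeta s c))).trans
      (hom_app_smul φ _ (hφ (D.bihomogeneousZeta s c)))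
    rw [smul_smul, characterFun_mul, neg_add_cancel, neg_add_cancel, characterFun_zero,
      one_smul] at h
    exact h

lemma exists_linearization (hs : Irreducible s) :
    ∃ Φ : Linearization (D.bigAction hs) (D.L s), D.IsGivenByBigrading s Φ := by
  obtain ⟨φ, hφ⟩ := D.exists_act_iso_snd hs
  refine ⟨⟨φ, cocycle_of_multiplicative _ _ _ (D.detects_zeta hs) φ.hom
    (fun c => D.characterFun s c 1) (fun c => hφ (D.bihomogeneousZeta s c))
    fun c => funOf_fst_mul (D.bigAction hs) (c, (1 : ℤ))⟩, fun x f hf hx => ?_⟩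
  exact hφ ⟨(x, f), hf, hx⟩

end DegenerationData

end

end MaxDegeneration

theorem mainTheorem8 {𝓡 : Type u} [CommRing 𝓡] [IsDomain 𝓡] [IsDiscreteValuationRing 𝓡]
    {K : Type u} [Field K] [Algebra 𝓡 K] [IsFractionRing 𝓡 K]
    {X : Type u} [AddCommGroup X] [Module.Free ℤ X] [Module.Finite ℤ X] [Nontrivial X]
    (D : DegenerationData 𝓡 K X) (s : 𝓡) (hs : Irreducible s) :
    -- `η(x, c)` is the maximum of `dA(α(σ))(x)`
    (∀ x c : X, IsGreatest (D.slopes x c) (D.eta x c)) ∧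
    -- the cone at the vertex `(c, A(c))` of `Q` is given by `x₀ ≥ η(x, c)`
    (∀ (c x : X) (x₀ : ℤ), D.eta x c ≤ x₀ ↔
      ∃ t : ℝ, 0 < t ∧ ((lat c, (D.A c : ℝ)) + t • (lat x, (x₀ : ℝ)) : RealSpan X × ℝ) ∈ D.Q) ∧
    ∃ j : ∀ c, specOver 𝓡 (D.vertexAlgebra s c) ⟶ D.P s,
      -- (i) `P̃` is covered by the `U(c) = Spec R(c)`, which are the standard open subsets `D₊(ζ_c)`
      (∃ e : ∀ c, HomogeneousLocalization.Away (D.grade s) (D.zeta s c) ≃+* D.vertexAlgebra s c,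
        (∀ (c : X) (n : ℕ) (f : D.satAlgebra s) (hf : f ∈ D.grade s (n • 1)),
          AddMonoidAlgebra.mapDomain (fun x : X => ((0, x) : ℕ × X))
            (e c (HomogeneousLocalization.Away.mk (D.grade s) (D.zeta_mem s c) n f hf) :
              AddMonoidAlgebra K X) * (D.zeta s c : AddMonoidAlgebra K (ℕ × X)) ^ n = f) ∧
        ∀ c, (j c).left = Spec.map (CommRingCat.ofHom (e c).toRingHom) ≫
          Proj.awayι (D.grade s) (D.zeta s c) (D.zeta_mem s c) one_pos) ∧
      (∀ c, IsOpenImmersion (j c).left) ∧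
      (∀ p : (D.P s).left, ∃ c, p ∈ Set.range (j c).left) ∧
      -- (ii) the basis of `R(c)`
      (∀ c, ∃ ζ : Module.Basis X 𝓡 (D.vertexAlgebra s c),
        ∀ x, (ζ x : AddMonoidAlgebra K X) = monomial 𝓡 s K x ⌈D.eta x c⌉) ∧
      -- (iii) isomorphisms and finiteness
      (∀ c c', Nonempty (D.vertexAlgebra s c ≃ₐ[𝓡] D.vertexAlgebra s c')) ∧
      (∀ c, Algebra.FiniteType 𝓡 (D.vertexAlgebra s c)) ∧
      LocallyOfFiniteType (D.P s).hom ∧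
      -- (v), first part: `Δ` is a fan, which contains the cones `Δ(c)`
      IsFan D.fan ∧
      ∃ hΔ : ∀ c, D.coneAt c ∈ D.fan,
      -- (iv) `Spec R(c)` is the affine torus embedding given by `Δ(c)`
      ∃ hc : ∀ c, coneAlgebra 𝓡 s K (D.coneAt c) = D.vertexAlgebra s c,
      -- (v) `P̃` is the torus embedding given by `Δ`, compatibly with the maps `U(c) → P̃`
      (∃ E : TorusEmbedding s K D.fan (D.P s),
        (∀ c, specOverMap (Subalgebra.inclusion (hc c).le) ≫ E.chart ⟨D.coneAt c, hΔ c⟩ = j c) ∧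
        ∃ E' : TorusEmbedding s K halfLineFan (Over.mk (𝟙 (Spec (CommRingCat.of 𝓡)))),
          IsToricMorphism E E' (0 : PUnit.{u + 1} →ₗ[ℤ] X) (Over.homMk (D.P s).hom)) ∧
      -- (vi) `L̃` is invertible and ample
      IsInvertibleSheaf (D.L s) ∧
      IsAmpleSheaf (D.L s) ∧
      -- (vii) the action of `T` on `P̃` and the compatible action of `T × 𝔾_m` on `L̃`
      ∃ (ρ : GroupAction (splitTorus 𝓡 X) (D.P s))
        (ρ' : GroupAction (splitTorus 𝓡 (X × ℤ)) (D.P s)) (Φ : Linearization ρ' (D.L s)),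
        D.IsGivenByGrading s j ρ ∧
        ρ'.act = splitTorusMap 𝓡 (AddMonoidHom.inl X ℤ) ▷ D.P s ≫ ρ.act ∧
        D.IsGivenByBigrading s Φ := by
  have hpow : ∀ (n : ℕ) (f : D.satAlgebra s), f ∈ D.grade s (n • 1) → f ∈ D.grade s n := by
    intro n f hf
    rwa [nsmul_one] at hf
  obtain ⟨Φ, hΦ⟩ := D.exists_linearization hs
  refine ⟨D.isGreatest_eta, fun c x x₀ => ?_, D.vertexImm hs,
    ⟨D.vertexEquiv hs, fun c n f hf => ?_, D.vertexImm_left hs⟩, D.isOpenImmersion_vertexImm hs,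
    fun p => ?_, D.exists_basis_vertexAlgebra hs, D.nonempty_vertexAlgebra_equiv hs,
    D.finiteType_vertexAlgebra hs, D.locallyOfFiniteType_P hs, D.isFan_fan, D.coneAt_mem_fan,
    D.vertexAlgebra_eq, ⟨D.torusEmbedding hs, D.vertexImm_eq_fanChart hs, _,
      D.isToricMorphism_structure hs⟩, (D.isAmpleSheaf_L hs).1, D.isAmpleSheaf_L hs,
    D.action hs, D.bigAction hs, Φ, D.isGivenByGrading_action hs, rfl, hΦ⟩
  · simp only [D.eta_le_iff, pairing_eq]
    exact D.cone_dual_iff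
  · rw [D.vertexEquiv_mk hs c n f hf]
    exact D.mapDomain_vertexHom hs c (hpow n f hf)
  · obtain ⟨c, hc⟩ := D.exists_mem_vertexOpen hs p
    refine ⟨c, ?_⟩
    rw [D.range_vertexImm hs]
    exact hc
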